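/- Words are over the ternary alphabet $\Sigma_3=\{0,1,2\}$. A finite word $w$ is rich if it has $|w|+1$ distinct palindromic factors (including the empty word); an infinite word is rich if all of its finite factors are rich. A finite word $w$ has period $p$ (where $1\le p\le |w|$) if $w_{i+p}=w_i$ for all $0\le i<|w|-p$, and then $|w|/p$ is an exponent of $w$; an infinite word is $16/7$-power-free if none of its finite factors has an exponent $\ge 16/7$. Let $f$ and $g$ be the morphisms with $$f(0)=01,\quad f(1)=022,\quad f(2)=02,\qquad g(0)=20,\quad g(1)=21,\quad g(2)=2,$$ extended letter by letter to infinite words, and let $f^\omega(0)$ be the infinite word that has every $f^n(0)$, $n\ge 0$, as a prefix. For an infinite word $w=w_0w_1w_2\cdots$ put $\tau(w)=t_1(w_0)\,t_2(w_1)\,t_1(w_2)\,t_2(w_3)\cdots$, where $$t_1(0)=001,\quad t_1(1)=00101101,\quad t_1(2)=0010110100101101,$$ $$t_2(0)=002,\quad t_2(1)=00202202,\quad t_2(2)=0020220200202202.$$ Theorem 2 (Structure Theorem). Let $\mathbf{z}\in\Sigma_3^\omega$ be a $16/7$-power-free rich infinite word. Then for every $n\ge 0$ there are an infinite word $\mathbf{x}_n\in\Sigma_3^\omega$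 and a permutation $\pi_n$ of $\Sigma_3$ such that the word obtained from $\tau(g(f^n(\mathbf{x}_n)))$ by applying $\pi_n$ to every letter is a suffix of $\mathbf{z}$. In particular, there is a permutation $\pi$ of $\Sigma_3$ such that every finite factor of the word obtained from $\tau(g(f^\omega(0)))$ by applying $\pi$ to every letter is a factor of $\mathbf{z}$. -/

import Mathlib

/-! Infinite words over an alphabet `A` are functions `ℕ → A`; finite words are lists.
The ternary alphabet `{0, 1, 2}` is `Fin 3`. -/

namespace TernaryRich

/-- The factor of length `n` of the infinite word `w` that starts at position `k`. -/
def segment {A : Type*} (w : ℕ → A) (k n : ℕ) : List A :=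
  List.ofFn (fun i : Fin n => w (k + i))

/-- The finite word `u` is a factor of the infinite word `w`. -/
def IsFactor {A : Type*} (u : List A) (w : ℕ → A) : Prop :=
  ∃ k n : ℕ, u = segment w k n

/-- The suffix of the infinite word `w` obtained by deleting its first `k` letters. -/
def suffix {A : Type*} (w : ℕ → A) (k : ℕ) : ℕ → A :=
  fun i => w (k + i)

/-- `p` is a period of the finite word `u`: `1 ≤ p ≤ |u|` and `u_{i+p} = u_i` for all
`0 ≤ i < |u| - p`. -/
def IsPeriod {A : Type*} (u : List A) (p : ℕ) : Prop :=
  1 ≤ p ∧ p ≤ u.length ∧ ∀ i : ℕ, i + p < u.length → u[i + p]? = u[i]?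

/-- The number `r` is an exponent of the finite word `u`: `r = |u| / p` for a period `p`. -/
def HasExponent {A : Type*} (u : List A) (r : ℝ) : Prop :=
  ∃ p : ℕ, IsPeriod u p ∧ r = (u.length : ℝ) / (p : ℝ)

/-- The infinite word `w` is `α`-power-free: none of its factors has an exponent `≥ α`. -/
def PowerFree {A : Type*} (α : ℝ) (w : ℕ → A) : Prop :=
  ∀ u : List A, IsFactor u w → ¬ ∃ r : ℝ, HasExponent u r ∧ α ≤ r

/-- A finite word is rich if it has `|u| + 1` distinct palindromes (including the empty word)
as factors. -/
def IsRich {A : Type*} (u : List A) : Prop :=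
  {p : List A | p <:+: u ∧ p.reverse = p}.ncard = u.length + 1

/-- An infinite word is rich if all of its finite factors are rich. -/
def IsRichInf {A : Type*} (w : ℕ → A) : Prop :=
  ∀ u : List A, IsFactor u w → IsRich u

/-- The infinite concatenation `B 0 ++ B 1 ++ B 2 ++ ⋯` of a sequence of blocks. It is meant for
nonempty blocks, where the first `i + 1` blocks have at least `i + 1` letters in total, so that the
default letter is never used. -/
def infConcat (B : ℕ → List (Fin 3)) : ℕ → Fin 3 :=
  fun i => ((List.range (i + 1)).flatMap B).getD i 0

/-- The morphism `Σ₃* → Σ₃*` with letter images `h`, applied to a finite word. -/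
def applyFin (h : Fin 3 → List (Fin 3)) (u : List (Fin 3)) : List (Fin 3) :=
  u.flatMap h

/-- The morphism with (nonempty) letter images `h`, extended to infinite words. -/
def applyInf (h : Fin 3 → List (Fin 3)) (x : ℕ → Fin 3) : ℕ → Fin 3 :=
  infConcat (fun i => h (x i))

/-- Letter images of `f`: `0 ↦ 01`, `1 ↦ 022`, `2 ↦ 02`. -/
def f : Fin 3 → List (Fin 3) := ![[0, 1], [0, 2, 2], [0, 2]]

/-- Letter images of `g`: `0 ↦ 20`, `1 ↦ 21`, `2 ↦ 2`. -/
def g : Fin 3 → List (Fin 3) := ![[2, 0], [2, 1], [2]]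

/-- Output of the transducer `τ` on a letter read in state `1`. -/
def t₁ : Fin 3 → List (Fin 3) :=
  ![[0, 0, 1],
    [0, 0, 1, 0, 1, 1, 0, 1],
    [0, 0, 1, 0, 1, 1, 0, 1, 0, 0, 1, 0, 1, 1, 0, 1]]

/-- Output of the transducer `τ` on a letter read in state `2`. -/
def t₂ : Fin 3 → List (Fin 3) :=
  ![[0, 0, 2],
    [0, 0, 2, 0, 2, 2, 0, 2],
    [0, 0, 2, 0, 2, 2, 0, 2, 0, 0, 2, 0, 2, 2, 0, 2]]

/-- The transducer `τ` on infinite words: it starts in state `1` and changes its state with every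
input letter, so `τ(w) = t₁(w₀) t₂(w₁) t₁(w₂) t₂(w₃) ⋯`. -/
def tau (w : ℕ → Fin 3) : ℕ → Fin 3 :=
  infConcat (fun i => if Even i then t₁ (w i) else t₂ (w i))

/-- The infinite word `f^ω(0)`, whose prefixes include all the words `f^n(0)`. Its letter number
`i` is read off from `f^i(0)`, which has more than `i` letters. -/
def fOmega : ℕ → Fin 3 :=
  fun i => ((applyFin f)^[i] [0]).getD i 0

end TernaryRich

namespace TernaryRich

/-! ### Labelled words

A labelled alphabet is a finite set of letters, coded by natural numbers; a letter `a` leads from the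
state `src a` to the state `dst a`, and its reversal `rv a` leads back. -/

/-! A word is rich exactly when each of its factors has a palindromic suffix that occurs in that
factor only once. Hence the factor from an occurrence of a word to the next occurrence of its
reversal is a palindrome, if the word itself does not recur in between (`Rich.return_pal`). Only
suffixes of z matter, so a word that eventually stops occurring may be treated as forbidden. If only
three letters can follow a palindrome, the letters after its successive occurrences form a walk on a
triangle that leaves a vertex along the edge by which it will come back. Such a walk cannot use all
three edges infinitely often, so two of the letters eventually stop meeting around the palindrome
(`Rich.triangle`).

For the empty palindrome this allows 12 to be forbidden, after a permutation of the letters, and the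
word is cut at the letter 0 into 0, 01, 011, 02, 022. For the palindrome 0 one of 001, 102, 002 dies
out. Finite searches refute the first and the last case; in the remaining one they show that the
word of return words is cut again by two palindromic markers, 01210 and 03430. The blocks form six
letters, three in each of two states. The triangle argument in both states, with more searches, then
shows that a word over these letters is from some point on an image under f, with states. After one
such step, spelling out all blocks gives the blocks of τ∘g, the state being the parity of the
transducer.

The step can be repeated because its hypotheses are inherited. Richness passes to the decoded word
since markers are palindromes and the coding respects reversal (`Coding.Decodes.rich`). The bound
16/7 becomes a bound on weights: a letter weighs as much as its code word, and a run gains the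
weight of the marker that closes it and of what different code words have in common at its ends
(`Coding.Decodes.powerBound`). The weights that arise under f stay in a cone with three generators,
because the weight map has the characteristic equation x³ = 2x² + 1. One search that respects all of
this cone therefore serves all levels (`ConeBound.step`, `sieve_cone`). The searches are a function
evaluated by the kernel; `search_sound` justifies them.

For the last claim, one permutation serves infinitely many n, and f^n(x) agrees with the fixed point
of f on its first n letters, whatever x is. -/

structure Alphabet where
  size : ℕ
  src : ℕ → ℕ
  dst : ℕ → ℕ
  rv : ℕ → ℕ
  rv_lt : ∀ a < size, rv a < size
  rv_rv : ∀ a < size, rv (rv a) = a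
  src_rv : ∀ a < size, src (rv a) = dst a

namespace Alphabet
variable (S : Alphabet)

theorem dst_rv {a : ℕ} (h : a < S.size) : S.dst (S.rv a) = S.src a := by
  rw [← S.src_rv _ (S.rv_lt a h), S.rv_rv a h]

/-- `y` spells a path. -/
def IsPath (y : ℕ → ℕ) : Prop :=
  ∀ i, y i < S.size ∧ S.dst (y i) = S.src (y (i + 1))

/-- The factor of `y` between the boundaries `p` and `e` is a palindrome. -/
def Pal (y : ℕ → ℕ) (p e : ℕ) : Prop :=
  ∀ a b, p ≤ a → p ≤ b → a + b + 1 = p + e → y b = S.rv (y a)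

/-- The factors of length `n` that start at `s` and at `t` are equal as labelled words. -/
def Same (y : ℕ → ℕ) (s t n : ℕ) : Prop :=
  S.src (y s) = S.src (y t) ∧ ∀ j < n, y (s + j) = y (t + j)

/-- Every factor has a palindromic suffix that occurs in it only once. -/
def Rich (y : ℕ → ℕ) : Prop :=
  ∀ i e, i ≤ e → ∃ p, i ≤ p ∧ p ≤ e ∧ S.Pal y p e ∧
    ∀ t, i ≤ t → t < p → ¬ S.Same y t p (e - p)

/-- The factor between `i` and `e` has period `q`. -/
def Run (y : ℕ → ℕ) (i e q : ℕ) : Prop :=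
  1 ≤ q ∧ i + q ≤ e ∧ S.src (y i) = S.src (y (i + q)) ∧ ∀ a, i ≤ a → a + q < e → y a = y (a + q)

/-- The word of the reversed factor. -/
def revWord (u : List ℕ) : List ℕ := (u.map S.rv).reverse

end Alphabet

/-! ### Weights and occurrences of factors. -/

/-- The total weight of the factor between `i` and `e`. -/
def wsum (w : ℕ → ℕ) (y : ℕ → ℕ) (i e : ℕ) : ℕ := ∑ a ∈ Finset.Ico i e, w (y a)

theorem wsum_self (w y : ℕ → ℕ) (i : ℕ) : wsum w y i i = 0 := by simp [wsum]

theorem wsum_succ (w y : ℕ → ℕ) {i e : ℕ} (h : i ≤ e) :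
    wsum w y i (e + 1) = wsum w y i e + w (y e) := Finset.sum_Ico_succ_top h _

theorem wsum_add (w y : ℕ → ℕ) {i j e : ℕ} (h : i ≤ j) (h' : j ≤ e) :
    wsum w y i j + wsum w y j e = wsum w y i e := Finset.sum_Ico_consecutive _ h h'

theorem wsum_cons (w y : ℕ → ℕ) {i e : ℕ} (h : i < e) :
    wsum w y i e = w (y i) + wsum w y (i + 1) e := Finset.sum_eq_sum_Ico_succ_bot h _

theorem wsum_shift (w y : ℕ → ℕ) (i e k : ℕ) :
    wsum w (fun t => y (k + t)) i e = wsum w y (k + i) (k + e) := by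
  simp only [wsum, Finset.sum_Ico_add (fun t => w (y t)) i e k, add_comm]

/-- The word `u` occurs in `y` at position `i`. -/
def Occ {A : Type*} (y : ℕ → A) : List A → ℕ → Prop
  | [], _ => True
  | a :: u, i => y i = a ∧ Occ y u (i + 1)

theorem occ_append {A : Type*} (y : ℕ → A) (u v : List A) (i : ℕ) :
    Occ y (u ++ v) i ↔ Occ y u i ∧ Occ y v (i + u.length) := by
  induction u generalizing i with
  | nil => simp [Occ]
  | cons a u ih => simp [Occ, ih, and_assoc, add_assoc, add_comm 1]

theorem occ_iff {A : Type*} (y : ℕ → A) (u : List A) (i : ℕ) :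
    Occ y u i ↔ ∀ j (h : j < u.length), y (i + j) = u[j] := by
  induction u generalizing i with
  | nil => simp [Occ]
  | cons a u ih =>
    simp only [Occ, ih]
    constructor
    · rintro ⟨h1, h2⟩ j hj
      cases j with
      | zero => simpa using h1
      | succ j => simpa [add_assoc, add_comm 1] using h2 j (by simpa using hj)
    · intro h
      refine ⟨h 0 (by simp), fun j hj => ?_⟩
      rw [add_assoc, add_comm 1]
      exact h (j + 1) (by simpa using hj)

theorem occ_shift {A : Type*} (y : ℕ → A) (u : List A) (k i : ℕ) :
    Occ (fun t => y (k + t)) u i ↔ Occ y u (k + i) := by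
  simp [occ_iff, add_assoc]

/-- The word `u` does not occur in `y`. -/
def Avoids (y : ℕ → ℕ) (u : List ℕ) : Prop := ∀ i, ¬ Occ y u i

/-- `7/16` of any run, together with what overlaps and the mismatches add to it, is lighter than a
period. -/
def Alphabet.PowerBound (S : Alphabet) (w : ℕ → ℕ) (lam : ℕ) (ε : ℕ → ℕ → ℕ) (y : ℕ → ℕ) : Prop :=
  ∀ i e q l r, S.Run y i e q →
    (l = 0 ∨ ∃ i', i = i' + 1 ∧ l = ε (y i') (y (i' + q))) →
    (r = 0 ∨ r = ε (y e) (y (e - q))) →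
    7 * (wsum w y i e + lam + l + r) < 16 * wsum w y (e - q) e

namespace Alphabet
variable {S : Alphabet} {y : ℕ → ℕ}

theorem IsPath.shift (h : S.IsPath y) (k : ℕ) : S.IsPath (fun t => y (k + t)) := fun i => by
  simpa [add_assoc] using h (k + i)

theorem pal_shift (k p e : ℕ) : S.Pal (fun t => y (k + t)) p e ↔ S.Pal y (k + p) (k + e) := by
  constructor
  · intro h a b ha hb hab
    obtain ⟨a, rfl⟩ := Nat.exists_eq_add_of_le (show k ≤ a by omega)
    obtain ⟨b, rfl⟩ := Nat.exists_eq_add_of_le (show k ≤ b by omega)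
    exact h a b (by omega) (by omega) (by omega)
  · intro h a b ha hb hab
    exact h (k + a) (k + b) (by omega) (by omega) (by omega)

theorem Rich.shift (h : S.Rich y) (k : ℕ) : S.Rich (fun t => y (k + t)) := by
  intro i e hie
  obtain ⟨p, hp, hpe, hpal, hu⟩ := h (k + i) (k + e) (by omega)
  obtain ⟨p, rfl⟩ := Nat.exists_eq_add_of_le (show k ≤ p by omega)
  refine ⟨p, by omega, by omega, (pal_shift ..).2 hpal, fun t ht htp hs => ?_⟩
  refine hu (k + t) (by omega) (by omega) ⟨hs.1, fun j hj => ?_⟩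
  simpa [add_assoc] using hs.2 j (by omega)

theorem PowerBound.shift {w : ℕ → ℕ} {lam : ℕ} {ε : ℕ → ℕ → ℕ} (h : S.PowerBound w lam ε y)
    (k : ℕ) : S.PowerBound w lam ε (fun t => y (k + t)) := by
  intro i e q l r hr hl hr'
  rw [wsum_shift, wsum_shift]
  have hq := hr.2.1
  rw [show k + (e - q) = k + e - q by omega]
  refine h (k + i) (k + e) q l r ⟨hr.1, by omega, ?_, fun a ha hae => ?_⟩ ?_ ?_
  · simpa [add_assoc] using hr.2.2.1
  · obtain ⟨a, rfl⟩ := Nat.exists_eq_add_of_le (show k ≤ a by omega)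
    simpa [add_assoc] using hr.2.2.2 a (by omega) (by omega)
  · rcases hl with hl | ⟨i', rfl, hl⟩
    · exact .inl hl
    · exact .inr ⟨k + i', rfl, by simpa [add_assoc] using hl⟩
  · rcases hr' with hr' | hr'
    · exact .inl hr'
    · exact .inr (by rw [show k + e - q = k + (e - q) by omega]; exact hr')

theorem IsPath.src_eq_of_lt (h : S.IsPath y) {s t n j : ℕ} (hs : S.Same y s t n) (hj : j ≤ n) :
    S.src (y (s + j)) = S.src (y (t + j)) := by
  cases j with
  | zero => exact hs.1
  | succ j =>
    rw [← add_assoc, ← add_assoc, ← (h _).2, ← (h _).2, hs.2 j (by omega)]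

theorem Same.mono (h : S.IsPath y) {s t n a m : ℕ} (hs : S.Same y s t n) (ham : a + m ≤ n) :
    S.Same y (s + a) (t + a) m :=
  ⟨h.src_eq_of_lt hs (by omega), fun j hj => by
    simpa [add_assoc] using hs.2 (a + j) (by omega)⟩

/-- In a rich word, the factor from a word `x` to the next occurrence of `x` or of its reversal is a
palindrome if that occurrence is one of the reversal. -/
theorem Rich.return_pal (hp : S.IsPath y) (hR : S.Rich y) {i i' m : ℕ} (hii : i ≤ i')
    (hrev : ∀ j < m, y (i' + m - 1 - j) = S.rv (y (i + j)))
    (hst : S.src (y i) = S.src (y (i' + m)))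
    (h1 : ∀ t, i < t → t < i' → ¬ S.Same y t i m) :
    S.Pal y i (i' + m) := by
  obtain ⟨p, hip, hpe, hpal, hu⟩ := hR i (i' + m) (by omega)
  rcases Nat.eq_or_lt_of_le hip with rfl | hlt
  · exact hpal
  exfalso
  by_cases hm : i' ≤ p
  · -- the palindrome is a suffix of the reversal, hence a prefix of `x`
    refine hu i le_rfl hlt ⟨?_, fun j hj => ?_⟩
    · rcases Nat.eq_or_lt_of_le hpe with rfl | h
      · exact hst
      · have h2 := hpal p (i' + m - 1) le_rfl (by omega) (by omega)
        have h3 := hst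
        rw [show i' + m = i' + m - 1 + 1 by omega, ← (hp _).2, h2, S.dst_rv (hp _).1] at h3
        exact h3
    · have h2 := hpal (p + j) (i' + m - 1 - j) (by omega) (by omega) (by omega)
      rw [hrev j (by omega)] at h2
      have := congrArg S.rv h2
      rwa [S.rv_rv _ (hp _).1, S.rv_rv _ (hp _).1] at this
  -- Here the palindrome contains the whole reversal at its end; mirrored, this is an occurrence of
  -- `x` at `p`.
  · refine h1 p hlt (by omega) ⟨?_, fun j hj => ?_⟩
    · have h2 := hpal p (i' + m - 1) le_rfl (by omega) (by omega)
      have h3 := hst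
      rw [show i' + m = i' + m - 1 + 1 by omega, ← (hp _).2, h2, S.dst_rv (hp _).1] at h3
      exact h3.symm
    · have h2 := hpal (p + j) (i' + m - 1 - j) (by omega) (by omega) (by omega)
      rw [hrev j (by omega)] at h2
      have := congrArg S.rv h2
      rw [S.rv_rv _ (hp _).1, S.rv_rv _ (hp _).1] at this
      exact this.symm

end Alphabet

/-! ### Words that eventually stop occurring. -/

open Filter

/-- Eventually, the word `u` does not occur in `y`. -/
def EvAvoids (y : ℕ → ℕ) (u : List ℕ) : Prop := ∀ᶠ i in atTop, ¬ Occ y u i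

namespace Alphabet
variable {S : Alphabet} {y : ℕ → ℕ}

theorem occ_revWord_iff (u : List ℕ) (i : ℕ) :
    Occ y (S.revWord u) i ↔ ∀ j (h : j < u.length), y (i + (u.length - 1 - j)) = S.rv u[j] := by
  rw [occ_iff]
  simp only [revWord, List.length_reverse, List.length_map, List.getElem_reverse, List.getElem_map]
  constructor
  · intro h j hj
    rw [h _ (by omega)]
    congr 2; omega
  · intro h j hj
    have := h (u.length - 1 - j) (by omega)
    rwa [show u.length - 1 - (u.length - 1 - j) = j by omega] at this

/-- Words that eventually disappear are closed under reversal. -/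
theorem EvAvoids.rev (hp : S.IsPath y) (hR : S.Rich y) {u : List ℕ} (hu : u ≠ [])
    (hs : ∀ a ∈ u, a < S.size) (h : EvAvoids y u) : EvAvoids y (S.revWord u) := by
  by_contra hc
  rw [EvAvoids, not_eventually] at hc
  obtain ⟨N, hN⟩ := eventually_atTop.1 h
  obtain ⟨i, hi, ho⟩ := (frequently_atTop.1 hc) N
  obtain ⟨i', hi', ho'⟩ := (frequently_atTop.1 hc) (i + 1)
  rw [not_not, occ_revWord_iff] at ho ho'
  have hl : 0 < u.length := List.length_pos_of_ne_nil hu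
  -- Between two late occurrences of the reversal, the palindromic suffix that occurs once cannot
  -- lie inside the second one, since it would also end the first. So it contains the second one and
  -- mirrors it to an occurrence of `u` at `p`.
  obtain ⟨p, hip, hpe, hpal, hun⟩ := hR i (i' + u.length) (by omega)
  by_cases hm : i' ≤ p
  · have hsame : S.Same y i i' u.length := by
      have key : ∀ j < u.length, y (i + j) = y (i' + j) := fun j hj => by
        have h1 := ho (u.length - 1 - j) (by omega)
        have h2 := ho' (u.length - 1 - j) (by omega)
        rw [show u.length - 1 - (u.length - 1 - j) = j by omega] at h1 h2
        rw [h1, h2]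
      exact ⟨by simpa using congrArg S.src (key 0 hl), key⟩
    obtain ⟨d, rfl⟩ := Nat.exists_eq_add_of_le hm
    exact hun (i + d) (by omega) (by omega) (hsame.mono hp (by omega))
  · refine hN p (by omega) ((occ_iff ..).2 fun j hj => ?_)
    have h1 := ho' j hj
    have h2 := hpal (p + j) (i' + (u.length - 1 - j)) (by omega) (by omega) (by omega)
    rw [h2] at h1
    have h3 := congrArg S.rv h1
    rwa [S.rv_rv _ (hp _).1, S.rv_rv _ (hs _ (List.getElem_mem hj))] at h3

end Alphabet
end TernaryRich

namespace TernaryRich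

/-! ### An exhaustive search for words with forbidden factors

The search is meant to be evaluated by the kernel: it is written with recursors, and the numbers in
it are raw literals. A word under examination is stored in one number `W` with a group of eight bits
for each boundary: the bits `0`-`5` tell the letter before the boundary, the bits `6` and `7` the
state there. -/

/-- `code` is the group of bits that the letter adds to `W`. An entry of `bad` is what a forbidden
word ending in this letter demands of the letters before it, read backwards. -/
structure Letter where
  id : ℕ
  rv : ℕ
  dst : ℕ
  wt : ℕ
  code : ℕ
  bad : List (List ℕ)

/-- `next` is indexed by the last letter read; its rows 6 and 7 serve the two states in which a
search can begin. -/
structure Params where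
  mask : ℕ
  viol : ℕ → ℕ → ℕ → Bool
  next : List (List Letter)

noncomputable def startsWith (u : List ℕ) : List ℕ → Bool :=
  List.rec (fun _ => true)
    (fun a _ ih w => List.rec false
      (fun b w' _ => @Bool.rec (fun _ => Bool) false (ih w') (Nat.beq a b)) w) u

noncomputable def hits (U : List (List ℕ)) (w : List ℕ) : Bool :=
  List.rec false (fun u _ ih => @Bool.rec (fun _ => Bool) ih true (startsWith u w)) U

noncomputable def keep (top l o : ℕ) (r : List (ℕ × ℕ)) : List (ℕ × ℕ) :=
  @Bool.rec (fun _ => List (ℕ × ℕ)) r ((Nat.add l (nat_lit 2), o) :: r) (Nat.ble top o)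

/-- A palindromic suffix of length at least two is one of the shorter word with a letter put on
either side. In an entry `(l, o)` the bits of `o` mark ends of occurrences of the palindrome of
length `l`. The three conjuncts ask that the inner palindrome end one letter earlier, that the last
letter be right and that the first letter be its reversal. -/
noncomputable def updPals (A B top : ℕ) (base pals : List (ℕ × ℕ)) : List (ℕ × ℕ) :=
  List.rec base (fun a _ ih => Prod.rec (fun l o =>
    keep top l (Nat.land (Nat.shiftLeft o (nat_lit 8))
      (Nat.land A (Nat.shiftLeft B (Nat.mul (nat_lit 8) (Nat.succ l))))) ih) a) pals

noncomputable def isMis (mask v : ℕ) : Bool :=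
  Nat.beq (nat_lit 1) (Nat.mod (Nat.shiftRight mask v) (nat_lit 2))

/-- `runs` holds periods of runs that a mismatch on the right, if it counts, would make too heavy.
-/
noncomputable def badRuns (n W code mask : ℕ) (runs : List ℕ) : Bool :=
  List.rec false (fun q _ ih =>
    @Bool.rec (fun _ => Bool) ih true (isMis mask (Nat.mod (Nat.xor code
      (Nat.shiftRight W (Nat.mul (nat_lit 8) (Nat.sub n q)))) (nat_lit 64)))) runs

noncomputable def field (PS tot j : ℕ) : ℕ :=
  Nat.sub tot (Nat.mod (Nat.shiftRight PS (Nat.mul (nat_lit 42) j)) (nat_lit 4398046511104))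

noncomputable def extendStep (j v : ℕ) (halt : ℕ → ℕ → Bool) (ih : Bool) : Bool :=
  @Bool.rec (fun _ => Bool) (halt (Nat.succ j) v) ih (Nat.beq v (nat_lit 0))

/-- The run is prolonged to the left while the period lasts. What `halt` receives is the place
reached and the exclusive or of the two differing letters, or `0` at the beginning of the word. -/
noncomputable def extendLeft (W q : ℕ) (halt : ℕ → ℕ → Bool) (j : ℕ) : Bool :=
  Nat.rec (halt (nat_lit 0) (nat_lit 0))
    (fun j ih => extendStep j (Nat.mod (Nat.xor
      (Nat.shiftRight W (Nat.mul (nat_lit 8) (Nat.succ j)))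
      (Nat.shiftRight W (Nat.mul (nat_lit 8) (Nat.add (Nat.succ j) q)))) (nat_lit 64)) halt ih) j

/-- A run that is already too heavy closes the branch. One that is too heavy only with a further
mismatch is put on guard for the next letter. -/
noncomputable def classify (viol : ℕ → ℕ → ℕ → Bool) (q : ℕ) (K : List ℕ → Bool) (acc : List ℕ)
    (r p t : ℕ) : Bool :=
  @Bool.rec (fun _ => Bool)
    (@Bool.rec (fun _ => Bool) (K acc) (K (q :: acc)) (viol r p (Nat.succ t)))
    true (viol r p t)

noncomputable def stopAt (viol : ℕ → ℕ → ℕ → Bool) (mask PS tot p q : ℕ) (K : List ℕ → Bool)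
    (acc : List ℕ) (j v : ℕ) : Bool :=
  classify viol q K acc (field PS tot j) p
    (@Bool.rec (fun _ => ℕ) (nat_lit 0) (nat_lit 1) (isMis mask v))

/-- The six extra bits of the shifts drop the letter before each left boundary but keep the state
there, so one comparison of numbers tests the initial state and all the letters. -/
noncomputable def isRun (W q j i : ℕ) : Bool :=
  Nat.beq (Nat.shiftRight W (Nat.add (Nat.mul (nat_lit 8) (Nat.add j q)) (nat_lit 6)))
    (Nat.shiftRight (Nat.mod W (Nat.pow (nat_lit 2) (Nat.mul (nat_lit 8) (Nat.succ i))))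
      (Nat.add (Nat.mul (nat_lit 8) j) (nat_lit 6)))

noncomputable def addTrueRun (viol : ℕ → ℕ → ℕ → Bool) (mask W PS tot q i j : ℕ)
    (K : List ℕ → Bool) (acc : List ℕ) : Bool :=
  @Bool.rec (fun _ => Bool) (K acc)
    (extendLeft W q (stopAt viol mask PS tot (field PS tot i) q K acc) j) (isRun W q j i)

noncomputable def addRun (viol : ℕ → ℕ → ℕ → Bool) (mask n W PS tot l q₀ q : ℕ)
    (K : ℕ → List ℕ → Bool) (acc : List ℕ) : Bool :=
  @Bool.rec (fun _ => Bool)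
    (addTrueRun viol mask W PS tot q (Nat.sub n q) (Nat.sub n l) (K q) acc) (K q₀ acc) (Nat.beq q q₀)

/-- The candidates for periods are the differences of the lengths of consecutive palindromic
suffixes; equal successive differences belong to the same run. Each candidate is tested, so
soundness does not depend on finding every period. -/
noncomputable def newRuns (viol : ℕ → ℕ → ℕ → Bool) (mask n W PS tot : ℕ) (K : List ℕ → Bool)
    (pals : List (ℕ × ℕ)) : ℕ → ℕ → List ℕ → Bool :=
  List.rec (fun _ _ => K) (fun a _ ih l q₀ =>
    addRun viol mask n W PS tot l q₀ (Nat.sub l a.1) (ih a.1)) pals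

/-- The branch dies if the longest palindromic suffix is marked anywhere but at the very end. From
weight `2 ^ 42` on the packed prefix sums would overflow, and the search gives up with `false`. -/
noncomputable def checkPals (P : Params)
    (ih : ℕ → ℕ → ℕ → ℕ → ℕ → List ℕ → List (ℕ × ℕ) → List ℕ → Bool)
    (n W ones PS tot top : ℕ) (w : List ℕ) (pals : List (ℕ × ℕ)) : Bool :=
  List.rec true (fun h t _ => @Bool.rec (fun _ => Bool) true
    (@Bool.rec (fun _ => Bool) 
      (newRuns P.viol P.mask n W PS tot (ih n W ones PS tot w pals) t h.1 (nat_lit 0) [])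
      false (Nat.ble (nat_lit 4398046511104) tot))
    (Nat.beq h.2 top)) pals

noncomputable def basePals (W id rv dst ones : ℕ) : List (ℕ × ℕ) :=
  @Bool.rec (fun _ => List (ℕ × ℕ))
    [(nat_lit 0, Nat.land (Nat.shiftRight W (Nat.add (nat_lit 6) dst)) ones)]
    [(nat_lit 1, Nat.land (Nat.shiftRight W id) ones),
      (nat_lit 0, Nat.land (Nat.shiftRight W (Nat.add (nat_lit 6) dst)) ones)] (Nat.beq id rv)

noncomputable def extendPals (P : Params)
    (ih : ℕ → ℕ → ℕ → ℕ → ℕ → List ℕ → List (ℕ × ℕ) → List ℕ → Bool)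
    (n W ones PS tot dst top id rv : ℕ) (w : List ℕ) (pals : List (ℕ × ℕ)) : Bool :=
  checkPals P ih n W ones (Nat.add PS (Nat.shiftLeft tot (Nat.mul (nat_lit 42) n))) tot top w
    (updPals (Nat.shiftRight W id) (Nat.shiftRight W rv) top (basePals W id rv dst ones) pals)

noncomputable def extendWord (P : Params)
    (ih : ℕ → ℕ → ℕ → ℕ → ℕ → List ℕ → List (ℕ × ℕ) → List ℕ → Bool)
    (n W ones PS tot dst top id rv code wt : ℕ) (w : List ℕ) (pals : List (ℕ × ℕ)) : Bool :=
  extendPals P ih n (Nat.add W (Nat.mul code top)) (Nat.add ones top) PS (Nat.add tot wt) dst top id rv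
    w pals

noncomputable def deadLetter (P : Params)
    (ih : ℕ → ℕ → ℕ → ℕ → ℕ → List ℕ → List (ℕ × ℕ) → List ℕ → Bool)
    (n W ones PS tot : ℕ) (w : List ℕ) (pals : List (ℕ × ℕ)) (runs : List ℕ)
    (x : Letter) : Bool :=
  Letter.rec (fun id rv dst wt code bad =>
  @Bool.rec (fun _ => Bool)
    (@Bool.rec (fun _ => Bool)
      (extendWord P ih (Nat.succ n) W ones PS tot dst
        (Nat.pow (nat_lit 2) (Nat.mul (nat_lit 8) (Nat.succ n))) id rv code wt
        (id :: w) pals)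
      true (badRuns (Nat.succ n) W code P.mask runs))
    true (hits bad w)) x

noncomputable def nextLetters (T : List (List Letter)) (w : List ℕ) : List Letter :=
  List.rec [] (fun a _ _ =>
    List.rec (fun _ => []) (fun L _ ih a => Nat.rec L (fun a' _ => ih a') a) T a) w

/-- The value `true` means that every branch dies; a plan that runs out of letters gives `false`. -/
noncomputable def search (P : Params) (R : List (List Letter → List Letter)) :
    ℕ → ℕ → ℕ → ℕ → ℕ → List ℕ → List (ℕ × ℕ) → List ℕ → Bool :=
  List.rec (fun _ _ _ _ _ _ _ _ => false) (fun r _ ih n W ones PS tot w pals runs =>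
    List.rec true (fun x _ rest =>
      @Bool.rec (fun _ => Bool) false rest (deadLetter P ih n W ones PS tot w pals runs x))
      (r (nextLetters P.next w))) R

noncomputable def searchFrom (P : Params) (R : List (List Letter → List Letter)) (st : ℕ) : Bool :=
  search P R (nat_lit 0) (Nat.pow (nat_lit 2) (Nat.add (nat_lit 6) st)) (nat_lit 1) (nat_lit 0)
    (nat_lit 0) [Nat.add (nat_lit 6) st] [(nat_lit 0, nat_lit 1)] []


/-- No restriction on the next `n` letters. -/
noncomputable def free (n : ℕ) : List (List Letter → List Letter) :=
  Nat.rec [] (fun _ ih => (fun L => L) :: ih) n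

noncomputable def pick (i : ℕ) (L : List Letter) : List Letter :=
  List.rec [] (fun x _ ih => @Bool.rec (fun _ => List Letter) ih (x :: ih) (Nat.beq x.id i)) L

/-- `m` arbitrary letters, then the word `u`, then arbitrary letters. -/
noncomputable def plan (m : ℕ) (u : List ℕ) : List (List Letter → List Letter) :=
  -- The 250 free letters only bound the depth: a branch that is alive at the end makes the search
  -- fail.
  Nat.rec (List.rec (free (nat_lit 250)) (fun i _ ih => pick i :: ih) u)
    (fun _ ih => (fun L => L) :: ih) m

/-! ### Soundness of the search -/

theorem boolRec {α : Sort*} (c : Bool) (t e : α) :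
    @Bool.rec (fun _ => α) e t c = if c = true then t else e := by cases c <;> rfl

theorem boolRec_beq {α : Sort*} (a b : ℕ) (t e : α) :
    @Bool.rec (fun _ => α) e t (Nat.beq a b) = if a = b then t else e := by
  simp only [boolRec, Nat.beq_eq]

theorem boolRec_ble {α : Sort*} (a b : ℕ) (t e : α) :
    @Bool.rec (fun _ => α) e t (Nat.ble a b) = if a ≤ b then t else e := by
  simp only [boolRec, Nat.ble_eq]

theorem keep_eq (top l o : ℕ) (r : List (ℕ × ℕ)) :
    keep top l o r = if top ≤ o then (l + 2, o) :: r else r := by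
  simp only [keep, boolRec_ble]

theorem updPals_cons (A B top l o : ℕ) (base pals : List (ℕ × ℕ)) :
    updPals A B top base ((l, o) :: pals) =
      if top ≤ (o <<< 8) &&& (A &&& (B <<< (8 * (l + 1)))) then
        (l + 2, (o <<< 8) &&& (A &&& (B <<< (8 * (l + 1))))) :: updPals A B top base pals
      else updPals A B top base pals := by
  rw [← keep_eq]; rfl

theorem isMis_eq (mask v : ℕ) : isMis mask v = mask.testBit v := by
  rw [Bool.eq_iff_iff, Nat.testBit_eq_decide_div_mod_eq, decide_eq_true_iff,
    ← Nat.shiftRight_eq_div_pow]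
  exact (Nat.beq_eq ▸ Iff.rfl : Nat.beq _ _ = true ↔ _ = _).trans eq_comm

theorem badRuns_cons (n W code mask q : ℕ) (runs : List ℕ) :
    badRuns n W code mask (q :: runs) = true ↔
      mask.testBit ((code ^^^ (W >>> (8 * (n - q)))) % 64) = true ∨
        badRuns n W code mask runs = true := by
  rw [← isMis_eq]
  change @Bool.rec (fun _ => Bool) _ true _ = true ↔ _
  rw [boolRec]
  change (if isMis mask ((code ^^^ (W >>> (8 * (n - q)))) % 64) = true then true
    else badRuns n W code mask runs) = true ↔ _
  split_ifs with h <;> simp [h]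

theorem field_eq (PS tot j : ℕ) : field PS tot j = tot - (PS >>> (42 * j)) % 2 ^ 42 := rfl

theorem extendLeft_succ (W q : ℕ) (halt : ℕ → ℕ → Bool) (j : ℕ) :
    extendLeft W q halt (j + 1) =
      if ((W >>> (8 * (j + 1))) ^^^ (W >>> (8 * (j + 1 + q)))) % 64 = 0 then
        extendLeft W q halt j
      else halt (j + 1) (((W >>> (8 * (j + 1))) ^^^ (W >>> (8 * (j + 1 + q)))) % 64) := by
  change @Bool.rec (fun _ => Bool) _ _ _ = _
  rw [boolRec_beq]; rfl

theorem classify_eq (viol : ℕ → ℕ → ℕ → Bool) (q : ℕ) (K : List ℕ → Bool) (acc : List ℕ)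
    (r p t : ℕ) : classify viol q K acc r p t =
      if viol r p t = true then true else if viol r p (t + 1) = true then K (q :: acc) else K acc := by
  simp only [classify, boolRec]

theorem stopAt_eq (viol : ℕ → ℕ → ℕ → Bool) (mask PS tot p q : ℕ) (K : List ℕ → Bool)
    (acc : List ℕ) (j v : ℕ) : stopAt viol mask PS tot p q K acc j v =
      classify viol q K acc (field PS tot j) p (if mask.testBit v = true then 1 else 0) := by
  simp only [stopAt, boolRec, isMis_eq]

theorem isRun_iff (W q j i : ℕ) : isRun W q j i = true ↔
    W >>> (8 * (j + q) + 6) = (W % 2 ^ (8 * (i + 1))) >>> (8 * j + 6) :=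
  Nat.beq_eq ▸ Iff.rfl

theorem addRun_eq (viol : ℕ → ℕ → ℕ → Bool) (mask n W PS tot l q₀ q : ℕ)
    (K : ℕ → List ℕ → Bool) (acc : List ℕ) : addRun viol mask n W PS tot l q₀ q K acc =
      if q = q₀ then K q₀ acc else if isRun W q (n - l) (n - q) = true then
        extendLeft W q (stopAt viol mask PS tot (field PS tot (n - q)) q (K q) acc) (n - l)
      else K q acc := by
  simp only [addRun, boolRec_beq, addTrueRun]
  simp only [boolRec]; rfl

theorem newRuns_cons (viol : ℕ → ℕ → ℕ → Bool) (mask n W PS tot : ℕ) (K : List ℕ → Bool)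
    (a : ℕ × ℕ) (pals : List (ℕ × ℕ)) (l q₀ : ℕ) (acc : List ℕ) :
    newRuns viol mask n W PS tot K (a :: pals) l q₀ acc =
      addRun viol mask n W PS tot l q₀ (l - a.1)
        (newRuns viol mask n W PS tot K pals a.1) acc := rfl

theorem checkPals_cons (P : Params)
    (ih : ℕ → ℕ → ℕ → ℕ → ℕ → List ℕ → List (ℕ × ℕ) → List ℕ → Bool)
    (n W ones PS tot top : ℕ) (w : List ℕ) (h : ℕ × ℕ) (pals : List (ℕ × ℕ)) :
    checkPals P ih n W ones PS tot top w (h :: pals) =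
      if h.2 = top then
        if 2 ^ 42 ≤ tot then false else
          newRuns P.viol P.mask n W PS tot (ih n W ones PS tot w (h :: pals)) pals h.1 0 []
      else true := by
  change @Bool.rec (fun _ => Bool) _ _ _ = _
  rw [boolRec_beq, boolRec_ble]; rfl

theorem basePals_eq (W id rv dst ones : ℕ) : basePals W id rv dst ones =
    if id = rv then [(1, (W >>> id) &&& ones), (0, (W >>> (6 + dst)) &&& ones)]
    else [(0, (W >>> (6 + dst)) &&& ones)] := by
  simp only [basePals, boolRec_beq]; rfl

theorem deadLetter_eq (P : Params)
    (ih : ℕ → ℕ → ℕ → ℕ → ℕ → List ℕ → List (ℕ × ℕ) → List ℕ → Bool)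
    (n W ones PS tot : ℕ) (w : List ℕ) (pals : List (ℕ × ℕ)) (runs : List ℕ) (x : Letter) :
    deadLetter P ih n W ones PS tot w pals runs x =
      if hits x.bad w = true then true
      else if badRuns (n + 1) W x.code P.mask runs = true then true
      else checkPals P ih (n + 1) (W + x.code * 2 ^ (8 * (n + 1))) (ones + 2 ^ (8 * (n + 1)))
        (PS + (tot + x.wt) <<< (42 * (n + 1))) (tot + x.wt) (2 ^ (8 * (n + 1))) (x.id :: w)
        (updPals ((W + x.code * 2 ^ (8 * (n + 1))) >>> x.id)
          ((W + x.code * 2 ^ (8 * (n + 1))) >>> x.rv) (2 ^ (8 * (n + 1)))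
          (basePals (W + x.code * 2 ^ (8 * (n + 1))) x.id x.rv x.dst
            (ones + 2 ^ (8 * (n + 1)))) pals) := by
  obtain ⟨id, rv, dst, wt, code, bad⟩ := x
  change @Bool.rec (fun _ => Bool) _ _ _ = _
  rw [boolRec, boolRec]; rfl

theorem search_cons (P : Params) (r : List Letter → List Letter)
    (R : List (List Letter → List Letter)) (n W ones PS tot : ℕ) (w : List ℕ)
    (pals : List (ℕ × ℕ)) (runs : List ℕ)
    (h : search P (r :: R) n W ones PS tot w pals runs = true) :
    ∀ x ∈ r (nextLetters P.next w),
      deadLetter P (search P R) n W ones PS tot w pals runs x = true := by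
  change List.rec (motive := fun _ => Bool) true (fun x _ rest => @Bool.rec (fun _ => Bool) false rest
      (deadLetter P (search P R) n W ones PS tot w pals runs x)) (r (nextLetters P.next w)) = true at h
  generalize r (nextLetters P.next w) = L at h ⊢
  induction L with
  | nil => simp
  | cons x L ih =>
    change @Bool.rec (fun _ => Bool) false _ _ = true at h
    rw [boolRec] at h
    split_ifs at h with hx
    intro z hz
    rcases List.mem_cons.1 hz with rfl | hz
    · exact hx
    · exact ih h z hz

theorem mem_pick {i : ℕ} {L : List Letter} {x : Letter} (hx : x ∈ L) (hi : x.id = i) :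
    x ∈ pick i L := by
  induction L with
  | nil => cases hx
  | cons a L ih =>
    change x ∈ @Bool.rec (fun _ => List Letter) (pick i L) (a :: pick i L) (Nat.beq a.id i)
    rw [boolRec_beq]
    rcases List.mem_cons.1 hx with rfl | hx
    · simp [hi]
    · split_ifs
      · exact List.mem_cons_of_mem _ (ih hx)
      · exact ih hx

end TernaryRich

/-! ### Invariants of the search: letters, states, palindromic suffixes. -/

namespace TernaryRich

/-- The last `n` letters read from `y` since position `p`, newest first, and the state at `p`. -/
def context (S : Alphabet) (y : ℕ → ℕ) (p : ℕ) : ℕ → List ℕ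
  | 0 => [6 + S.src (y p)]
  | n + 1 => y (p + n) :: context S y p n

/-- The field `letters` says that the table always offers the letter that really comes next in `y`,
and that no forbidden word rejects it. -/
structure SearchHyp (P : Params) (S : Alphabet) (wt : ℕ → ℕ) (y : ℕ → ℕ) (p : ℕ) : Prop where
  path : S.IsPath y
  rich : S.Rich y
  size : S.size ≤ 6
  states : ∀ a < S.size, S.src a < 2
  mis_zero : P.mask.testBit 0 = false
  power : ∀ i e q l r, S.Run y i e q →
    (l = 0 ∨ l = 1 ∧ ∃ i', i = i' + 1 ∧ P.mask.testBit (2 ^ y i' ^^^ 2 ^ y (i' + q)) = true) →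
    (r = 0 ∨ r = 1 ∧ P.mask.testBit (2 ^ y e ^^^ 2 ^ y (e - q)) = true) →
    P.viol (wsum wt y i e) (wsum wt y (e - q) e) (l + r) = false
  letters : ∀ n, ∃ x ∈ nextLetters P.next (context S y p n), x.id = y (p + n) ∧
    x.rv = S.rv x.id ∧ x.dst = S.dst x.id ∧ x.wt = wt x.id ∧
    x.code = 2 ^ x.id + 2 ^ (6 + S.dst x.id) ∧ hits x.bad (context S y p n) = false

namespace SearchHyp
variable {P : Params} {S : Alphabet} {wt : ℕ → ℕ} {y : ℕ → ℕ} {p : ℕ}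

theorem lt_six (H : SearchHyp P S wt y p) (i : ℕ) : y i < 6 := (H.path i).1.trans_le H.size

theorem src_lt (H : SearchHyp P S wt y p) (i : ℕ) : S.src (y i) < 2 := H.states _ (H.path i).1

end SearchHyp

/-- `W` encodes `n` letters of `y` from position `p` on. -/
def Encodes (S : Alphabet) (y : ℕ → ℕ) (p n W : ℕ) : Prop :=
  ∀ i c, c < 8 → (W.testBit (8 * i + c) = true ↔
    i ≤ n ∧ ((∃ a, i = a + 1 ∧ c = y (p + a)) ∨ c = 6 + S.src (y (p + i))))

theorem testBit_letterCode {a s : ℕ} (ha : a < 6) (hs : s < 2) (t : ℕ) :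
    (2 ^ a + 2 ^ (6 + s)).testBit t = true ↔ t = a ∨ t = 6 + s := by
  have hlt : 2 ^ a < 2 ^ (6 + s) := Nat.pow_lt_pow_right (by norm_num) (by omega)
  have e := Nat.testBit_two_pow_mul_add 1 hlt t
  rw [mul_one, add_comm] at e
  rw [e, Nat.testBit_two_pow, ← Nat.pow_zero 2, Nat.testBit_two_pow]
  split_ifs <;> rw [decide_eq_true_iff] <;> omega

namespace Encodes
variable {P : Params} {S : Alphabet} {wt : ℕ → ℕ} {y : ℕ → ℕ} {p n W : ℕ}

theorem lt (H : Encodes S y p n W) : W < 2 ^ (8 * (n + 1)) := by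
  refine Nat.lt_pow_two_of_testBit _ fun t ht => ?_
  by_contra hc
  rw [Bool.not_eq_false, show t = 8 * (t / 8) + t % 8 by omega, H _ _ (Nat.mod_lt _ (by omega))] at hc
  omega

theorem letter (H : Encodes S y p n W) {i c : ℕ} (hc : c < 6) (h : W.testBit (8 * i + c) = true) :
    ∃ a, i = a + 1 ∧ a + 1 ≤ n ∧ c = y (p + a) := by
  obtain ⟨h1, ⟨a, ha, h2⟩ | h2⟩ := (H i c (by omega)).1 h
  · exact ⟨a, ha, by omega, h2⟩
  · omega

theorem testBit_letter (H : Encodes S y p n W) (hy : SearchHyp P S wt y p) {a : ℕ}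
    (h : a + 1 ≤ n) : W.testBit (8 * (a + 1) + y (p + a)) = true :=
  (H _ _ (by have := hy.lt_six (p + a); omega)).2 ⟨h, .inl ⟨a, rfl, rfl⟩⟩

theorem state (H : Encodes S y p n W) (hy : SearchHyp P S wt y p) {i s : ℕ} (hs : s < 2)
    (h : W.testBit (8 * i + (6 + s)) = true) : i ≤ n ∧ s = S.src (y (p + i)) := by
  obtain ⟨h1, ⟨a, ha, h2⟩ | h2⟩ := (H i (6 + s) (by omega)).1 h
  · have := hy.lt_six (p + a); omega
  · exact ⟨h1, by omega⟩

theorem group (H : Encodes S y p n W) (hy : SearchHyp P S wt y p) {a : ℕ} (h : a + 1 ≤ n) :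
    (W >>> (8 * (a + 1))) % 64 = 2 ^ y (p + a) := by
  have h6 := hy.lt_six (p + a)
  refine Nat.eq_of_testBit_eq fun t => ?_
  rw [show 64 = 2 ^ 6 by norm_num, Nat.testBit_mod_two_pow, Nat.testBit_shiftRight,
    Nat.testBit_two_pow, Bool.eq_iff_iff]
  simp only [Bool.and_eq_true, decide_eq_true_eq]
  constructor
  · rintro ⟨h1, h2⟩
    obtain ⟨b, hb, -, h3⟩ := H.letter h1 h2
    rw [h3, show a = b by omega]
  · rintro rfl
    exact ⟨h6, H.testBit_letter hy h⟩

theorem zero (hy : SearchHyp P S wt y p) : Encodes S y p 0 (2 ^ (6 + S.src (y p))) := by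
  intro i c hc
  have := hy.src_lt p
  rw [Nat.testBit_two_pow, decide_eq_true_iff]
  constructor
  · intro h
    obtain rfl : i = 0 := by omega
    exact ⟨le_rfl, .inr (by simp; omega)⟩
  · rintro ⟨h1, ⟨a, ha, h2⟩ | h2⟩
    · omega
    · obtain rfl : i = 0 := by omega
      simp at h2; omega

theorem succ (H : Encodes S y p n W) (hy : SearchHyp P S wt y p) {a : ℕ} (ha : a = y (p + n)) :
    Encodes S y p (n + 1) (W + (2 ^ a + 2 ^ (6 + S.dst a)) * 2 ^ (8 * (n + 1))) := by
  subst ha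
  have h6 := hy.lt_six (p + n)
  have h2 := hy.src_lt (p + (n + 1))
  have hd : S.dst (y (p + n)) = S.src (y (p + (n + 1))) := (hy.path (p + n)).2
  intro i c hc
  rw [add_comm W, mul_comm, Nat.testBit_two_pow_mul_add _ H.lt]
  split_ifs with hlt
  · rw [H i c hc]
    constructor
    · rintro ⟨h, h'⟩; exact ⟨by omega, h'⟩
    · rintro ⟨h, h'⟩; exact ⟨by omega, h'⟩
  · rw [hd, testBit_letterCode h6 h2]
    constructor
    · intro h
      obtain rfl : i = n + 1 := by omega
      refine ⟨le_rfl, ?_⟩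
      rcases h with h | h
      · exact .inl ⟨n, rfl, by omega⟩
      · exact .inr (by omega)
    · rintro ⟨h, h'⟩
      obtain rfl : i = n + 1 := by omega
      rcases h' with ⟨b, hb, h'⟩ | h'
      · obtain rfl : b = n := by omega
        left; omega
      · right; omega

end Encodes

/-- `m` is a mask of the boundaries up to `n`. -/
def Ones (n m : ℕ) : Prop := ∀ t, m.testBit t = true ↔ ∃ j ≤ n, t = 8 * j

theorem Ones.zero : Ones 0 1 := by
  intro t
  rw [show 1 = 2 ^ 0 by norm_num, Nat.testBit_two_pow, decide_eq_true_iff]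
  constructor
  · rintro rfl; exact ⟨0, le_rfl, rfl⟩
  · rintro ⟨j, hj, rfl⟩; omega

theorem Ones.succ {n m : ℕ} (h : Ones n m) : Ones (n + 1) (m + 2 ^ (8 * (n + 1))) := by
  have hlt : m < 2 ^ (8 * (n + 1)) := by
    refine Nat.lt_pow_two_of_testBit _ fun t ht => ?_
    by_contra hc
    rw [Bool.not_eq_false, h] at hc
    obtain ⟨j, hj, rfl⟩ := hc
    omega
  intro t
  have e := Nat.testBit_two_pow_mul_add 1 hlt t
  rw [mul_one, add_comm] at e
  rw [e]
  split_ifs with ht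
  · rw [h]
    exact ⟨fun ⟨j, hj, e⟩ => ⟨j, by omega, e⟩, fun ⟨j, hj, e⟩ => ⟨j, by omega, e⟩⟩
  · rw [show (1 : ℕ) = 2 ^ 0 by norm_num, Nat.testBit_two_pow, decide_eq_true_iff]
    constructor
    · intro h; exact ⟨n + 1, le_rfl, by simp at h; omega⟩
    · rintro ⟨j, hj, rfl⟩; simp; omega

/-- The set bits of `O` are at ends of occurrences of one word of length `l`. -/
def Marks (S : Alphabet) (y : ℕ → ℕ) (p n l O : ℕ) : Prop :=
  (∀ t, O.testBit t = true → ∃ s, t = 8 * (s + l) ∧ s + l ≤ n) ∧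
  ∀ s s', O.testBit (8 * (s + l)) = true → O.testBit (8 * (s' + l)) = true →
    S.Same y (p + s) (p + s') l

/-- `pals` lists the palindromic suffixes of the first `n` letters, longest first. -/
structure ListsPals (S : Alphabet) (y : ℕ → ℕ) (p n : ℕ) (pals : List (ℕ × ℕ)) : Prop where
  marks : ∀ a ∈ pals, Marks S y p n a.1 a.2
  top : ∀ a ∈ pals, 2 ^ (8 * n) ≤ a.2
  sorted : pals.Pairwise fun a b => b.1 < a.1
  complete : ∀ s l, s + l = n → S.Pal y (p + s) (p + n) →
    ∃ O, (l, O) ∈ pals ∧ O.testBit (8 * n) = true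

theorem Ones.testBit_top {n m : ℕ} (h : Ones n m) : m.testBit (8 * n) = true :=
  (h _).2 ⟨n, le_rfl, rfl⟩

section
variable {P : Params} {S : Alphabet} {wt : ℕ → ℕ} {y : ℕ → ℕ} {p n W ones : ℕ}

/-- A bit that survives the conjunction sits at the end of the inner word enclosed by the two right
letters. It is not required that all occurrences be marked: missing marks could only make the search
weaker. -/
theorem Marks.step (hy : SearchHyp P S wt y p) (hW : Encodes S y p (n + 1) W) {l O a : ℕ}
    (ha : a = y (p + n)) (h : Marks S y p n l O) :
    Marks S y p (n + 1) (l + 2)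
      ((O <<< 8) &&& ((W >>> a) &&& ((W >>> S.rv a) <<< (8 * (l + 1))))) := by
  have h6 : a < 6 := ha ▸ hy.lt_six _
  have h6' : S.rv a < 6 := ha ▸ (S.rv_lt _ (hy.path _).1).trans_le hy.size
  have key : ∀ t, ((O <<< 8) &&& ((W >>> a) &&& ((W >>> S.rv a) <<< (8 * (l + 1))))).testBit t = true →
      ∃ s, t = 8 * (s + 1 + (l + 1)) ∧ O.testBit (8 * (s + 1 + l)) = true ∧ s + 1 + l ≤ n ∧
        y (p + s) = S.rv a ∧ y (p + (s + 1 + l)) = a := by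
    intro t ht
    simp only [Nat.testBit_and, Nat.testBit_shiftLeft, Nat.testBit_shiftRight, Bool.and_eq_true,
      decide_eq_true_eq] at ht
    obtain ⟨⟨h1, h2⟩, h3, h4, h5⟩ := ht
    obtain ⟨s, hs, hsn⟩ := h.1 _ h2
    obtain rfl : t = 8 * (s + (l + 1)) := by omega
    rw [add_comm] at h3 h5
    obtain ⟨b, hb, -, hb'⟩ := hW.letter h6 h3
    rw [show 8 * (s + (l + 1)) - 8 * (l + 1) = 8 * s by omega] at h5
    obtain ⟨c, rfl, -, hc'⟩ := hW.letter h6' h5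
    refine ⟨c, rfl, ?_, hsn, hc'.symm, ?_⟩
    · rw [hs] at h2; exact h2
    · rw [show c + 1 + l = b by omega]; exact hb'.symm
  refine ⟨fun t ht => ?_, fun s s' hs hs' => ?_⟩
  · obtain ⟨s, rfl, -, hs, -⟩ := key t ht
    exact ⟨s, by omega, by omega⟩
  · obtain ⟨b, hb, h1, -, h2, h3⟩ := key _ hs
    obtain ⟨b', hb', h1', -, h2', h3'⟩ := key _ hs'
    obtain rfl : s = b := by omega
    obtain rfl : s' = b' := by omega
    have hm := h.2 _ _ h1 h1'
    refine ⟨by rw [h2, h2'], fun j hj => ?_⟩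
    rcases j with _ | j
    · simp [h2, h2']
    · rcases Nat.lt_or_ge j l with hjl | hjl
      · have := hm.2 j hjl
        simpa only [add_assoc, add_comm, add_left_comm] using this
      · obtain rfl : j = l := by omega
        rw [show p + s + (j + 1) = p + (s + 1 + j) by omega,
          show p + s' + (j + 1) = p + (s' + 1 + j) by omega, h3, h3']

theorem step_testBit_top (hy : SearchHyp P S wt y p) (hW : Encodes S y p (n + 1) W) {s l O a : ℕ}
    (ha : a = y (p + n)) (hsl : s + 1 + l = n) (hO : O.testBit (8 * n) = true)
    (hr : y (p + s) = S.rv a) :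
    ((O <<< 8) &&& ((W >>> a) &&& ((W >>> S.rv a) <<< (8 * (l + 1))))).testBit (8 * (n + 1))
      = true := by
  simp only [Nat.testBit_and, Nat.testBit_shiftLeft, Nat.testBit_shiftRight, Bool.and_eq_true,
      decide_eq_true_eq]
  refine ⟨⟨by omega, by rwa [show 8 * (n + 1) - 8 = 8 * n by omega]⟩, ?_, by omega, ?_⟩
  · rw [add_comm, ha]; exact hW.testBit_letter hy le_rfl
  · rw [show S.rv a + (8 * (n + 1) - 8 * (l + 1)) = 8 * (s + 1) + S.rv a by omega, ← hr]
    exact hW.testBit_letter hy (by omega)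

/-- Palindromes of length 0 and 1 do not arise from shorter ones. The empty word counts as repeated
only where the state is the same, and a single letter is a palindrome only if it is its own
reversal. -/
theorem listsPals_base (hy : SearchHyp P S wt y p) (hW : Encodes S y p (n + 1) W)
    (h1 : Ones (n + 1) ones) {a : ℕ} (ha : a = y (p + n)) :
    let base := basePals W a (S.rv a) (S.dst a) ones
    (∀ b ∈ base, Marks S y p (n + 1) b.1 b.2 ∧ b.2.testBit (8 * (n + 1)) = true) ∧
    (base.Pairwise fun a b => b.1 < a.1) ∧ (∀ b ∈ base, b.1 < 2) ∧
    (∃ O, (0, O) ∈ base ∧ O.testBit (8 * (n + 1)) = true) ∧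
    (a = S.rv a → ∃ O, (1, O) ∈ base ∧ O.testBit (8 * (n + 1)) = true) := by
  have h6 : a < 6 := ha ▸ hy.lt_six _
  have hd : S.dst a = S.src (y (p + (n + 1))) := ha ▸ (hy.path (p + n)).2
  have hd2 : S.dst a < 2 := hd ▸ hy.src_lt _
  have hz : Marks S y p (n + 1) 0 ((W >>> (6 + S.dst a)) &&& ones) := by
    have key : ∀ t, ((W >>> (6 + S.dst a)) &&& ones).testBit t = true →
        ∃ j ≤ n + 1, t = 8 * j ∧ S.src (y (p + j)) = S.dst a := by
      intro t ht
      simp only [Nat.testBit_and, Nat.testBit_shiftRight, Bool.and_eq_true] at ht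
      obtain ⟨j, hj, rfl⟩ := (h1 _).1 ht.2
      have h3 := ht.1
      rw [add_comm] at h3
      exact ⟨j, hj, rfl, (hW.state hy hd2 h3).2.symm⟩
    refine ⟨fun t ht => ?_, fun s s' hs hs' => ⟨?_, by simp⟩⟩
    · obtain ⟨j, hj, h, -⟩ := key t ht
      exact ⟨j, h, hj⟩
    · obtain ⟨j, -, h, h'⟩ := key _ hs
      obtain ⟨j', -, k, k'⟩ := key _ hs'
      rw [show s = j by omega, show s' = j' by omega, h', k']
  have hzt : ((W >>> (6 + S.dst a)) &&& ones).testBit (8 * (n + 1)) = true := by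
    simp only [Nat.testBit_and, Nat.testBit_shiftRight, Bool.and_eq_true]
    refine ⟨?_, h1.testBit_top⟩
    rw [add_comm]
    exact (hW _ _ (by omega)).2 ⟨le_rfl, .inr (by rw [hd])⟩
  have ho : Marks S y p (n + 1) 1 ((W >>> a) &&& ones) := by
    have key : ∀ t, ((W >>> a) &&& ones).testBit t = true →
        ∃ j, j + 1 ≤ n + 1 ∧ t = 8 * (j + 1) ∧ y (p + j) = a := by
      intro t ht
      simp only [Nat.testBit_and, Nat.testBit_shiftRight, Bool.and_eq_true] at ht
      obtain ⟨j, hj, rfl⟩ := (h1 _).1 ht.2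
      have h3 := ht.1
      rw [add_comm] at h3
      obtain ⟨b, rfl, h4, h5⟩ := hW.letter h6 h3
      exact ⟨b, h4, rfl, h5.symm⟩
    refine ⟨fun t ht => ?_, fun s s' hs hs' => ?_⟩
    · obtain ⟨j, hj, h, -⟩ := key t ht
      exact ⟨j, h, hj⟩
    · obtain ⟨j, -, h, h'⟩ := key _ hs
      obtain ⟨j', -, k, k'⟩ := key _ hs'
      have e : y (p + s) = y (p + s') := by
        rw [show s = j by omega, show s' = j' by omega, h', k']
      exact ⟨by rw [e], fun i hi => by rw [show i = 0 by omega]; exact e⟩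
  have hot : ((W >>> a) &&& ones).testBit (8 * (n + 1)) = true := by
    simp only [Nat.testBit_and, Nat.testBit_shiftRight, Bool.and_eq_true]
    refine ⟨?_, h1.testBit_top⟩
    rw [add_comm, ha]
    exact hW.testBit_letter hy le_rfl
  intro base
  simp only [base, basePals_eq]
  split_ifs with hr
  · simp [hz, hzt, ho, hot]
  · simp [hz, hzt, hr]

theorem listsPals_step (hy : SearchHyp P S wt y p) (hW : Encodes S y p (n + 1) W)
    (h1 : Ones (n + 1) ones) {a : ℕ} (ha : a = y (p + n)) {pals : List (ℕ × ℕ)}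
    (h : ListsPals S y p n pals) :
    ListsPals S y p (n + 1) (updPals (W >>> a) (W >>> S.rv a) (2 ^ (8 * (n + 1)))
      (basePals W a (S.rv a) (S.dst a) ones) pals) := by
  obtain ⟨b1, b2, b3, b4, b5⟩ := listsPals_base hy hW h1 ha
  generalize basePals W a (S.rv a) (S.dst a) ones = base at *
  have key : ∀ pals : List (ℕ × ℕ), (∀ a ∈ pals, Marks S y p n a.1 a.2) →
      (pals.Pairwise fun a b => b.1 < a.1) →
      let new := updPals (W >>> a) (W >>> S.rv a) (2 ^ (8 * (n + 1))) base pals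
      (∀ b ∈ new, Marks S y p (n + 1) b.1 b.2 ∧ 2 ^ (8 * (n + 1)) ≤ b.2) ∧
      (new.Pairwise fun a b => b.1 < a.1) ∧ (∀ b ∈ new, b.1 < 2 ∨ ∃ c ∈ pals, b.1 = c.1 + 2) ∧
      (∀ b ∈ base, b ∈ new) ∧
      ∀ l O, (l, O) ∈ pals → ∀ O', O' = (O <<< 8) &&& ((W >>> a) &&& ((W >>> S.rv a) <<< (8 * (l + 1)))) →
        2 ^ (8 * (n + 1)) ≤ O' → (l + 2, O') ∈ new := by
    intro pals
    induction pals with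
    | nil =>
      intro _ _ new
      exact ⟨fun b hb => ⟨(b1 b hb).1, Nat.ge_two_pow_of_testBit (b1 b hb).2⟩, b2,
        fun b hb => .inl (b3 b hb), fun b hb => hb, by simp⟩
    | cons c pals ih =>
      intro hm hs
      obtain ⟨l, O⟩ := c
      obtain ⟨c1, c2, c3, c4, c5⟩ := ih (fun a ha => hm a (List.mem_cons_of_mem _ ha)) hs.of_cons
      rw [updPals_cons]
      split_ifs with hk
      · refine ⟨?_, ?_, ?_, fun b hb => List.mem_cons_of_mem _ (c4 b hb), ?_⟩
        · intro b hb
          rcases List.mem_cons.1 hb with rfl | hb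
          · exact ⟨(hm (l, O) (by simp)).step hy hW ha, hk⟩
          · exact c1 b hb
        · refine List.pairwise_cons.2 ⟨fun b hb => ?_, c2⟩
          rcases c3 b hb with h | ⟨c, hc, h⟩
          · simp; omega
          · have := (List.pairwise_cons.1 hs).1 c hc
            simp at this ⊢; omega
        · intro b hb
          rcases List.mem_cons.1 hb with rfl | hb
          · exact .inr ⟨(l, O), by simp, rfl⟩
          · rcases c3 b hb with h | ⟨c, hc, h⟩
            · exact .inl h
            · exact .inr ⟨c, List.mem_cons_of_mem _ hc, h⟩
        · intro l' O₁ hlo O' hO' hge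
          rcases List.mem_cons.1 hlo with h | h
          · obtain ⟨rfl, rfl⟩ := Prod.mk.inj h
            rw [hO']; exact List.mem_cons_self
          · exact List.mem_cons_of_mem _ (c5 l' O₁ h O' hO' hge)
      · refine ⟨c1, c2, ?_, c4, ?_⟩
        · intro b hb
          rcases c3 b hb with h | ⟨c, hc, h⟩
          · exact .inl h
          · exact .inr ⟨c, List.mem_cons_of_mem _ hc, h⟩
        · intro l' O₁ hlo O' hO' hge
          rcases List.mem_cons.1 hlo with h | h
          · obtain ⟨rfl, rfl⟩ := Prod.mk.inj h
            exact absurd (hO' ▸ hge) hk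
          · exact c5 l' O₁ h O' hO' hge
  obtain ⟨k1, k2, -, k4, k5⟩ := key pals h.marks h.sorted
  refine ⟨fun a ha => (k1 a ha).1, fun a ha => (k1 a ha).2, k2, fun s l hsl hp => ?_⟩
  rcases l with _ | _ | l
  · obtain ⟨O, hO, hO'⟩ := b4
    exact ⟨O, k4 _ hO, hO'⟩
  · obtain rfl : s = n := by omega
    obtain ⟨O, hO, hO'⟩ := b5 (by
      rw [ha]; exact hp (p + s) (p + s) le_rfl le_rfl (by omega))
    exact ⟨O, k4 _ hO, hO'⟩
  · obtain ⟨O, hO, hO'⟩ := h.complete (s + 1) l (by omega) (fun a b ha hb hab =>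
      hp a b (by omega) (by omega) (by omega))
    have ht := step_testBit_top hy hW (s := s) (l := l) ha (by omega) hO'
      (by rw [ha]; exact hp (p + n) (p + s) (by omega) le_rfl (by omega))
    exact ⟨_, k5 l O hO _ rfl (Nat.ge_two_pow_of_testBit ht), ht⟩

theorem listsPals_zero : ListsPals S y p 0 [(0, 1)] := by
  have h1 : ∀ t, (1 : ℕ).testBit t = true ↔ t = 0 := fun t => by
    rw [show (1 : ℕ) = 2 ^ 0 by norm_num, Nat.testBit_two_pow, decide_eq_true_iff, eq_comm]
  refine ⟨?_, by simp, by simp, fun s l hsl _ => ⟨1, ?_, by simp⟩⟩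
  · intro a ha
    obtain rfl := List.mem_singleton.1 ha
    refine ⟨fun t ht => ⟨0, (h1 t).1 ht, le_rfl⟩, fun s s' hs hs' => ?_⟩
    rw [h1] at hs hs'
    obtain rfl : s = s' := by omega
    exact ⟨rfl, fun _ _ => rfl⟩
  · simp; omega

/-- The longest palindromic suffix of a rich word is marked at its end only. -/
theorem ListsPals.head_eq (hy : SearchHyp P S wt y p) {h : ℕ × ℕ} {t : List (ℕ × ℕ)}
    (H : ListsPals S y p n (h :: t)) : h.2 = 2 ^ (8 * n) := by
  obtain ⟨l, O⟩ := h
  have hm := H.marks (l, O) (by simp)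
  have htop := H.top (l, O) (by simp)
  simp only at hm htop ⊢
  have hn : O.testBit (8 * n) = true := by
    obtain ⟨t, ht, h⟩ := Nat.exists_ge_and_testBit_of_ge_two_pow htop
    obtain ⟨s, rfl, hs⟩ := hm.1 t h
    rwa [show 8 * (s + l) = 8 * n by omega] at h
  by_contra hne
  have : ∃ t, O.testBit t = true ∧ t ≠ 8 * n := by
    by_contra hc
    push Not at hc
    refine hne (Nat.eq_of_testBit_eq fun t => ?_)
    rw [Nat.testBit_two_pow, Bool.eq_iff_iff, decide_eq_true_iff]
    exact ⟨fun h => (hc t h).symm, fun h => h ▸ hn⟩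
  obtain ⟨t, ht, htn⟩ := this
  obtain ⟨s, rfl, hs⟩ := hm.1 t ht
  -- The palindromic suffix that occurs once is in the list, so it is a suffix of the head. A second
  -- mark of the head would give it a second occurrence.
  obtain ⟨q, hq, hqn, hpal, hu⟩ := hy.rich p (p + n) (by omega)
  obtain ⟨s', hs'⟩ := Nat.exists_eq_add_of_le (show l ≤ n by omega)
  obtain ⟨d, rfl⟩ := Nat.exists_eq_add_of_le hq
  obtain ⟨O', hO', -⟩ := H.complete d (n - d) (by omega) hpal
  have hle : n - d ≤ l := by
    rcases List.mem_cons.1 hO' with h | h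
    · have := (Prod.mk.inj h).1; omega
    · have := (List.pairwise_cons.1 H.sorted).1 _ h
      simp at this; omega
  have hsame := hm.2 s s' ht (by rwa [show s' + l = n by omega])
  refine hu (p + s + (l - (n - d))) (by omega) (by omega) ?_
  have := hsame.mono hy.path (a := l - (n - d)) (m := n - d) (by omega)
  rw [show p + s' + (l - (n - d)) = p + d by omega] at this
  rwa [show p + n - (p + d) = n - d by omega]

end

end TernaryRich

/-! ### Invariants of the search: weights and runs. -/

namespace TernaryRich

/-- `PS` packs the weights of the prefixes of `y` from position `p` on. -/
def Packs (wt y : ℕ → ℕ) (p n PS : ℕ) : Prop :=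
  PS < 2 ^ (42 * (n + 1)) ∧ ∀ j ≤ n, (PS >>> (42 * j)) % 2 ^ 42 = wsum wt y p (p + j)

theorem Packs.zero (wt y : ℕ → ℕ) (p : ℕ) : Packs wt y p 0 0 := by
  refine ⟨by positivity, fun j hj => ?_⟩
  obtain rfl : j = 0 := by omega
  simp [wsum_self]

theorem Packs.succ {wt y : ℕ → ℕ} {p n PS : ℕ} (h : Packs wt y p n PS)
    (ht : wsum wt y p (p + (n + 1)) < 2 ^ 42) :
    Packs wt y p (n + 1) (PS + wsum wt y p (p + (n + 1)) <<< (42 * (n + 1))) := by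
  rw [Nat.shiftLeft_eq]
  generalize hT : wsum wt y p (p + (n + 1)) = T at *
  refine ⟨?_, fun j hj => ?_⟩
  · calc PS + T * 2 ^ (42 * (n + 1)) < 2 ^ (42 * (n + 1)) + T * 2 ^ (42 * (n + 1)) := by
          have := h.1; omega
      _ = (T + 1) * 2 ^ (42 * (n + 1)) := by ring
      _ ≤ 2 ^ 42 * 2 ^ (42 * (n + 1)) := Nat.mul_le_mul_right _ ht
      _ = 2 ^ (42 * (n + 1 + 1)) := by rw [← pow_add]; ring_nf
  · rw [Nat.shiftRight_eq_div_pow]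
    rcases Nat.lt_or_ge n j with hjn | hjn
    · obtain rfl : j = n + 1 := by omega
      rw [Nat.add_mul_div_right _ _ (by positivity), Nat.div_eq_of_lt h.1, zero_add,
        Nat.mod_eq_of_lt ht, hT]
    · rw [← h.2 j hjn, Nat.shiftRight_eq_div_pow,
        show 42 * (n + 1) = 42 * (n - j) + 42 + 42 * j by omega, pow_add, ← mul_assoc,
        Nat.add_mul_div_right _ _ (by positivity), pow_add, ← mul_assoc, Nat.add_mul_mod_self_right]

theorem field_wsum {wt y : ℕ → ℕ} {p n PS j : ℕ} (h : Packs wt y p n PS) (hj : j ≤ n) :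
    field PS (wsum wt y p (p + n)) j = wsum wt y (p + j) (p + n) := by
  rw [field_eq, h.2 j hj, ← wsum_add wt y (show p ≤ p + j by omega) (show p + j ≤ p + n by omega)]
  omega

section
variable {P : Params} {S : Alphabet} {wt : ℕ → ℕ} {y : ℕ → ℕ} {p n W PS : ℕ}

/-- One inclusion suffices: each bit of the left factor reappears `8 * q` places further on, and a
single set bit determines the letter or the state. -/
theorem run_of_isRun (hy : SearchHyp P S wt y p) {q j i : ℕ} (hW : Encodes S y p (i + q) W)
    (hq : 1 ≤ q) (hji : j ≤ i) (h : isRun W q j i = true) : S.Run y (p + j) (p + (i + q)) q := by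
  rw [isRun_iff] at h
  have key : ∀ t, 8 * j + 6 ≤ t → t < 8 * (i + 1) → W.testBit t = true →
      W.testBit (t + 8 * q) = true := by
    intro t h1 h2 h3
    have := congrArg (fun m => m.testBit (t - (8 * j + 6))) h
    simp only [Nat.testBit_shiftRight, Nat.testBit_mod_two_pow] at this
    rw [show 8 * (j + q) + 6 + (t - (8 * j + 6)) = t + 8 * q by omega,
      show 8 * j + 6 + (t - (8 * j + 6)) = t by omega, h3] at this
    simpa [h2] using this
  refine ⟨hq, by omega, ?_, fun a ha hae => ?_⟩
  · have h2 := hy.src_lt (p + j)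
    have := key (8 * j + (6 + S.src (y (p + j)))) (by omega) (by omega)
      ((hW _ _ (by omega)).2 ⟨by omega, .inr rfl⟩)
    rw [show 8 * j + (6 + S.src (y (p + j))) + 8 * q = 8 * (j + q) + (6 + S.src (y (p + j))) by
      omega] at this
    rw [(hW.state hy h2 this).2, add_assoc]
  · obtain ⟨a, rfl⟩ := Nat.exists_eq_add_of_le (show p ≤ a by omega)
    have h6 := hy.lt_six (p + a)
    have := key (8 * (a + 1) + y (p + a)) (by omega) (by omega) (hW.testBit_letter hy (by omega))
    rw [show 8 * (a + 1) + y (p + a) + 8 * q = 8 * (a + 1 + q) + y (p + a) by omega] at this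
    obtain ⟨b, hb, -, h⟩ := hW.letter h6 this
    rw [h]; congr 1; omega

/-- What the search compares at the left end of a run. -/
def leftDiff (y : ℕ → ℕ) (p q : ℕ) : ℕ → ℕ
  | 0 => 0
  | j + 1 => 2 ^ y (p + j) ^^^ 2 ^ y (p + j + q)

theorem extendLeft_sound (hy : SearchHyp P S wt y p) (hW : Encodes S y p n W) {q : ℕ}
    {halt : ℕ → ℕ → Bool} (j : ℕ) (hr : S.Run y (p + j) (p + n) q)
    (h : extendLeft W q halt j = true) :
    ∃ j' ≤ j, S.Run y (p + j') (p + n) q ∧ halt j' (leftDiff y p q j') = true := by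
  induction j with
  | zero => exact ⟨0, le_rfl, hr, h⟩
  | succ j ih =>
    have hq := hr.2.1
    rw [extendLeft_succ] at h
    have e : ((W >>> (8 * (j + 1))) ^^^ (W >>> (8 * (j + 1 + q)))) % 64 =
        2 ^ y (p + j) ^^^ 2 ^ y (p + j + q) := by
      rw [show 64 = 2 ^ 6 by norm_num, Nat.xor_mod_two_pow, show 2 ^ 6 = 64 by norm_num,
        hW.group hy (by omega), show j + 1 + q = j + q + 1 by omega, hW.group hy (by omega),
        add_assoc]
    rw [e] at h
    split_ifs at h with h0
    · have heq : y (p + j) = y (p + j + q) :=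
        Nat.pow_right_injective le_rfl (Nat.xor_eq_zero_iff.1 h0)
      obtain ⟨j', h1, h2⟩ := ih ⟨hr.1, by omega, by rw [heq], fun a ha hae => by
        rcases Nat.eq_or_lt_of_le ha with rfl | ha
        · exact heq
        · exact hr.2.2.2 a (by omega) hae⟩ h
      exact ⟨j', by omega, h2⟩
    · exact ⟨j + 1, le_rfl, hr, h⟩

/-- The runs whose continuation by another letter with a long common prefix is impossible. -/
def Guards (mask : ℕ) (y : ℕ → ℕ) (p n : ℕ) (runs : List ℕ) : Prop :=
  ∀ q ∈ runs, 1 ≤ q ∧ q ≤ n ∧ mask.testBit (2 ^ y (p + n) ^^^ 2 ^ y (p + n - q)) = false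

theorem stopAt_sound (hy : SearchHyp P S wt y p) (hP : Packs wt y p n PS) {q j : ℕ}
    {K : List ℕ → Bool} {acc : List ℕ} (hr : S.Run y (p + j) (p + n) q)
    (ha : Guards P.mask y p n acc)
    (h : stopAt P.viol P.mask PS (wsum wt y p (p + n))
      (field PS (wsum wt y p (p + n)) (n - q)) q K acc j (leftDiff y p q j) = true) :
    ∃ acc', Guards P.mask y p n acc' ∧ K acc' = true := by
  have hq := hr.2.1
  rw [stopAt_eq, field_wsum hP (by omega), field_wsum hP (by omega), classify_eq,
    show p + (n - q) = p + n - q by omega] at h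
  have hl : (if P.mask.testBit (leftDiff y p q j) = true then 1 else 0 : ℕ) = 0 ∨
      (if P.mask.testBit (leftDiff y p q j) = true then 1 else 0 : ℕ) = 1 ∧ ∃ i', p + j = i' + 1 ∧
        P.mask.testBit (2 ^ y i' ^^^ 2 ^ y (i' + q)) = true := by
    split_ifs with hm
    · right
      refine ⟨rfl, ?_⟩
      cases j with
      | zero => rw [leftDiff, hy.mis_zero] at hm; cases hm
      | succ j => exact ⟨p + j, rfl, hm⟩
    · exact .inl rfl
  generalize (if P.mask.testBit (leftDiff y p q j) = true then 1 else 0 : ℕ) = c at h hl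
  -- Without a mismatch on the right the bound on powers applies as it stands, so the run cannot
  -- close the branch.
  have h0 := hy.power _ _ q _ 0 hr hl (.inl rfl)
  rw [add_zero] at h0
  rw [h0] at h
  simp only [Bool.false_eq_true, if_false] at h
  split_ifs at h with hv
  · refine ⟨q :: acc, fun q' hq' => ?_, h⟩
    rcases List.mem_cons.1 hq' with rfl | hq'
    · refine ⟨hr.1, by omega, ?_⟩
      by_contra hc
      rw [Bool.not_eq_false] at hc
      rw [hy.power _ _ q' _ 1 hr hl (.inr ⟨rfl, hc⟩)] at hv
      cases hv
    · exact ha q' hq'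
  · exact ⟨acc, ha, h⟩

theorem newRuns_sound (hy : SearchHyp P S wt y p) (hW : Encodes S y p n W)
    (hP : Packs wt y p n PS) {K : List ℕ → Bool} (pals : List (ℕ × ℕ)) (l q₀ : ℕ) (acc : List ℕ)
    (hs : ∀ a ∈ pals, a.1 < l) (hs' : pals.Pairwise fun a b => b.1 < a.1) (hl : l ≤ n)
    (ha : Guards P.mask y p n acc)
    (h : newRuns P.viol P.mask n W PS (wsum wt y p (p + n)) K pals l q₀ acc = true) :
    ∃ acc', Guards P.mask y p n acc' ∧ K acc' = true := by
  induction pals generalizing l q₀ acc with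
  | nil => exact ⟨acc, ha, h⟩
  | cons a pals ih =>
    have hal := hs a (by simp)
    have ih' := fun q₀ acc => ih a.1 q₀ acc (fun b hb => (List.pairwise_cons.1 hs').1 b hb)
      hs'.of_cons (by omega)
    rw [newRuns_cons, addRun_eq] at h
    split_ifs at h with h1 h2
    · exact ih' _ _ ha h
    · have hr := run_of_isRun hy (q := l - a.1) (i := n - (l - a.1))
        (by rwa [show n - (l - a.1) + (l - a.1) = n by omega]) (by omega) (by omega) h2
      rw [show n - (l - a.1) + (l - a.1) = n by omega] at hr
      obtain ⟨j', -, hr', h3⟩ := extendLeft_sound hy hW _ hr h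
      obtain ⟨acc', ha', hK⟩ := stopAt_sound hy hP hr' ha h3
      exact ih' _ _ ha' hK
    · exact ih' _ _ ha h

theorem badRuns_eq_false (hy : SearchHyp P S wt y p) (hW : Encodes S y p n W) {code : ℕ}
    (hc : code % 64 = 2 ^ y (p + n)) {runs : List ℕ} (hr : Guards P.mask y p n runs) :
    badRuns (n + 1) W code P.mask runs = false := by
  induction runs with
  | nil => rfl
  | cons q runs ih =>
    rw [← Bool.not_eq_true, badRuns_cons]
    have h1 := hr q (by simp)
    rintro (h | h)
    · have hg := hW.group hy (a := n - q) (by omega)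
      rw [show 64 = 2 ^ 6 by norm_num, Nat.xor_mod_two_pow, show 2 ^ 6 = 64 by norm_num, hc,
        show n + 1 - q = n - q + 1 by omega, hg, show p + (n - q) = p + n - q by omega, h1.2.2] at h
      cases h
    · rw [ih fun q hq => hr q (List.mem_cons_of_mem _ hq)] at h
      cases h

/-- The letters of `y` from position `p + n` on obey the restrictions `R`. -/
def Obeys (y : ℕ → ℕ) (p : ℕ) : List (List Letter → List Letter) → ℕ → Prop
  | [], _ => True
  | r :: R, n => (∀ L, ∀ x ∈ L, x.id = y (p + n) → x ∈ r L) ∧ Obeys y p R (n + 1)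

/-- The branch that follows `y` never dies: its next letter is offered, completes no forbidden word,
breaks no guarded run, and its longest palindromic suffix is new. It ends with the plan or at the
limit on weights, and both answer `false`. -/
theorem search_sound (hy : SearchHyp P S wt y p) (R : List (List Letter → List Letter))
    {n W ones PS : ℕ} {pals : List (ℕ × ℕ)} {runs : List ℕ} (hW : Encodes S y p n W)
    (h1 : Ones n ones) (hP : Packs wt y p n PS) (hl : ListsPals S y p n pals)
    (hr : Guards P.mask y p n runs) (hR : Obeys y p R n) :
    search P R n W ones PS (wsum wt y p (p + n)) (context S y p n) pals runs ≠ true := by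
  induction R generalizing n W ones PS pals runs with
  | nil => intro h; cases h
  | cons r R ih =>
    intro h
    obtain ⟨x, hx, hid, hrv, hdst, hwt, hcode, hbad⟩ := hy.letters n
    have hd := search_cons P r R n W ones PS _ _ pals runs h x (hR.1 _ x hx hid)
    have h6 : x.id < 6 := hid ▸ hy.lt_six _
    have hs2 : S.dst x.id < 2 := by rw [hid, (hy.path _).2]; exact hy.src_lt _
    have hc64 : x.code % 64 = 2 ^ y (p + n) := by
      rw [hcode, hid, pow_add, show 64 = 2 ^ 6 by norm_num, Nat.add_mul_mod_self_left,
        Nat.mod_eq_of_lt (Nat.pow_lt_pow_right (by norm_num) (hid ▸ h6))]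
    have hW' := hW.succ hy hid
    have htot : wsum wt y p (p + n) + x.wt = wsum wt y p (p + (n + 1)) := by
      rw [hwt, hid, ← add_assoc, wsum_succ _ _ (by omega)]
    have hctx : x.id :: context S y p n = context S y p (n + 1) := by rw [hid]; rfl
    have hl' := listsPals_step hy hW' h1.succ hid hl
    rw [deadLetter_eq, hbad, badRuns_eq_false hy hW hc64 hr, hrv, hdst, hcode, htot, hctx] at hd
    simp only [Bool.false_eq_true, if_false] at hd
    generalize hpals : updPals _ _ _ _ _ = pals' at hd hl'
    obtain ⟨O, hO, -⟩ := hl'.complete (n + 1) 0 rfl (fun a b ha hb hab => by omega)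
    cases pals' with
    | nil => cases hO
    | cons b t =>
      rw [checkPals_cons, if_pos (hl'.head_eq hy)] at hd
      split_ifs at hd with hlt
      have hP' := hP.succ (not_le.1 hlt)
      have hb : b.1 ≤ n + 1 := by
        have := hl'.top b (by simp)
        obtain ⟨t, -, ht⟩ := Nat.exists_ge_and_testBit_of_ge_two_pow this
        obtain ⟨s, -, hs⟩ := (hl'.marks b (by simp)).1 t ht
        omega
      obtain ⟨acc, hacc, hK⟩ := newRuns_sound hy hW' hP' t b.1 0 []
        (fun a ha => (List.pairwise_cons.1 hl'.sorted).1 a ha) hl'.sorted.of_cons hb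
        (fun q hq => by cases hq) hd
      exact ih hW' h1.succ hP' hl' hacc hR.2 hK

theorem obeys_free (k n : ℕ) : Obeys y p (free k) n := by
  induction k generalizing n with
  | zero => trivial
  | succ k ih => exact ⟨fun L x hx _ => hx, ih _⟩

theorem obeys_plan (m : ℕ) (u : List ℕ) (n : ℕ) (h : Occ y u (p + n + m)) :
    Obeys y p (plan m u) n := by
  induction m generalizing n with
  | zero =>
    rw [add_zero] at h
    induction u generalizing n with
    | nil => exact obeys_free 250 _
    | cons a u ih =>
      exact ⟨fun L x hx hid => mem_pick hx (hid.trans h.1), ih (n + 1) h.2⟩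
  | succ m ih =>
    exact ⟨fun L x hx _ => hx, ih _ (by rwa [show p + (n + 1) + m = p + n + (m + 1) by omega])⟩

theorem not_occ_of_searchFrom (hy : SearchHyp P S wt y p) {m : ℕ} {u : List ℕ}
    (h : searchFrom P (plan m u) (S.src (y p)) = true) : ¬ Occ y u (p + m) := by
  intro ho
  refine search_sound hy (plan m u) (Encodes.zero hy) Ones.zero (Packs.zero wt y p)
    listsPals_zero (runs := []) (fun q hq => by cases hq) (obeys_plan m u 0 ho) ?_
  rw [add_zero, wsum_self]
  exact h

end

end TernaryRich

/-! ### Models: alphabets with weights and forbidden words. -/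

namespace TernaryRich

/-- A labelled alphabet with weights, in the form the search works with: `viol r p t` tells that a
run of weight `r` with a period of weight `p` is too long if `t` of its ends are followed by
mismatches that count; these are the pairs `a`, `b` for which `mask` has the bit `2 ^ a ^^^ 2 ^ b`. -/
structure Model where
  S : Alphabet
  wt : ℕ → ℕ
  mask : ℕ
  viol : ℕ → ℕ → ℕ → Bool
  size : S.size ≤ 6
  states : ∀ a < S.size, S.src a < 2
  mis_zero : mask.testBit 0 = false

structure Model.Good (M : Model) (y : ℕ → ℕ) : Prop where
  path : M.S.IsPath y
  rich : M.S.Rich y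
  power : ∀ i e q l r, M.S.Run y i e q →
    (l = 0 ∨ l = 1 ∧ ∃ i', i = i' + 1 ∧ M.mask.testBit (2 ^ y i' ^^^ 2 ^ y (i' + q)) = true) →
    (r = 0 ∨ r = 1 ∧ M.mask.testBit (2 ^ y e ^^^ 2 ^ y (e - q)) = true) →
    M.viol (wsum M.wt y i e) (wsum M.wt y (e - q) e) (l + r) = false

theorem Model.Good.shift {M : Model} {y : ℕ → ℕ} (h : M.Good y) (k : ℕ) :
    M.Good (fun t => y (k + t)) where
  path := h.path.shift k
  rich := h.rich.shift k
  power := by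
    intro i e q l r hr hl hr'
    rw [wsum_shift, wsum_shift]
    have hq := hr.2.1
    rw [show k + (e - q) = k + e - q by omega]
    refine h.power (k + i) (k + e) q l r ⟨hr.1, by omega, ?_, fun a ha hae => ?_⟩ ?_ ?_
    · simpa [add_assoc] using hr.2.2.1
    · obtain ⟨a, rfl⟩ := Nat.exists_eq_add_of_le (show k ≤ a by omega)
      simpa [add_assoc] using hr.2.2.2 a (by omega) (by omega)
    · rcases hl with hl | ⟨hl, i', rfl, h'⟩
      · exact .inl hl
      · exact .inr ⟨hl, k + i', rfl, by simpa [add_assoc] using h'⟩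
    · rcases hr' with hr' | ⟨hr', h'⟩
      · exact .inl hr'
      · exact .inr ⟨hr', by rw [show k + e - q = k + (e - q) by omega]; exact h'⟩

/-- The continuations of the words in `F`, which are read backwards, that end in the letter `b`. -/
def endings (b : ℕ) (F : List (List ℕ)) : List (List ℕ) :=
  (F.filter fun u => Nat.beq (u.headD 0) b).map List.tail

namespace Model
variable (M : Model)

def letter (F : List (List ℕ)) (b : ℕ) : Letter :=
  ⟨b, M.S.rv b, M.S.dst b, M.wt b, 2 ^ b + 2 ^ (6 + M.S.dst b),
    (endings b F).filter fun u => Nat.ble 2 u.length⟩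

/-- Forbidden words of one or two symbols are built into the table, where a start marker 6 or 7
counts as a symbol; the longer ones are left to `bad`. -/
def row (F : List (List ℕ)) (s a : ℕ) : List Letter :=
  ((List.range M.S.size).filter fun b =>
    Nat.beq (M.S.src b) s && !((endings b F).contains [] || (endings b F).contains [a])).map
      (M.letter F)

def params (F : List (List ℕ)) : Params :=
  ⟨M.mask, M.viol, [M.row F (M.S.dst 0) 0, M.row F (M.S.dst 1) 1, M.row F (M.S.dst 2) 2,
    M.row F (M.S.dst 3) 3, M.row F (M.S.dst 4) 4, M.row F (M.S.dst 5) 5, M.row F 0 6, M.row F 1 7]⟩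

/-- No word from the state `s` on has `u` after `m` letters, if it avoids the words of `F` and does
not begin with a word of `G`. -/
noncomputable def excludes (F G : List (List ℕ)) (s m : ℕ) (u : List ℕ) : Bool :=
  searchFrom (M.params (F.map List.reverse ++ G.map fun v => v.reverse ++ [6 + s])) (plan m u) s

end Model

theorem startsWith_iff (u w : List ℕ) : startsWith u w = true ↔ u <+: w := by
  induction u generalizing w with
  | nil => exact ⟨fun _ => List.nil_prefix, fun _ => rfl⟩
  | cons a u ih =>
    cases w with
    | nil => exact ⟨fun h => (by cases h), fun h => by simp at h⟩
    | cons b w =>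
      change @Bool.rec (fun _ => Bool) false (startsWith u w) (Nat.beq a b) = true ↔ _
      rw [boolRec_beq, List.cons_prefix_cons, ← ih]
      split_ifs with h <;> simp [h]

theorem hits_iff (U : List (List ℕ)) (w : List ℕ) : hits U w = true ↔ ∃ u ∈ U, u <+: w := by
  induction U with
  | nil => exact ⟨fun h => (by cases h), fun h => by simp at h⟩
  | cons u U ih =>
    change @Bool.rec (fun _ => Bool) (hits U w) true (startsWith u w) = true ↔ _
    rw [boolRec]
    by_cases h : startsWith u w = true
    · rw [if_pos h]; simp [(startsWith_iff u w).1 h]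
    · rw [if_neg h, ih]; rw [startsWith_iff] at h; simp [h]

/-- The default value of `headD` makes the empty word pass as one that ends in `0`, whence the first
alternative. -/
theorem mem_endings {b : ℕ} {F : List (List ℕ)} {v : List ℕ} (h : v ∈ endings b F) :
    [] ∈ F ∨ b :: v ∈ F := by
  simp only [endings, List.mem_map, List.mem_filter, Nat.beq_eq] at h
  obtain ⟨u, ⟨hu, hb⟩, rfl⟩ := h
  cases u with
  | nil => exact .inl hu
  | cons c u => right; simp at hb; rwa [← hb]

theorem context_eq (S : Alphabet) (y : ℕ → ℕ) (p n : ℕ) :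
    context S y p n = ((List.range n).map fun i => y (p + i)).reverse ++ [6 + S.src (y p)] := by
  induction n with
  | zero => rfl
  | succ n ih => simp [context, ih, List.range_succ]

namespace Model
variable {M : Model} {y : ℕ → ℕ} {p : ℕ}

theorem Good.searchHyp (hy : M.Good y) {F : List (List ℕ)}
    (hF : ∀ n, ∀ u ∈ F, ¬ u <+: context M.S y p n) : SearchHyp (M.params F) M.S M.wt y p where
  path := hy.path
  rich := hy.rich
  size := M.size
  states := M.states
  mis_zero := M.mis_zero
  power := hy.power
  letters := by
    intro n
    have hlt := fun i => (hy.path i).1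
    refine ⟨M.letter F (y (p + n)), ?_, rfl, rfl, rfl, rfl, rfl, ?_⟩
    · have key : ∀ a w, context M.S y p n = a :: w →
          M.letter F (y (p + n)) ∈ M.row F (M.S.src (y (p + n))) a := by
        intro a w haw
        refine List.mem_map_of_mem (List.mem_filter.2 ⟨List.mem_range.2 (hlt _), ?_⟩)
        simp only [Nat.beq_eq, Bool.and_eq_true, Bool.not_eq_true', Bool.or_eq_false_iff,
          List.contains_eq_mem, decide_eq_false_iff_not]
        refine ⟨by simp, fun h => ?_, fun h => ?_⟩
        · rcases mem_endings h with h | h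
          · exact hF 0 _ h List.nil_prefix
          · exact hF (n + 1) _ h (by simp [context])
        · rcases mem_endings h with h | h
          · exact hF 0 _ h List.nil_prefix
          · exact hF (n + 1) _ h (by simp [context, haw])
      cases n with
      | zero =>
        have := key _ _ rfl
        have h2 := M.states _ (hlt p)
        simp only [add_zero] at this ⊢
        have h01 : M.S.src (y p) = 0 ∨ M.S.src (y p) = 1 := by omega
        rcases h01 with h | h <;> rw [h] at this <;> simp only [context, h] <;> exact this
      | succ n =>
        have := key _ _ rfl
        have h6 := (hlt (p + n)).trans_le M.size
        rw [← add_assoc, ← (hy.path _).2, add_assoc] at this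
        change _ ∈ nextLetters _ (y (p + n) :: _)
        generalize y (p + n) = a at *
        interval_cases a <;> exact this
    · rw [← Bool.not_eq_true, hits_iff]
      rintro ⟨u, hu, h⟩
      rcases mem_endings (List.mem_of_mem_filter hu) with h' | h'
      · exact hF 0 _ h' List.nil_prefix
      · exact hF (n + 1) _ h' (by simpa [context] using h)

theorem occ_of_append_eq {u v : List ℕ} {n : ℕ}
    (h : u ++ v = (List.range n).map fun i => y (p + i)) : Occ y v (p + u.length) := by
  rw [occ_iff]
  intro j hj
  have h1 : (u ++ v)[u.length + j]'(by simp; omega) = v[j] := by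
    rw [List.getElem_append_right (by omega)]; simp
  rw [← h1]
  simp only [h, List.getElem_map, List.getElem_range, add_assoc]

theorem not_prefix_context {v : List ℕ} (h : Avoids y v) (hv : ∀ a ∈ v, a < 6) (n : ℕ) :
    ¬ v.reverse <+: context M.S y p n := by
  rw [context_eq]
  intro hp
  have hlen : v.length ≤ n := by
    by_contra hc
    have h1 := hp.length_le
    simp only [List.length_reverse, List.length_append, List.length_map, List.length_range,
      List.length_singleton] at h1
    have h2 := hp.eq_of_length (by simp; omega)
    have : 6 + M.S.src (y p) ∈ v := by
      rw [← List.mem_reverse, h2]; simp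
    have := hv _ this
    omega
  have h2 := List.prefix_of_prefix_length_le hp (List.prefix_append _ [6 + M.S.src (y p)])
    (by simpa using hlen)
  obtain ⟨u, hu⟩ := List.reverse_prefix.1 h2
  exact h _ (occ_of_append_eq hu)

/-- The symbol `6 + s` is not a letter, so it can match only the last entry of the context; this
ties the word to the position `p`. -/
theorem Good.not_prefix_context' (hy : M.Good y) {v : List ℕ} {s : ℕ} (h : ¬ Occ y v p) (n : ℕ) :
    ¬ v.reverse ++ [6 + s] <+: context M.S y p n := by
  rw [context_eq]
  intro hp
  have h1 := hp.length_le
  simp only [List.length_reverse, List.length_append, List.length_map, List.length_range,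
    List.length_singleton] at h1
  rcases Nat.lt_or_ge v.length n with hlt | hge
  · have h2 := List.prefix_of_prefix_length_le hp (List.prefix_append _ [6 + M.S.src (y p)])
      (by simpa using hlt)
    have h3 : 6 + s ∈ ((List.range n).map fun i => y (p + i)).reverse :=
      h2.subset (by simp)
    simp only [List.mem_reverse, List.mem_map] at h3
    obtain ⟨i, -, hi⟩ := h3
    have := (hy.path (p + i)).1.trans_le M.size
    omega
  · have h2 := hp.eq_of_length (by simp; omega)
    have h3 := (List.append_inj h2 (by simp; omega)).1
    exact h (occ_of_append_eq (u := []) (List.reverse_injective h3))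

theorem Good.not_occ (hy : M.Good y) {F G : List (List ℕ)} {m : ℕ} {u : List ℕ}
    (hF : ∀ v ∈ F, Avoids y v) (hF' : ∀ v ∈ F, ∀ a ∈ v, a < 6) (hG : ∀ v ∈ G, ¬ Occ y v p)
    (h : M.excludes F G (M.S.src (y p)) m u = true) : ¬ Occ y u (p + m) := by
  refine not_occ_of_searchFrom (hy.searchHyp ?_) h
  intro n u hu
  rcases List.mem_append.1 hu with hu | hu
  · obtain ⟨v, hv, rfl⟩ := List.mem_map.1 hu
    exact not_prefix_context (hF v hv) (hF' v hv) n
  · obtain ⟨v, hv, rfl⟩ := List.mem_map.1 hu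
    exact hy.not_prefix_context' (hG v hv) n

theorem eventually_avoids {y : ℕ → ℕ} {F : List (List ℕ)} (hF : ∀ v ∈ F, EvAvoids y v) :
    ∃ N, ∀ k ≥ N, ∀ v ∈ F, Avoids (fun t => y (k + t)) v := by
  have : ∀ᶠ i in Filter.atTop, ∀ v ∈ F, ¬ Occ y v i := by
    induction F with
    | nil => simp
    | cons v F ih =>
      have h1 := hF v (by simp)
      have h2 := ih fun v hv => hF v (List.mem_cons_of_mem _ hv)
      filter_upwards [h1, h2] with i h1 h2 v hv
      rcases List.mem_cons.1 hv with rfl | hv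
      · exact h1
      · exact h2 v hv
  obtain ⟨N, hN⟩ := Filter.eventually_atTop.1 this
  exact ⟨N, fun k hk v hv i => by rw [occ_shift]; exact hN _ (by omega) v hv⟩

/-- A word that dies out in the search, from either state, eventually does not occur. -/
theorem Good.evAvoids (hy : M.Good y) {F : List (List ℕ)} {m : ℕ} {u : List ℕ}
    (hF : ∀ v ∈ F, EvAvoids y v) (hF' : ∀ v ∈ F, ∀ a ∈ v, a < 6)
    (h₀ : M.excludes F [] 0 m u = true) (h₁ : M.excludes F [] 1 m u = true) : EvAvoids y u := by
  obtain ⟨N, hN⟩ := eventually_avoids hF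
  refine Filter.eventually_atTop.2 ⟨N + m, fun i hi ho => ?_⟩
  obtain ⟨d, rfl⟩ := Nat.exists_eq_add_of_le hi
  have hs := (M.states _ ((hy.shift N).path d).1)
  refine (hy.shift N).not_occ (p := d) (m := m) (F := F) (G := []) (u := u)
    (hN N le_rfl) hF' (by simp) ?_ ?_
  · have h01 : M.S.src (y (N + d)) = 0 ∨ M.S.src (y (N + d)) = 1 := by omega
    rcases h01 with h | h <;> rw [h] <;> assumption
  · rw [occ_shift, ← add_assoc, add_right_comm]; exact ho

end Model
end TernaryRich

namespace TernaryRich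

/-! ### Decoding a word along marked return words -/

theorem Occ.drop {y : ℕ → ℕ} {u : List ℕ} {i : ℕ} (h : Occ y u i) {o : ℕ} (ho : o ≤ u.length) :
    Occ y (u.drop o) (i + o) := by
  rw [← List.take_append_drop o u, occ_append, List.length_take_of_le ho] at h
  exact h.2

theorem Occ.of_prefix {y : ℕ → ℕ} {u v : List ℕ} {i : ℕ} (h : Occ y v i) (huv : u <+: v) :
    Occ y u i := by
  obtain ⟨w, rfl⟩ := huv
  exact ((occ_append ..).1 h).1

theorem Occ.prefix {y : ℕ → ℕ} {u v : List ℕ} {i : ℕ} (hu : Occ y u i) (hv : Occ y v i)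
    (h : u.length ≤ v.length) : u <+: v := by
  induction u generalizing v i with
  | nil => exact List.nil_prefix
  | cons a u ih =>
    cases v with
    | nil => simp at h
    | cons b v =>
      rw [List.cons_prefix_cons]
      exact ⟨hu.1.symm.trans hv.1, ih hu.2 hv.2 (by simpa using h)⟩

theorem Occ.eq {y : ℕ → ℕ} {u : List ℕ} {i k j : ℕ} (hu : Occ y u i) (hv : Occ y u k)
    (h : j < u.length) : y (i + j) = y (k + j) := by
  rw [occ_iff] at hu hv
  rw [hu j h, hv j h]

theorem Occ.wsum {y : ℕ → ℕ} {u : List ℕ} {i : ℕ} (hu : Occ y u i) (w : ℕ → ℕ) :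
    wsum w y i (i + u.length) = (u.map w).sum := by
  induction u generalizing i with
  | nil => simp [wsum_self]
  | cons a u ih =>
    rw [wsum_cons w y (by simp), List.length_cons, show i + (u.length + 1) = i + 1 + u.length by ring,
      ih hu.2, hu.1, List.map_cons, List.sum_cons]

/-- `u` is what one reads leftwards from the boundary `i`. -/
def OccLeft (y : ℕ → ℕ) : List ℕ → ℕ → Prop
  | [], _ => True
  | a :: u, i => ∃ i', i = i' + 1 ∧ y i' = a ∧ OccLeft y u i'

theorem Occ.occLeft {y : ℕ → ℕ} {u : List ℕ} {i : ℕ} (hu : Occ y u i) :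
    OccLeft y u.reverse (i + u.length) := by
  induction u using List.reverseRecOn with
  | nil => trivial
  | append_singleton u a ih =>
    rw [occ_append] at hu
    rw [List.reverse_append, List.length_append]
    exact ⟨i + u.length, rfl, hu.2.1, ih hu.1⟩

namespace Alphabet
variable {S : Alphabet} {y : ℕ → ℕ}

theorem Pal.occ_revWord (h : S.Pal y p e) {u : List ℕ} {t t' : ℕ} (hu : Occ y u t) (hp : p ≤ t)
    (he : t + u.length + t' = p + e) (hp' : p ≤ t') : Occ y (S.revWord u) t' := by
  rw [occ_revWord_iff]
  rw [occ_iff] at hu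
  intro j hj
  rw [← hu j hj]
  exact h _ _ (by omega) (by omega) (by omega)

/-- Sliding a window of one period along the run exchanges equal letters. -/
theorem Run.wsum_period {i e q : ℕ} (h : S.Run y i e q) (w : ℕ → ℕ) :
    wsum w y (e - q) e = wsum w y i (i + q) := by
  obtain ⟨h1, h2, h3, h4⟩ := h
  induction e, h2 using Nat.le_induction with
  | base => rw [Nat.add_sub_cancel]
  | succ e he ih =>
    rw [← ih fun a ha hae => h4 a ha (by omega), wsum_succ _ _ (by omega), wsum_cons w y (i := e - q) (by omega),
      show e - q + 1 = e + 1 - q by omega, h4 (e - q) (by omega) (by omega),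
      show e - q + q = e by omega, add_comm]

/-- A lower bound for the weight of the common prefix of `u` and `v` and of the mismatch after it. -/
def ext (w : ℕ → ℕ) (ε : ℕ → ℕ → ℕ) : List ℕ → List ℕ → ℕ
  | a :: u, b :: v => if a = b then w a + ext w ε u v else ε a b
  | _, _ => 0

section
variable {w : ℕ → ℕ} {lam : ℕ} {ε : ℕ → ℕ → ℕ}

/-- The run is lengthened letter by letter while the two continuations agree, and their first
disagreement is charged with `ε`. The weight of the period does not change. -/
theorem PowerBound.ext_right (h : S.PowerBound w lam ε y) {i q l : ℕ}
    (hl : l = 0 ∨ ∃ i', i = i' + 1 ∧ l = ε (y i') (y (i' + q))) (u v : List ℕ) {e : ℕ}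
    (hr : S.Run y i e q) (hu : Occ y u e) (hv : Occ y v (e - q)) :
    7 * (wsum w y i e + lam + l + ext w ε u v) < 16 * wsum w y i (i + q) := by
  rw [← hr.wsum_period w]
  induction u generalizing v e with
  | nil => simpa [ext] using h i e q l 0 hr hl (.inl rfl)
  | cons a u ih =>
    cases v with
    | nil => simpa [ext] using h i e q l 0 hr hl (.inl rfl)
    | cons b v =>
      rw [ext]
      have hq := hr.2.1
      split_ifs with hab
      · have hr' : S.Run y i (e + 1) q := ⟨hr.1, by omega, hr.2.2.1, fun c hc hce => by
          rcases Nat.eq_or_lt_of_le (show c + q ≤ e by omega) with he | he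
          · rw [he, hu.1, hab, ← hv.1]; congr 1; omega
          · exact hr.2.2.2 c hc he⟩
        have := ih v hr' hu.2 (by rw [show e + 1 - q = e - q + 1 by omega]; exact hv.2)
        rw [hr'.wsum_period w, ← hr.wsum_period w, wsum_succ _ _ (by omega), hu.1] at this
        omega
      · exact h i e q l _ hr hl (.inr (by rw [hu.1, hv.1]))

theorem PowerBound.ext_both (h : S.PowerBound w lam ε y) {q e : ℕ}
    (u v u' v' : List ℕ) {i : ℕ} (hr : S.Run y i e q) (hu : Occ y u e) (hv : Occ y v (e - q))
    (hu' : OccLeft y u' i) (hv' : OccLeft y v' (i + q)) :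
    7 * (wsum w y i e + lam + ext w ε u' v' + ext w ε u v) < 16 * wsum w y i (i + q) := by
  induction u' generalizing v' i with
  | nil => simpa [ext] using h.ext_right (.inl rfl) u v hr hu hv
  | cons a u' ih =>
    cases v' with
    | nil => simpa [ext] using h.ext_right (.inl rfl) u v hr hu hv
    | cons b v' =>
      obtain ⟨j, rfl, rfl, hj⟩ := hu'
      obtain ⟨k, hk, rfl, hk'⟩ := hv'
      obtain rfl : k = j + q := by omega
      have hq := hr.2.1
      rw [ext]
      split_ifs with hab
      · have hr' : S.Run y j e q := ⟨hr.1, by omega, by rw [hab], fun c hc hce => by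
          rcases Nat.eq_or_lt_of_le hc with rfl | hc
          · exact hab
          · exact hr.2.2.2 c hc hce⟩
        have := ih v' hr' hj hk'
        rw [← hr'.wsum_period w, hr.wsum_period w, wsum_cons w y (i := j) (e := e) (by omega)] at this
        omega
      · exact h.ext_right (.inr ⟨j, rfl, rfl⟩) u v hr hu hv

end
end Alphabet

/-- A coding of the words over `S'` by words over `S`. The code word of a letter `a` begins, if
continued, with the marker `W (S'.src a)`, and has no other marker inside. -/
structure Coding (S S' : Alphabet) where
  states : ℕ
  φ : ℕ → List ℕ
  W : ℕ → List ℕ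
  len : ℕ
  len_pos : 0 < len
  src_lt : ∀ a < S'.size, S'.src a < states
  length_W : ∀ s < states, (W s).length = len
  rev_W : ∀ s < states, S.revWord (W s) = W s
  W_inj : ∀ s < states, ∀ s' < states, W s = W s' → s = s'
  φ_ne : ∀ a < S'.size, φ a ≠ []
  W_prefix : ∀ a < S'.size, W (S'.src a) <+: φ a ++ W (S'.dst a)
  inner : ∀ a < S'.size, ∀ s < states, ∀ o < (φ a).length, 0 < o →
    ¬ W s <+: (φ a ++ W (S'.dst a)).drop o
  rev_φ : ∀ a < S'.size, S.revWord (φ a ++ W (S'.dst a)) = φ (S'.rv a) ++ W (S'.src a)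
  -- Two letters may share a code word; the marker that follows then tells them apart.
  φ_inj : ∀ a < S'.size, ∀ b < S'.size, φ a ++ W (S'.dst a) <+: φ b ++ W (S'.dst b) → a = b

namespace Coding
variable {S S' : Alphabet} (C : Coding S S')

/-- `y` is, from its beginning on, the code of `y'`; the code word number `i` is at `pos i`. -/
structure Decodes (y y' pos : ℕ → ℕ) : Prop where
  path : S.IsPath y
  path' : S'.IsPath y'
  zero : pos 0 = 0
  succ : ∀ i, pos (i + 1) = pos i + (C.φ (y' i)).length
  occ : ∀ i, Occ y (C.φ (y' i) ++ C.W (S'.dst (y' i))) (pos i)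

theorem exists_decodes {y : ℕ → ℕ} (hp : S.IsPath y)
    (h0 : ∃ s < C.states, Occ y (C.W s) 0)
    (hs : ∀ t, ∀ s < C.states, Occ y (C.W s) t →
      ∃ a < S'.size, S'.src a = s ∧ Occ y (C.φ a ++ C.W (S'.dst a)) t) :
    ∃ y' pos, C.Decodes y y' pos := by
  have : ∀ t s, ∃ a, s < C.states → Occ y (C.W s) t →
      a < S'.size ∧ S'.src a = s ∧ Occ y (C.φ a ++ C.W (S'.dst a)) t := by
    intro t s
    by_cases h : s < C.states ∧ Occ y (C.W s) t
    · obtain ⟨a, ha⟩ := hs t s h.1 h.2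
      exact ⟨a, fun _ _ => ha⟩
    · exact ⟨0, fun h1 h2 => absurd ⟨h1, h2⟩ h⟩
  choose A hA using this
  obtain ⟨s₀, hs₀, h0⟩ := h0
  -- The reader keeps its position and the state whose marker stands there.
  let P : ℕ → ℕ × ℕ := fun n => Nat.rec (0, s₀)
    (fun _ p => (p.1 + (C.φ (A p.1 p.2)).length, S'.dst (A p.1 p.2))) n
  have hP : ∀ n, (P n).2 < C.states ∧ Occ y (C.W (P n).2) (P n).1 := by
    intro n
    induction n with
    | zero => exact ⟨hs₀, h0⟩
    | succ n ih =>
      obtain ⟨h1, h2, h3⟩ := hA _ _ ih.1 ih.2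
      refine ⟨?_, ((occ_append ..).1 h3).2⟩
      change S'.dst _ < _
      rw [← S'.src_rv _ h1]
      exact C.src_lt _ (S'.rv_lt _ h1)
  have hP' := fun n => hA _ _ (hP n).1 (hP n).2
  refine ⟨fun n => A (P n).1 (P n).2, fun n => (P n).1, hp, fun n => ⟨(hP' n).1, ?_⟩, rfl,
    fun i => rfl, fun i => (hP' i).2.2⟩
  exact (hP' (n + 1)).2.1.symm

namespace Decodes
variable {C} {y y' pos : ℕ → ℕ}

theorem src_lt (D : C.Decodes y y' pos) (i : ℕ) : S'.src (y' i) < C.states :=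
  C.src_lt _ (D.path' i).1

theorem length_W (D : C.Decodes y y' pos) (i : ℕ) : (C.W (S'.src (y' i))).length = C.len :=
  C.length_W _ (D.src_lt i)

theorem mono (D : C.Decodes y y' pos) : StrictMono pos :=
  strictMono_nat_of_lt_succ fun i => by
    have := List.length_pos_of_ne_nil (C.φ_ne _ (D.path' i).1)
    rw [D.succ]; omega

theorem mark (D : C.Decodes y y' pos) (i : ℕ) : Occ y (C.W (S'.src (y' i))) (pos i) :=
  (D.occ i).of_prefix (C.W_prefix _ (D.path' i).1)

theorem block (D : C.Decodes y y' pos) (i : ℕ) : Occ y (C.φ (y' i)) (pos i) :=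
  ((occ_append ..).1 (D.occ i)).1

/-- Markers occur at the beginnings of code words only. -/
theorem sync (D : C.Decodes y y' pos) {s t : ℕ} (hs : s < C.states) (h : Occ y (C.W s) t) :
    ∃ i, t = pos i ∧ S'.src (y' i) = s := by
  obtain ⟨i, hi, hi'⟩ : ∃ i, pos i ≤ t ∧ t < pos (i + 1) := by
    have hex : ∃ i, t < pos (i + 1) := ⟨t, (Nat.lt_succ_self t).trans_le (D.mono.id_le (t + 1))⟩
    refine ⟨Nat.find hex, ?_, Nat.find_spec hex⟩
    rcases hf : Nat.find hex with _ | k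
    · rw [D.zero]; omega
    · have := Nat.find_min hex (m := k) (by omega)
      omega
  rw [D.succ] at hi'
  obtain ⟨o, rfl⟩ := Nat.exists_eq_add_of_le hi
  rcases Nat.eq_zero_or_pos o with rfl | ho
  · refine ⟨i, rfl, ?_⟩
    have h2 := h.prefix (D.mark i) (by rw [C.length_W _ hs, D.length_W])
    exact (C.W_inj _ hs _ (D.src_lt i)
      (h2.eq_of_length (by rw [C.length_W _ hs, D.length_W]))).symm
  · exfalso
    have hd := C.length_W _ (D.src_lt (i + 1))
    rw [← (D.path' i).2] at hd
    refine C.inner _ (D.path' i).1 s hs o (by omega) ho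
      (h.prefix ((D.occ i).drop (by simp; omega)) ?_)
    rw [List.length_drop, List.length_append, C.length_W _ hs, hd]
    omega

theorem unique (D : C.Decodes y y' pos) {a i : ℕ} (ha : a < S'.size)
    (h : Occ y (C.φ a ++ C.W (S'.dst a)) (pos i)) : a = y' i := by
  rcases Nat.le_total (C.φ a ++ C.W (S'.dst a)).length
    (C.φ (y' i) ++ C.W (S'.dst (y' i))).length with hl | hl
  · exact C.φ_inj _ ha _ (D.path' i).1 (h.prefix (D.occ i) hl)
  · exact (C.φ_inj _ (D.path' i).1 _ ha ((D.occ i).prefix h hl)).symm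

theorem wsum_eq (D : C.Decodes y y' pos) {w w' : ℕ → ℕ}
    (hw : ∀ a < S'.size, w' a = ((C.φ a).map w).sum) {i j : ℕ} (h : i ≤ j) :
    wsum w y (pos i) (pos j) = wsum w' y' i j := by
  induction j, h using Nat.le_induction with
  | base => simp [wsum_self]
  | succ j hj ih =>
    rw [wsum_succ _ _ hj, ← ih, hw _ (D.path' j).1, ← (D.block j).wsum w, ← D.succ,
      wsum_add _ _ (D.mono.monotone hj) (D.mono.monotone (Nat.le_succ j))]

/-- The state reached determines the marker that follows, hence the extra `C.len` letters. -/
theorem same (D : C.Decodes y y' pos) {s t n : ℕ} (h : S'.Same y' s t n) :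
    pos (s + n) - pos s = pos (t + n) - pos t ∧
      ∀ j < pos (t + n) - pos t + C.len, y (pos s + j) = y (pos t + j) := by
  induction n generalizing s t with
  | zero =>
    refine ⟨by simp, fun j hj => ?_⟩
    have h1 := D.mark s
    rw [h.1] at h1
    exact h1.eq (D.mark t) (by rw [D.length_W]; simpa using hj)
  | succ n ih =>
    have h0 : y' s = y' t := h.2 0 (by omega)
    have hst : S'.Same y' (s + 1) (t + 1) n := h.mono D.path' (by omega)
    obtain ⟨h1, h2⟩ := ih hst
    have es := D.succ s
    have et := D.succ t
    rw [h0] at es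
    have ms := D.mono.monotone (show s + 1 ≤ s + 1 + n by omega)
    have mt := D.mono.monotone (show t + 1 ≤ t + 1 + n by omega)
    rw [show s + (n + 1) = s + 1 + n by ring, show t + (n + 1) = t + 1 + n by ring]
    refine ⟨by omega, fun j hj => ?_⟩
    rcases Nat.lt_or_ge j (C.φ (y' t)).length with hlt | hge
    · have h3 := D.block s
      rw [h0] at h3
      exact h3.eq (D.block t) hlt
    · have := h2 (j - (C.φ (y' t)).length) (by omega)
      rwa [es, et, add_assoc, add_assoc, Nat.add_sub_cancel' hge] at this

/-- Richness passes to the decoded word. -/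
theorem rich (D : C.Decodes y y' pos) (hR : S.Rich y) : S'.Rich y' := by
  intro i e hie
  have hmono := D.mono.monotone hie
  -- The factor includes the marker at its end, so that it begins and ends with a marker, as its
  -- reversal does.
  obtain ⟨p, hip, hpe, hpal, hu⟩ := hR (pos i) (pos e + C.len) (by omega)
  have hlen := D.length_W e
  have hlp := C.len_pos
  have hWe := D.mark e
  have hWrev := C.rev_W _ (D.src_lt e)
  rcases Nat.lt_or_ge (pos e) p with hlt | hge
  -- A palindrome shorter than the final marker would also be a prefix of this marker, which is its
  -- own reversal, and so would occur earlier.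
  · exfalso
    have hrev : ∀ j < C.len, y (pos e + (C.len - 1 - j)) = S.rv (y (pos e + j)) := by
      intro j hj
      have h1 := hWe
      rw [← hWrev, Alphabet.occ_revWord_iff] at h1
      rw [← hlen, h1 j (by omega), (occ_iff ..).1 hWe j (by omega)]
    have key : ∀ j < pos e + C.len - p, y (pos e + j) = y (p + j) := by
      intro j hj
      have h1 := hpal (p + j) (pos e + (C.len - 1 - j)) (by omega) (by omega) (by omega)
      rw [hrev j (by omega)] at h1
      have := congrArg S.rv h1
      rwa [S.rv_rv _ (D.path _).1, S.rv_rv _ (D.path _).1] at this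
    refine hu (pos e) hmono hlt ⟨?_, key⟩
    rcases Nat.eq_or_lt_of_le hpe with rfl | h
    · have h1 := hrev 0 hlp
      have h2 := (D.path (pos e + (C.len - 1 - 0))).2
      rw [h1, add_zero, S.dst_rv (D.path _).1] at h2
      rw [h2]; congr 2; omega
    · have := key 0 (by omega)
      rw [add_zero, add_zero] at this
      rw [this]
  -- Mirrored in the palindrome, the final marker stands at `p`, which is therefore the beginning of
  -- a code word.
  · have hW := hpal.occ_revWord hWe hge (t' := p) (by rw [hlen]; omega) le_rfl
    rw [hWrev] at hW
    obtain ⟨i', rfl, hst⟩ := D.sync (D.src_lt e) hW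
    have hii : i ≤ i' := D.mono.le_iff_le.1 hip
    have hie' : i' ≤ e := D.mono.le_iff_le.1 hge
    -- A code word with its next marker is mirrored to the code word of the reversed letter with its
    -- marker, so the two ends are decoded in step.
    have claim : ∀ j, i' + j ≤ e → pos (i' + j) + pos (e - j) = pos i' + pos e ∧
        (1 ≤ j → y' (e - j) = S'.rv (y' (i' + j - 1))) := by
      intro j
      induction j with
      | zero => intro _; simp
      | succ j ih =>
        intro hj
        obtain ⟨h1, -⟩ := ih (by omega)
        have ha := (D.path' (i' + j)).1
        have hocc := D.occ (i' + j)
        have hsucc := D.succ (i' + j)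
        have hle : pos (i' + j + 1) ≤ pos e := D.mono.monotone (by omega)
        have hle' : pos i' ≤ pos (i' + j) := D.mono.monotone (by omega)
        have hd : (C.W (S'.dst (y' (i' + j)))).length = C.len := by
          rw [(D.path' _).2]; exact D.length_W _
        have hrφ := C.rev_φ _ ha
        have hlenφ : (C.φ (S'.rv (y' (i' + j)))).length = (C.φ (y' (i' + j))).length := by
          have := congrArg List.length hrφ
          simp only [Alphabet.revWord, List.length_reverse, List.length_map, List.length_append,
            hd, D.length_W] at this
          omega
        have hT := hpal.occ_revWord (t' := pos i' + pos e - pos (i' + j + 1)) hocc hle'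
          (by rw [List.length_append, hd]; omega) (by omega)
        rw [hrφ] at hT
        have hra := S'.rv_lt _ ha
        rw [← S'.dst_rv ha] at hT
        obtain ⟨k, hk, -⟩ := D.sync (C.src_lt _ hra) (hT.of_prefix (C.W_prefix _ hra))
        rw [hk] at hT
        have hu := D.unique hra hT
        have hk1 := D.succ k
        rw [← hu, hlenφ, ← hk] at hk1
        have hke : k + 1 = e - j := D.mono.injective (by omega)
        have hk2 : e - (j + 1) = k := by omega
        rw [hk2]
        exact ⟨by rw [← hk, ← add_assoc]; omega, fun _ => hu.symm⟩
    refine ⟨i', hii, hie', fun a b ha hb hab => ?_, fun t ht hti hs => ?_⟩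
    · obtain ⟨j, rfl⟩ := Nat.exists_eq_add_of_le ha
      have := (claim (j + 1) (by omega)).2 (by omega)
      rwa [show e - (j + 1) = b by omega, show i' + (j + 1) - 1 = i' + j by omega] at this
    · obtain ⟨-, h2⟩ := D.same hs
      rw [show i' + (e - i') = e by omega] at h2
      refine hu (pos t) (D.mono.monotone ht) (D.mono hti) ⟨?_, fun j hj => h2 j (by omega)⟩
      have := h2 0 (by omega)
      rw [add_zero, add_zero] at this
      rw [this]

/-- The bound on powers passes to the decoded word. -/
theorem powerBound (D : C.Decodes y y' pos) {w w' : ℕ → ℕ} {lam lam' : ℕ} {ε ε' : ℕ → ℕ → ℕ}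
    (h : S.PowerBound w lam ε y)
    (hw : ∀ a < S'.size, w' a = ((C.φ a).map w).sum)
    (hlam : ∀ s < C.states, lam' ≤ lam + ((C.W s).map w).sum)
    (hright : ∀ a < S'.size, ∀ b < S'.size, S'.src a = S'.src b → ε' a b ≤
      Alphabet.ext w ε ((C.φ a ++ C.W (S'.dst a)).drop C.len)
        ((C.φ b ++ C.W (S'.dst b)).drop C.len))
    (hleft : ∀ a < S'.size, ∀ b < S'.size, S'.dst a = S'.dst b →
      ε' a b ≤ Alphabet.ext w ε (C.φ a).reverse (C.φ b).reverse) :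
    S'.PowerBound w' lam' ε' y' := by
  intro i e q l r hr hl hr'
  obtain ⟨h1, h2, h3, h4⟩ := id hr
  have hsame : S'.Same y' i (i + q) (e - q - i) := ⟨h3, fun j hj => by
    rw [h4 (i + j) (by omega) (by omega), add_right_comm]⟩
  obtain ⟨h5, h6⟩ := D.same hsame
  rw [show i + q + (e - q - i) = e by omega] at h6
  rw [show i + q + (e - q - i) = e by omega, show i + (e - q - i) = e - q by omega] at h5
  have m1 := D.mono (show i < i + q by omega)
  have m2 := D.mono.monotone h2
  have m3 := D.mono.monotone (show i ≤ e - q by omega)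
  have hlp := C.len_pos
  have hper : pos e - pos (e - q) = pos (i + q) - pos i := by omega
  -- The coded run extends over one more marker, because the same marker follows both of the equal
  -- factors.
  have hrun : S.Run y (pos i) (pos e + C.len) (pos (i + q) - pos i) := by
    refine ⟨by omega, by omega, ?_, fun a ha hae => ?_⟩
    · have := h6 0 (by omega)
      rw [add_zero, add_zero] at this
      rw [this]; congr 2; omega
    · obtain ⟨j, rfl⟩ := Nat.exists_eq_add_of_le ha
      rw [h6 j (by omega)]; congr 1; omega
  have hrunsum : wsum w y (pos i) (pos e + C.len) =
      wsum w' y' i e + ((C.W (S'.src (y' e))).map w).sum := by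
    rw [← wsum_add w y (show pos i ≤ pos e by omega) (Nat.le_add_right _ _),
      D.wsum_eq hw (by omega), ← (D.mark e).wsum w, D.length_W]
  have hpersum : wsum w y (pos i) (pos i + (pos (i + q) - pos i)) = wsum w' y' (e - q) e := by
    rw [show pos i + (pos (i + q) - pos i) = pos (i + q) by omega, D.wsum_eq hw (by omega),
      hr.wsum_period]
  have hlam' := hlam _ (D.src_lt e)
  have hsrc : S'.src (y' e) = S'.src (y' (e - q)) := by
    have := D.path'.src_eq_of_lt hsame (j := e - q - i) le_rfl
    rw [show i + q + (e - q - i) = e by omega, show i + (e - q - i) = e - q by omega] at this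
    exact this.symm
  -- If the letters after the run differ, their code words may still agree beyond the marker; `ext`
  -- measures by how much. On the left it is a common suffix of the code words that counts.
  have right : ∃ u v, r ≤ Alphabet.ext w ε u v ∧ Occ y u (pos e + C.len) ∧
      Occ y v (pos e + C.len - (pos (i + q) - pos i)) := by
    rcases hr' with rfl | rfl
    · exact ⟨[], [], Nat.zero_le _, trivial, trivial⟩
    · have hd : ∀ k, C.len ≤ (C.φ (y' k) ++ C.W (S'.dst (y' k))).length := fun k => by
        rw [List.length_append, (D.path' k).2, D.length_W]; omega
      refine ⟨_, _, hright _ (D.path' e).1 _ (D.path' (e - q)).1 hsrc, (D.occ e).drop (hd e), ?_⟩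
      rw [show pos e + C.len - (pos (i + q) - pos i) = pos (e - q) + C.len by omega]
      exact (D.occ (e - q)).drop (hd _)
  have left : ∃ u v, l ≤ Alphabet.ext w ε u v ∧ OccLeft y u (pos i) ∧
      OccLeft y v (pos i + (pos (i + q) - pos i)) := by
    rcases hl with rfl | ⟨j, rfl, rfl⟩
    · exact ⟨[], [], Nat.zero_le _, trivial, trivial⟩
    · refine ⟨_, _, hleft _ (D.path' j).1 _ (D.path' (j + q)).1 ?_, ?_, ?_⟩
      · rw [(D.path' _).2, (D.path' _).2, h3, add_right_comm]
      · rw [D.succ]; exact (D.block j).occLeft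
      · rw [show pos (j + 1) + (pos (j + 1 + q) - pos (j + 1)) = pos (j + 1 + q) by omega,
          add_right_comm, D.succ]
        exact (D.block (j + q)).occLeft
  obtain ⟨u, v, huv, hu, hv⟩ := right
  obtain ⟨u', v', huv', hu', hv'⟩ := left
  have := h.ext_both u v u' v' hrun hu hv hu' hv'
  rw [hrunsum, hpersum] at this
  omega

end Decodes
end Coding
end TernaryRich

namespace TernaryRich

/-! ### The letters around a palindrome -/

theorem exists_last {p : ℕ → Prop} {lo hi : ℕ} (h : lo ≤ hi) (hp : p lo) :
    ∃ m, lo ≤ m ∧ m ≤ hi ∧ p m ∧ ∀ t, m < t → t ≤ hi → ¬ p t := by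
  induction hi, h using Nat.le_induction with
  | base => exact ⟨lo, le_rfl, le_rfl, hp, fun t h1 h2 => by omega⟩
  | succ hi hlo ih =>
    by_cases hh : p (hi + 1)
    · exact ⟨hi + 1, by omega, le_rfl, hh, fun t h1 h2 => by omega⟩
    · obtain ⟨m, h1, h2, h3, h4⟩ := ih
      refine ⟨m, h1, by omega, h3, fun t ht ht' => ?_⟩
      rcases Nat.eq_or_lt_of_le ht' with rfl | ht'
      · exact hh
      · exact h4 t ht (by omega)

/-- A walk on a triangle that always leaves a vertex along the edge along which it will come back
does not use all three edges infinitely often. -/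
theorem not_all_edges {W : ℕ → ℕ} {a b c : ℕ} (hab : a ≠ b) (hbc : b ≠ c) (hac : a ≠ c)
    (hW : ∀ k, W k = a ∨ W k = b ∨ W k = c)
    (hret : ∀ i j, i < j → W i = W j → (∀ t, i < t → t < j → W t ≠ W i) → W (i + 1) = W (j - 1))
    (h1 : ∀ N, ∃ k ≥ N, (W k = a ∧ W (k + 1) = b) ∨ (W k = b ∧ W (k + 1) = a))
    (h2 : ∀ N, ∃ k ≥ N, (W k = b ∧ W (k + 1) = c) ∨ (W k = c ∧ W (k + 1) = b))
    (h3 : ∀ N, ∃ k ≥ N, (W k = a ∧ W (k + 1) = c) ∨ (W k = c ∧ W (k + 1) = a)) : False := by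
  classical
  -- from `a` to `c` without using the edge between them
  obtain ⟨s, s', hss, hs, hs', hno⟩ : ∃ s s', s < s' ∧ W s = a ∧ W s' = c ∧
      ∀ t, s ≤ t → t < s' → ¬ ((W t = a ∧ W (t + 1) = c) ∨ (W t = c ∧ W (t + 1) = a)) := by
    -- `v` is the first step between `b` and `c` after some step between `a` and `b`, and `u` is the
    -- last step between `a` and `b` before `v`.
    obtain ⟨u₀, -, hu₀⟩ := h1 0
    have hv := Nat.find_spec (h2 (u₀ + 1))
    have hmin := fun t => Nat.find_min (h2 (u₀ + 1)) (m := t)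
    generalize Nat.find (h2 (u₀ + 1)) = v at hv hmin
    obtain ⟨u, hu1, hu2, hu3, hu4⟩ := exists_last (hi := v - 1)
      (p := fun k => (W k = a ∧ W (k + 1) = b) ∨ (W k = b ∧ W (k + 1) = a)) (by omega) hu₀
    have hno1 : ∀ t, u < t → t < v → ¬ ((W t = a ∧ W (t + 1) = b) ∨ (W t = b ∧ W (t + 1) = a)) :=
      fun t ht ht' => hu4 t ht (by omega)
    have hno2 : ∀ t, u < t → t < v → ¬ ((W t = b ∧ W (t + 1) = c) ∨ (W t = c ∧ W (t + 1) = b)) :=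
      fun t ht ht' h => hmin t ht' ⟨by omega, h⟩
    rcases hu3 with ⟨hua, hub⟩ | ⟨hub, hua⟩
    · have hb : ∀ t, u + 1 ≤ t → t ≤ v → W t = b := by
        intro t ht
        induction t, ht using Nat.le_induction with
        | base => exact fun _ => hub
        | succ t ht ih =>
          intro htv
          have := ih (by omega)
          rcases hW (t + 1) with h | h | h
          · exact absurd (.inr ⟨this, h⟩) (hno1 t (by omega) (by omega))
          · exact h
          · exact absurd (.inl ⟨this, h⟩) (hno2 t (by omega) (by omega))
      have hvb := hb v (by omega) le_rfl
      refine ⟨u, v + 1, by omega, hua, ?_, fun t ht htv => ?_⟩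
      · rcases hv.2 with h | h
        · exact h.2
        · exact absurd (hvb.symm.trans h.1) hbc
      · rcases Nat.eq_or_lt_of_le ht with rfl | ht
        · rw [hub, hua]; rintro (h | h)
          · exact hbc h.2
          · exact hac h.1
        · rw [hb t (by omega) (by omega)]; rintro (h | h)
          · exact hab h.1.symm
          · exact hbc h.1
    -- If `u` leads from `b` to `a`, the walk avoids `b` up to `v` and comes back to it from `c`,
    -- against the rule of return.
    · exfalso
      have hb : ∀ t, u + 1 ≤ t → t ≤ v → W t ≠ b := by
        intro t ht
        induction t, ht using Nat.le_induction with
        | base => rw [hua]; exact fun _ => hab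
        | succ t ht ih =>
          intro htv h
          rcases hW t with h' | h' | h'
          · exact hno1 t (by omega) (by omega) (.inl ⟨h', h⟩)
          · exact ih (by omega) h'
          · exact hno2 t (by omega) (by omega) (.inr ⟨h', h⟩)
      rcases hv.2 with h | h
      · exact hb v (by omega) le_rfl h.1
      · have := hret u (v + 1) (by omega) (by rw [hub, h.2])
          (fun t ht ht' => by rw [hub]; exact hb t (by omega) (by omega))
        rw [hua, Nat.add_sub_cancel, h.1] at this
        exact hac this
  -- `t` is the first step between `a` and `c` after `s`. The vertex that it enters was last left
  -- towards `b`, but is now entered from elsewhere.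
  have ht := Nat.find_spec (h3 s)
  have hmin := fun t => Nat.find_min (h3 s) (m := t)
  generalize Nat.find (h3 s) = t at ht hmin
  have hst : s' ≤ t := by
    by_contra hc
    exact hno t ht.1 (by omega) ht.2
  rcases ht.2 with ⟨hta, htc⟩ | ⟨htc, hta⟩
  · obtain ⟨i, hi1, hi2, hi3, hi4⟩ := exists_last (p := fun k => W k = c) hst hs'
    have hit : i ≠ t := fun h => hac (by rw [← hta, ← h]; exact hi3)
    have hb : W (i + 1) = b := by
      rcases hW (i + 1) with h | h | h
      · exact absurd ⟨by omega, .inr ⟨hi3, h⟩⟩ (hmin i (by omega))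
      · exact h
      · exact absurd h (hi4 _ (by omega) (by omega))
    have := hret i (t + 1) (by omega) (by rw [hi3, htc])
      (fun k hk hk' => by rw [hi3]; exact hi4 k hk (by omega))
    rw [hb, Nat.add_sub_cancel, hta] at this
    exact hab this.symm
  · obtain ⟨i, hi1, hi2, hi3, hi4⟩ := exists_last (p := fun k => W k = a) (hi := t) (by omega) hs
    have hit : i ≠ t := fun h => hac (by rw [← htc, ← h]; exact hi3.symm)
    have hb : W (i + 1) = b := by
      rcases hW (i + 1) with h | h | h
      · exact absurd h (hi4 _ (by omega) (by omega))
      · exact h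
      · exact absurd ⟨by omega, .inl ⟨hi3, h⟩⟩ (hmin i (by omega))
    have := hret i (t + 1) (by omega) (by rw [hi3, hta])
      (fun k hk hk' => by rw [hi3]; exact hi4 k hk (by omega))
    rw [hb, Nat.add_sub_cancel, htc] at this
    exact hbc this

namespace Alphabet
variable {S : Alphabet} {y : ℕ → ℕ}

/-- The palindrome `p` from the state `σ` occurs at `t`. -/
def PalAt (S : Alphabet) (y : ℕ → ℕ) (p : List ℕ) (σ t : ℕ) : Prop :=
  Occ y p t ∧ S.src (y t) = σ ∧ S.src (y (t + p.length)) = σ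

theorem Rich.return_of_palAt (hy : S.IsPath y) (hR : S.Rich y) {p : List ℕ} {σ s t : ℕ}
    (hrev : S.revWord p = p) (hst : s < t) (hs : S.PalAt y p σ s) (ht : S.PalAt y p σ t)
    (hno : ∀ k, s < k → k < t → ¬ S.PalAt y p σ k) :
    y (t - 1) = S.rv (y (s + p.length)) := by
  have h1 := ht.1
  rw [← hrev, occ_revWord_iff] at h1
  have h2 := (occ_iff ..).1 hs.1
  refine hR.return_pal hy (i := s) (i' := t) (m := p.length) (by omega) (fun j hj => ?_) ?_
    (fun k hk hk' h => ?_) _ _ (by omega) (by omega) (by omega)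
  · rw [h2 j hj, ← h1 j hj]; congr 1; omega
  · rw [hs.2.1, ht.2.2]
  · refine hno k hk hk' ⟨?_, by rw [h.1, hs.2.1], ?_⟩
    · rw [occ_iff]; intro j hj; rw [h.2 j hj, h2 j hj]
    · rw [hy.src_eq_of_lt h le_rfl, hs.2.2]

/-- If only three letters follow a palindrome, then two of them eventually do not meet around it. -/
theorem Rich.triangle (hy : S.IsPath y) (hR : S.Rich y) {p : List ℕ} {σ a b c : ℕ}
    (hrev : S.revWord p = p) (ha : a < S.size) (hb : b < S.size) (hc : c < S.size)
    (hσ : ∀ x < S.size, S.src x = σ ↔ x = a ∨ x = b ∨ x = c)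
    (hab : a ≠ b) (hbc : b ≠ c) (hac : a ≠ c) :
    EvAvoids y (S.rv a :: p ++ [b]) ∨ EvAvoids y (S.rv b :: p ++ [c]) ∨
      EvAvoids y (S.rv a :: p ++ [c]) := by
  by_contra hcon
  push Not at hcon
  have hlt := fun i => (hy i).1
  have palAt : ∀ x x' t, x < S.size → S.src x = σ → S.src x' = σ →
      Occ y (S.rv x :: p ++ [x']) t → S.PalAt y p σ (t + 1) ∧ y (t + 1 + p.length) = x' := by
    intro x x' t hx hxσ hxσ' ho
    rw [occ_append] at ho
    have h1 : y (t + 1 + p.length) = x' := by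
      have := ho.2.1
      rw [List.length_cons, ← add_assoc, add_right_comm] at this
      exact this
    refine ⟨⟨ho.1.2, ?_, ?_⟩, h1⟩
    · rw [← (hy t).2, ho.1.1, S.dst_rv hx, hxσ]
    · rw [h1, hxσ']
  have sa := (hσ a ha).2 (.inl rfl)
  have sb := (hσ b hb).2 (.inr (.inl rfl))
  have sc := (hσ c hc).2 (.inr (.inr rfl))
  have hinf : (Set.ofPred (S.PalAt y p σ)).Infinite := by
    rw [Set.infinite_iff_exists_gt]
    intro N
    obtain ⟨t, ht, ho⟩ := (Filter.frequently_atTop.1 (Filter.not_eventually.1 hcon.1)) N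
    exact ⟨t + 1, (palAt a b t ha sa sb (not_not.1 ho)).1, by omega⟩
  set pos := Nat.nth (S.PalAt y p σ) with hpos
  have hmono : StrictMono pos := Nat.nth_strictMono hinf
  have hat : ∀ k, S.PalAt y p σ (pos k) := Nat.nth_mem_of_infinite hinf
  have hex : ∀ t, S.PalAt y p σ t → ∃ k, pos k = t := fun t ht => by
    have : t ∈ Set.range pos := by rw [hpos, Nat.range_nth_of_infinite hinf]; exact ht
    exact this
  -- The letter before one occurrence of the palindrome is the reversal of the letter after the
  -- preceding occurrence, so the letters around an occurrence are an edge of the walk.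
  have hret : ∀ k, y (pos (k + 1) - 1) = S.rv (y (pos k + p.length)) := fun k =>
    hR.return_of_palAt hy hrev (hmono (by omega)) (hat k) (hat (k + 1)) (fun t h1 h2 h => by
      obtain ⟨j, rfl⟩ := hex t h
      rw [hmono.lt_iff_lt] at h1 h2
      omega)
  have edge : ∀ x x', x < S.size → S.src x = σ → S.src x' = σ →
      ¬ EvAvoids y (S.rv x :: p ++ [x']) →
      ∀ N, ∃ k ≥ N, (y (pos k + p.length) = x ∧ y (pos (k + 1) + p.length) = x') ∨
        (y (pos k + p.length) = x' ∧ y (pos (k + 1) + p.length) = x) := by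
    intro x x' hx hxσ hxσ' h N
    obtain ⟨t, ht, ho⟩ := (Filter.frequently_atTop.1 (Filter.not_eventually.1 h)) (pos N)
    obtain ⟨h1, h2⟩ := palAt x x' t hx hxσ hxσ' (not_not.1 ho)
    obtain ⟨k, hk⟩ := hex _ h1
    have hNk : N < k := hmono.lt_iff_lt.1 (by omega)
    obtain ⟨k, rfl⟩ : ∃ m, k = m + 1 := ⟨k - 1, by omega⟩
    refine ⟨k, by omega, .inl ⟨?_, by rw [hk, h2]⟩⟩
    have h3 := hret k
    rw [hk, Nat.add_sub_cancel, (not_not.1 ho).1] at h3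
    have := congrArg S.rv h3
    rw [S.rv_rv _ hx, S.rv_rv _ (hlt _)] at this
    exact this.symm
  refine not_all_edges (W := fun k => y (pos k + p.length)) hab hbc hac
    (fun k => (hσ _ (hlt _)).1 (hat k).2.2) ?_ (edge a b ha sa sb hcon.1)
    (edge b c hb sb sc hcon.2.1) (edge a c ha sa sc hcon.2.2)
  intro i j hij hxy hno
  beta_reduce at hxy hno ⊢
  rcases Nat.eq_or_lt_of_le (show i + 1 ≤ j by omega) with rfl | hlt'
  · exact hxy.symm
  have hs := hat (i + 1)
  have ht := hat j
  have hpi : pos 0 ≤ pos i := hmono.monotone (Nat.zero_le i)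
  have hpi' : pos i < pos (i + 1) := hmono (by omega)
  have hpj : pos (i + 1) < pos j := hmono hlt'
  have h1 := ht.1
  rw [← hrev, occ_revWord_iff] at h1
  have h2 := (occ_iff ..).1 hs.1
  -- With `x` the letter after occurrence `i`, the word `rv x :: p` ends at the end of occurrence `i
  -- + 1`, and its reversal begins at occurrence `j`. The former does not recur in between, as the
  -- walk does not visit `x` there. The palindrome between them equates the steps out of and back to
  -- `x`.
  have hpal := hR.return_pal hy (i := pos (i + 1) - 1) (i' := pos j) (m := p.length + 1)
    (by omega) ?_ ?_ ?_
  · have e1 := hpal (pos (i + 1) + p.length) (pos j - 1) (by omega) (by omega) (by omega)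
    have e2 := hret (j - 1)
    rw [show j - 1 + 1 = j by omega, e1] at e2
    have := congrArg S.rv e2
    rwa [S.rv_rv _ (hlt _), S.rv_rv _ (hlt _)] at this
  · intro k hk
    rcases k with _ | k
    · rw [add_zero, hret i, S.rv_rv _ (hlt _), hxy]; congr 1
    · rw [show pos (i + 1) - 1 + (k + 1) = pos (i + 1) + k by omega, h2 k (by omega),
        ← h1 k (by omega)]
      congr 1; omega
  · have e1 := (hy (pos j + p.length)).2
    rw [← add_assoc, ← e1, ← hxy, ← S.src_rv _ (hlt _), ← hret i]
  · intro t ht1 ht2 hsame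
    have e0 := hsame.2 0 (by omega)
    rw [add_zero, add_zero, hret i] at e0
    have hP : S.PalAt y p σ (t + 1) := by
      have hm := hsame.mono hy (a := 1) (m := p.length) (by omega)
      rw [show pos (i + 1) - 1 + 1 = pos (i + 1) by omega] at hm
      refine ⟨?_, by rw [hm.1, hs.2.1], by rw [hy.src_eq_of_lt hm le_rfl, hs.2.2]⟩
      rw [occ_iff]; intro k hk; rw [hm.2 k hk, h2 k hk]
    obtain ⟨k, hk⟩ := hex _ hP
    have k1 : i + 1 < k := hmono.lt_iff_lt.1 (by omega)
    have k2 : k ≤ j := hmono.le_iff_le.1 (by omega)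
    obtain ⟨k, rfl⟩ : ∃ m, k = m + 1 := ⟨k - 1, by omega⟩
    have e1 := hret k
    rw [hk, Nat.add_sub_cancel, e0] at e1
    have := congrArg S.rv e1
    rw [S.rv_rv _ (hlt _), S.rv_rv _ (hlt _)] at this
    exact hno k (by omega) (by omega) this.symm

end Alphabet
end TernaryRich

namespace TernaryRich

/-! ### Symmetries of an alphabet -/

structure Alphabet.Symm (S : Alphabet) where
  σ : ℕ → ℕ
  lt : ∀ a < S.size, σ a < S.size
  inj : ∀ a < S.size, ∀ b < S.size, σ a = σ b → a = b
  rv : ∀ a < S.size, σ (S.rv a) = S.rv (σ a)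
  src : ∀ a < S.size, ∀ b < S.size, S.src (σ a) = S.src (σ b) ↔ S.src a = S.src b

namespace Alphabet.Symm
variable {S : Alphabet} (T : S.Symm) {y : ℕ → ℕ}

theorem isPath (h : S.IsPath y) : S.IsPath fun i => T.σ (y i) := fun i => by
  refine ⟨T.lt _ (h i).1, ?_⟩
  rw [← S.src_rv _ (T.lt _ (h i).1), ← T.rv _ (h i).1, T.src _ (S.rv_lt _ (h i).1) _ (h _).1,
    S.src_rv _ (h i).1, (h i).2]

theorem pal (h : S.IsPath y) {p e : ℕ} (hp : S.Pal y p e) : S.Pal (fun i => T.σ (y i)) p e :=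
  fun a b ha hb hab => by
    change T.σ (y b) = S.rv (T.σ (y a))
    rw [hp a b ha hb hab, T.rv _ (h a).1]

theorem same (h : S.IsPath y) {s t n : ℕ} (hs : S.Same (fun i => T.σ (y i)) s t n) :
    S.Same y s t n :=
  ⟨(T.src _ (h s).1 _ (h t).1).1 hs.1, fun j hj => T.inj _ (h _).1 _ (h _).1 (hs.2 j hj)⟩

theorem rich (h : S.IsPath y) (hR : S.Rich y) : S.Rich fun i => T.σ (y i) := fun i e hie => by
  obtain ⟨p, h1, h2, h3, h4⟩ := hR i e hie
  exact ⟨p, h1, h2, T.pal h h3, fun t ht htp hs => h4 t ht htp (T.same h hs)⟩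

theorem run (h : S.IsPath y) {i e q : ℕ} (hr : S.Run (fun i => T.σ (y i)) i e q) :
    S.Run y i e q :=
  ⟨hr.1, hr.2.1, (T.src _ (h _).1 _ (h _).1).1 hr.2.2.1, fun a ha hae =>
    T.inj _ (h _).1 _ (h _).1 (hr.2.2.2 a ha hae)⟩

theorem occ (h : S.IsPath y) {u : List ℕ} {i : ℕ} (hu : ∀ a ∈ u, a < S.size) :
    Occ (fun i => T.σ (y i)) (u.map T.σ) i ↔ Occ y u i := by
  simp only [occ_iff, List.length_map, List.getElem_map]
  exact ⟨fun ho j hj => T.inj _ (h _).1 _ (hu _ (List.getElem_mem hj)) (ho j hj),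
    fun ho j hj => by rw [ho j hj]⟩

theorem evAvoids (h : S.IsPath y) {u : List ℕ} (hu : ∀ a ∈ u, a < S.size) (he : EvAvoids y u) :
    EvAvoids (fun i => T.σ (y i)) (u.map T.σ) :=
  he.mono fun i hi => by rwa [T.occ h hu]

theorem wsum {w : ℕ → ℕ} (h : S.IsPath y) (hw : ∀ a < S.size, w (T.σ a) = w a) (i e : ℕ) :
    wsum w (fun i => T.σ (y i)) i e = wsum w y i e :=
  Finset.sum_congr rfl fun a _ => hw _ (h a).1

theorem good {M : Model} (T : M.S.Symm) (hw : ∀ a < M.S.size, M.wt (T.σ a) = M.wt a)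
    (hm : ∀ a < M.S.size, ∀ b < M.S.size, M.mask.testBit (2 ^ T.σ a ^^^ 2 ^ T.σ b) =
      M.mask.testBit (2 ^ a ^^^ 2 ^ b)) (h : M.Good y) : M.Good fun i => T.σ (y i) where
  path := T.isPath h.path
  rich := T.rich h.path h.rich
  power := by
    intro i e q l r hr hl hr'
    have hp := fun i => (h.path i).1
    rw [T.wsum h.path hw, T.wsum h.path hw]
    simp only [hm _ (hp _) _ (hp _)] at hl hr'
    exact h.power i e q l r (T.run h.path hr) hl hr'

end Alphabet.Symm

/-! ### Successive exclusion of words -/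

namespace Model

def withRev (M : Model) (F : List (List ℕ)) : List (List ℕ) := F ++ F.map M.S.revWord

/-- One after the other, the words of a list die out in the search. -/
noncomputable def chain (M : Model) : List (List ℕ) → List (ℕ × List ℕ) → Bool
  | _, [] => true
  | F, (m, u) :: L => M.excludes (M.withRev F) [] 0 m u &&
      (M.excludes (M.withRev F) [] 1 m u && M.chain (u :: F) L)

variable {M : Model} {y : ℕ → ℕ}

theorem not_evAvoids_nil (y : ℕ → ℕ) : ¬ EvAvoids y [] := fun h => by
  obtain ⟨N, hN⟩ := Filter.eventually_atTop.1 h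
  exact hN N le_rfl trivial

theorem Good.withRev (hy : M.Good y) {F : List (List ℕ)} (hF : ∀ v ∈ F, EvAvoids y v)
    (hF' : ∀ v ∈ F, ∀ a ∈ v, a < M.S.size) :
    (∀ v ∈ M.withRev F, EvAvoids y v) ∧ ∀ v ∈ M.withRev F, ∀ a ∈ v, a < M.S.size := by
  constructor
  · intro v hv
    rcases List.mem_append.1 hv with hv | hv
    · exact hF v hv
    · obtain ⟨u, hu, rfl⟩ := List.mem_map.1 hv
      refine Alphabet.EvAvoids.rev hy.path hy.rich ?_ (hF' u hu) (hF u hu)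
      rintro rfl
      exact not_evAvoids_nil y (hF _ hu)
  · intro v hv a ha
    rcases List.mem_append.1 hv with hv | hv
    · exact hF' v hv a ha
    · obtain ⟨u, hu, rfl⟩ := List.mem_map.1 hv
      simp only [Alphabet.revWord, List.mem_reverse, List.mem_map] at ha
      obtain ⟨b, hb, rfl⟩ := ha
      exact M.S.rv_lt _ (hF' u hu b hb)

theorem Good.chain (hy : M.Good y) {F : List (List ℕ)} {L : List (ℕ × List ℕ)}
    (hF : ∀ v ∈ F, EvAvoids y v) (hF' : ∀ v ∈ F, ∀ a ∈ v, a < M.S.size)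
    (hL : ∀ p ∈ L, ∀ a ∈ p.2, a < M.S.size) (h : M.chain F L = true) :
    ∀ p ∈ L, EvAvoids y p.2 := by
  induction L generalizing F with
  | nil => simp
  | cons p L ih =>
    obtain ⟨m, u⟩ := p
    simp only [Model.chain, Bool.and_eq_true] at h
    obtain ⟨h1, h2⟩ := hy.withRev hF hF'
    have hu : EvAvoids y u :=
      hy.evAvoids h1 (fun v hv a ha => (h2 v hv a ha).trans_le M.size) h.1 h.2.1
    intro p hp
    rcases List.mem_cons.1 hp with rfl | hp
    · exact hu
    · refine ih (F := u :: F) (fun v hv => ?_) (fun v hv => ?_)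
        (fun p hp => hL p (List.mem_cons_of_mem _ hp)) h.2.2 p hp
      · rcases List.mem_cons.1 hv with rfl | hv
        · exact hu
        · exact hF v hv
      · rcases List.mem_cons.1 hv with rfl | hv
        · exact hL _ List.mem_cons_self
        · exact hF' v hv

theorem Good.false_of_chain (hy : M.Good y) {F : List (List ℕ)} {L : List (ℕ × List ℕ)}
    (hF : ∀ v ∈ F, EvAvoids y v) (hF' : ∀ v ∈ F, ∀ a ∈ v, a < M.S.size)
    (hL : ∀ p ∈ L, ∀ a ∈ p.2, a < M.S.size) (h : M.chain F L = true) (h0 : ∃ m, (m, []) ∈ L) :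
    False := by
  obtain ⟨m, hm⟩ := h0
  exact not_evAvoids_nil y (hy.chain hF hF' hL h _ hm)

/-- A word that avoids `F`, in which one of the markers occurs and is always followed by a code
word, can be decoded from some point on. -/
theorem Good.exists_decodes {S' : Alphabet} (C : Coding M.S S') (hy : M.Good y)
    {F : List (List ℕ)} (hF : ∀ v ∈ F, EvAvoids y v) (hF' : ∀ v ∈ F, ∀ a ∈ v, a < M.S.size)
    (hne : ∃ s < C.states, ¬ EvAvoids y (C.W s))
    (hG : ∀ s < C.states, ∀ s₁ < 2, M.excludes (M.withRev F)
      (((List.range S'.size).filter fun a => S'.src a = s).map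
        fun a => C.φ a ++ C.W (S'.dst a)) s₁ 0 (C.W s) = true) :
    ∃ k y' pos, C.Decodes (fun t => y (k + t)) y' pos := by
  obtain ⟨h1, h2⟩ := hy.withRev hF hF'
  obtain ⟨N, hN⟩ := eventually_avoids h1
  obtain ⟨s, hs, hne⟩ := hne
  rw [EvAvoids, Filter.not_eventually, Filter.frequently_atTop] at hne
  obtain ⟨k, hk, ho⟩ := hne N
  rw [not_not] at ho
  refine ⟨k, C.exists_decodes (hy.shift k).path ⟨s, hs, by rw [occ_shift]; exact ho⟩ ?_⟩
  intro t s hs ho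
  by_contra hc
  refine (hy.shift k).not_occ (hN k hk) (fun v hv a ha => (h2 v hv a ha).trans_le M.size) ?_
    (hG s hs _ (M.states _ ((hy.shift k).path t).1)) ho
  simp only [List.mem_map, List.mem_filter, List.mem_range, decide_eq_true_eq]
  rintro v ⟨a, ⟨ha, has⟩, rfl⟩ hv
  exact hc ⟨a, ha, has, hv⟩

end Model
end TernaryRich

namespace TernaryRich

/-! ### Ternary words with a state

The letters `0`, `1`, `2` are read in the state `0`, the letters `3`, `4`, `5` are their copies in
the state `1`; the letters `2` and `5` change the state. -/

def stateAlphabet : Alphabet where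
  size := 6
  src a := [0, 0, 0, 1, 1, 1].getD a 0
  dst a := [0, 0, 1, 1, 1, 0].getD a 0
  rv a := [0, 1, 5, 3, 4, 2].getD a 0
  rv_lt := by decide
  rv_rv := by decide
  src_rv := by decide

def stateSwap : stateAlphabet.Symm where
  σ a := [3, 4, 5, 0, 1, 2].getD a 0
  lt := by decide
  inj := by decide
  rv := by decide
  src := by decide

/-- The morphism `f`, with states. -/
def codingF : Coding stateAlphabet stateAlphabet where
  states := 2
  φ a := [[0, 1], [0, 2, 5], [0, 2], [3, 4], [3, 5, 2], [3, 5]].getD a []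
  W s := [[0], [3]].getD s []
  len := 1
  len_pos := by decide
  src_lt := by decide
  length_W := by decide
  rev_W := by decide
  W_inj := by decide
  φ_ne := by decide
  W_prefix := by decide
  inner := by decide
  rev_φ := by decide
  φ_inj := by decide

def stateModel (wt : ℕ → ℕ) (viol : ℕ → ℕ → ℕ → Bool) : Model where
  S := stateAlphabet
  wt a := wt (a % 3)
  -- The pairs 1, 2 and 4, 5 share a source, the pairs 1, 5 and 2, 4 a target. Their code words
  -- under f agree in one more letter, after the marker or at the end respectively.
  mask := 2 ^ 6 + 2 ^ 48 + 2 ^ 34 + 2 ^ 20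
  viol := viol
  size := by decide
  states := by decide
  mis_zero := by decide

/-- What the search has to find out. -/
structure Model.Sieve (M : Model) (C : Coding M.S stateAlphabet) : Prop where
  -- In each list a word comes with the number of letters that the search reads before it. A final
  -- `[]` says that nothing survives at all.
  h01 : M.chain [[0, 1], [3, 4]] [(2, [2, 5, 2]), (1, [2, 5]), (1, [5, 2]), (0, [])] = true
  h02' : M.chain [[0, 2], [3, 4]] [(1, [1, 0]), (1, [2, 5]), (0, [])] = true
  h02 : M.chain [[0, 2], [3, 5]] [(3, [0]), (1, [2]), (0, [])] = true
  h12' : M.chain [[1, 2], [3, 4]] [(2, [1, 0]), (1, [2, 5]), (0, [])] = true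
  h12'' : M.chain [[1, 2], [3, 5]] [(2, [1, 0]), (1, [2, 5]), (0, [])] = true
  h12 : M.chain [[1, 2], [4, 5]] [(1, [2, 5, 2])] = true
  mark : M.chain [[2, 5, 2], [1, 2], [4, 5], [0], [3]] [(0, [])] = true
  parse : ∀ s < C.states, ∀ s₁ < 2, M.excludes (M.withRev [[2, 5, 2], [1, 2], [4, 5]])
      (((List.range stateAlphabet.size).filter fun a => stateAlphabet.src a = s).map
        fun a => C.φ a ++ C.W (stateAlphabet.dst a)) s₁ 0 (C.W s) = true

/-- The words that pass the sieve are, from some point on, images under `f`. -/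
theorem Model.Sieve.exists_decodes {wt : ℕ → ℕ} {viol : ℕ → ℕ → ℕ → Bool}
    (hM : (stateModel wt viol).Sieve codingF) {y : ℕ → ℕ} (hy : (stateModel wt viol).Good y) :
    ∃ k y' pos, codingF.Decodes (fun t => y (k + t)) y' pos := by
  have hp : stateAlphabet.IsPath y := hy.path
  have hs : ∀ {y}, (stateModel wt viol).Good y →
      (stateModel wt viol).Good fun i => stateSwap.σ (y i) := fun h =>
    Alphabet.Symm.good (M := stateModel wt viol) stateSwap
      (fun a (ha : a < 6) => by
        change wt _ = wt _
        have : stateSwap.σ a % 3 = a % 3 := by revert a; decide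
        rw [this])
      (show ∀ a < 6, ∀ b < 6, Nat.testBit (2 ^ 6 + 2 ^ 48 + 2 ^ 34 + 2 ^ 20)
        (2 ^ stateSwap.σ a ^^^ 2 ^ stateSwap.σ b) =
        Nat.testBit (2 ^ 6 + 2 ^ 48 + 2 ^ 34 + 2 ^ 20) (2 ^ a ^^^ 2 ^ b) by decide +kernel) h
  have hsw : ∀ {u}, (∀ a ∈ u, a < 6) → EvAvoids y u →
      EvAvoids (fun i => stateSwap.σ (y i)) (u.map stateSwap.σ) := fun hu h =>
    stateSwap.evAvoids hp hu h
  have dead : ∀ {y}, (stateModel wt viol).Good y → ∀ u v L,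
      EvAvoids y u → EvAvoids y v → (∀ a ∈ u, a < 6) → (∀ a ∈ v, a < 6) →
      (∀ p ∈ L, ∀ a ∈ p.2, a < 6) → (stateModel wt viol).chain [u, v] L = true →
      (∃ m, (m, []) ∈ L) → False := fun {y} h u v L hu hv hu' hv' hL hc hm =>
    h.false_of_chain (F := [u, v]) (by simp [hu, hv]) (by
      intro w hw
      simp only [List.mem_cons, List.not_mem_nil, or_false] at hw
      rcases hw with rfl | rfl
      · exact hu'
      · exact hv') hL hc hm
  have h0 := hy.rich.triangle hp (p := []) (σ := 0) (a := 0) (b := 1) (c := 2) rfl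
    (by decide) (by decide) (by decide) (by decide) (by decide) (by decide) (by decide)
  have h1 := hy.rich.triangle hp (p := []) (σ := 1) (a := 3) (b := 4) (c := 5) rfl
    (by decide) (by decide) (by decide) (by decide) (by decide) (by decide) (by decide)
  have main : EvAvoids y [1, 2] ∧ EvAvoids y [4, 5] := by
    -- Up to the exchange of the two states, every combination but `[1, 2]` with `[4, 5]` is refuted
    -- by one of the five searches.
    rcases h0 with h0 | h0 | h0 <;> rcases h1 with h1 | h1 | h1
    · exact (dead hy [0, 1] [3, 4] _ h0 h1 (by decide) (by decide) (by decide) hM.h01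
        ⟨0, by decide⟩).elim
    · exact (dead (hs hy) [1, 2] [3, 4] _ (hsw (by decide) h1) (hsw (by decide) h0) (by decide)
        (by decide) (by decide) hM.h12' ⟨0, by decide⟩).elim
    · exact (dead (hs hy) [0, 2] [3, 4] _ (hsw (by decide) h1) (hsw (by decide) h0) (by decide)
        (by decide) (by decide) hM.h02' ⟨0, by decide⟩).elim
    · exact (dead hy [1, 2] [3, 4] _ h0 h1 (by decide) (by decide) (by decide) hM.h12'
        ⟨0, by decide⟩).elim
    · exact ⟨h0, h1⟩
    · exact (dead hy [1, 2] [3, 5] _ h0 h1 (by decide) (by decide) (by decide) hM.h12''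
        ⟨0, by decide⟩).elim
    · exact (dead hy [0, 2] [3, 4] _ h0 h1 (by decide) (by decide) (by decide) hM.h02'
        ⟨0, by decide⟩).elim
    · exact (dead (hs hy) [1, 2] [3, 5] _ (hsw (by decide) h1) (hsw (by decide) h0) (by decide)
        (by decide) (by decide) hM.h12'' ⟨0, by decide⟩).elim
    · exact (dead hy [0, 2] [3, 5] _ h0 h1 (by decide) (by decide) (by decide) hM.h02
        ⟨0, by decide⟩).elim
  have h252 : EvAvoids y [2, 5, 2] :=
    hy.chain (F := [[1, 2], [4, 5]]) (by simp [main])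
      (show ∀ v ∈ [[1, 2], [4, 5]], ∀ a ∈ v, a < 6 by decide)
      (show ∀ p ∈ [(1, [2, 5, 2])], ∀ a ∈ p.2, a < 6 by decide) hM.h12
      (1, [2, 5, 2]) (by simp)
  refine hy.exists_decodes codingF (F := [[2, 5, 2], [1, 2], [4, 5]]) (by simp [main, h252])
    (show ∀ v ∈ [[2, 5, 2], [1, 2], [4, 5]], ∀ a ∈ v, a < 6 by decide) ?_ hM.parse
  by_contra hc
  push Not at hc
  refine hy.false_of_chain (F := [[2, 5, 2], [1, 2], [4, 5], [0], [3]]) ?_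
    (show ∀ v ∈ [[2, 5, 2], [1, 2], [4, 5], [0], [3]], ∀ a ∈ v, a < 6 by decide) (by simp) hM.mark ⟨0, by decide⟩
  have a0 : EvAvoids y [0] := hc 0 Nat.zero_lt_two
  have a1 : EvAvoids y [3] := hc 1 Nat.one_lt_two
  simp [main, h252, a0, a1]

end TernaryRich

namespace TernaryRich

/-! ### Weights -/

/-- The mismatches given by `mask` have weight `c`. -/
def maskEps (mask c a b : ℕ) : ℕ := if mask.testBit (2 ^ a ^^^ 2 ^ b) = true then c else 0

noncomputable def linViol (lam c r p t : ℕ) : Bool :=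
  Nat.ble (Nat.mul (nat_lit 16) p) (Nat.mul (nat_lit 7) (Nat.add (Nat.add r lam) (Nat.mul c t)))

theorem linViol_eq_true {lam c r p t : ℕ} :
    linViol lam c r p t = true ↔ 16 * p ≤ 7 * (r + lam + c * t) :=
  iff_of_eq Nat.ble_eq

theorem linViol_eq_false {lam c r p t : ℕ} (h : 7 * (r + lam + c * t) < 16 * p) :
    linViol lam c r p t = false := by
  rw [← Bool.not_eq_true, linViol_eq_true]; omega

theorem Alphabet.PowerBound.flags {S : Alphabet} {w : ℕ → ℕ} {lam mask c : ℕ} {y : ℕ → ℕ}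
    (h : S.PowerBound w lam (maskEps mask c) y) {i e q l r : ℕ} (hr : S.Run y i e q)
    (hl : l = 0 ∨ l = 1 ∧ ∃ i', i = i' + 1 ∧ mask.testBit (2 ^ y i' ^^^ 2 ^ y (i' + q)) = true)
    (hr' : r = 0 ∨ r = 1 ∧ mask.testBit (2 ^ y e ^^^ 2 ^ y (e - q)) = true) :
    7 * (wsum w y i e + lam + c * (l + r)) < 16 * wsum w y (e - q) e := by
  have := h i e q (c * l) (c * r) hr ?_ ?_
  · rwa [add_assoc, ← mul_add] at this
  · rcases hl with rfl | ⟨rfl, i', rfl, h'⟩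
    · exact .inl rfl
    · exact .inr ⟨i', rfl, by simp [maskEps, h']⟩
  · rcases hr' with rfl | ⟨rfl, h'⟩
    · exact .inl rfl
    · exact .inr (by simp [maskEps, h'])

theorem Model.good_of_powerBound {M : Model} {lam c : ℕ} (hv : M.viol = linViol lam c) {y : ℕ → ℕ}
    (hp : M.S.IsPath y) (hR : M.S.Rich y) (h : M.S.PowerBound M.wt lam (maskEps M.mask c) y) :
    M.Good y where
  path := hp
  rich := hR
  power := by
    intro i e q l r hr hl hr'
    rw [hv]
    exact linViol_eq_false (h.flags hr hl hr')

def stateMask : ℕ := 2 ^ 6 + 2 ^ 48 + 2 ^ 34 + 2 ^ 20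

def stateWt (a b c : ℕ) (x : ℕ) : ℕ := [a, b, c].getD (x % 3) 0

/-- The weights of the code words of `f`. -/
theorem powerBound_codingF {y y' pos : ℕ → ℕ} (D : codingF.Decodes y y' pos)
    {a b c lam e lam' e' : ℕ}
    (h : stateAlphabet.PowerBound (stateWt a b c) lam (maskEps stateMask e) y)
    (hl : lam' ≤ lam + a) (he : e' ≤ c) :
    stateAlphabet.PowerBound (stateWt (a + b) (a + 2 * c) (a + c)) lam' (maskEps stateMask e') y' := by
  refine D.powerBound h ?_ ?_ ?_ ?_
  · intro x hx
    change x < 6 at hx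
    interval_cases x <;> simp [stateWt, codingF] <;> ring
  · intro s hs
    change s < 2 at hs
    interval_cases s <;> simpa [stateWt, codingF] using hl
  · intro x hx x' hx' hs
    change x < 6 at hx
    change x' < 6 at hx'
    interval_cases x <;> interval_cases x' <;>
      simp [stateAlphabet, stateWt, codingF, Alphabet.ext, maskEps, stateMask,
        Nat.testBit_eq_decide_div_mod_eq] at hs ⊢ <;>
      omega
  · intro x hx x' hx' hs
    change x < 6 at hx
    change x' < 6 at hx'
    interval_cases x <;> interval_cases x' <;>
      simp [stateAlphabet, stateWt, codingF, Alphabet.ext, maskEps, stateMask,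
        Nat.testBit_eq_decide_div_mod_eq] at hs ⊢ <;>
      omega

/-! ### A cone of weights -/

noncomputable def packed (s r : ℕ) : ℕ := Nat.mod (Nat.shiftRight r s) (nat_lit 16384)

/-- Too long a run for each of three weights, the values of which are packed into one number. -/
noncomputable def coneViol (r p t : ℕ) : Bool :=
  @Bool.rec (fun _ => Bool)
    (@Bool.rec (fun _ => Bool) false
      (@Bool.rec (fun _ => Bool) false
        (linViol (nat_lit 78) (nat_lit 35) (packed (nat_lit 28) r) (packed (nat_lit 28) p) t)
        (linViol (nat_lit 35) (nat_lit 16) (packed (nat_lit 14) r) (packed (nat_lit 14) p) t))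
      (linViol (nat_lit 16) (nat_lit 8) (packed (nat_lit 0) r) (packed (nat_lit 0) p) t))
    -- Below `2 ^ 42` the third weight, the largest, is below `2 ^ 14`, so the packed values do not
    -- run into each other.
    false (Nat.ble (nat_lit 4398046511104) r)

theorem coneViol_eq_true {r p t : ℕ} (h : coneViol r p t = true) : r < 4398046511104 ∧
    16 * (p % 16384) ≤ 7 * (r % 16384 + 16 + 8 * t) ∧
    16 * (p / 16384 % 16384) ≤ 7 * (r / 16384 % 16384 + 35 + 16 * t) ∧
    16 * (p / 268435456 % 16384) ≤ 7 * (r / 268435456 % 16384 + 78 + 35 * t) := by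
  simp only [coneViol, boolRec_ble] at h
  split_ifs at h with h0
  simp only [boolRec] at h
  split_ifs at h with h1 h2
  rw [linViol_eq_true] at h h1 h2
  refine ⟨Nat.lt_of_not_le h0, ?_, ?_, ?_⟩
  · exact h1
  · change 16 * ((p >>> 14) % 16384) ≤ 7 * ((r >>> 14) % 16384 + 35 + 16 * t) at h2
    rwa [Nat.shiftRight_eq_div_pow, Nat.shiftRight_eq_div_pow] at h2
  · change 16 * ((p >>> 28) % 16384) ≤ 7 * ((r >>> 28) % 16384 + 78 + 35 * t) at h
    rwa [Nat.shiftRight_eq_div_pow, Nat.shiftRight_eq_div_pow] at h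

/-- The weights (19, 24, 16), (43, 51, 35), (94, 113, 78) are the first three images of (8, 11, 8)
under the weight map of f. -/
def packedWt : ℕ → ℕ :=
  stateWt (19 + 16384 * 43 + 268435456 * 94) (24 + 16384 * 51 + 268435456 * 113)
    (16 + 16384 * 35 + 268435456 * 78)

/-- The bound on powers holds for weights in the cone that is spanned by three of them. -/
def ConeBound (y : ℕ → ℕ) : Prop :=
  ∃ t₀ t₁ t₂, stateAlphabet.PowerBound
    (stateWt (19 * t₀ + 43 * t₁ + 94 * t₂) (24 * t₀ + 51 * t₁ + 113 * t₂)
      (16 * t₀ + 35 * t₁ + 78 * t₂)) (16 * t₀ + 35 * t₁ + 78 * t₂)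
    (maskEps stateMask (8 * t₀ + 16 * t₁ + 35 * t₂)) y

theorem wsum_linear {w w₀ w₁ w₂ : ℕ → ℕ} {k₀ k₁ k₂ : ℕ}
    (h : ∀ x, w x = k₀ * w₀ x + k₁ * w₁ x + k₂ * w₂ x) (y : ℕ → ℕ) (i e : ℕ) :
    wsum w y i e = k₀ * wsum w₀ y i e + k₁ * wsum w₁ y i e + k₂ * wsum w₂ y i e := by
  simp only [wsum, h, Finset.sum_add_distrib, Finset.mul_sum]

theorem wsum_le {w w' : ℕ → ℕ} (h : ∀ x, w x ≤ w' x) (y : ℕ → ℕ) (i e : ℕ) :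
    wsum w y i e ≤ wsum w' y i e := Finset.sum_le_sum fun _ _ => h _

theorem stateWt_cases {P : ℕ → Prop} (x : ℕ) (h0 : P 0) (h1 : P 1) (h2 : P 2) : P (x % 3) := by
  have := Nat.mod_lt x (show 0 < 3 by decide)
  generalize x % 3 = r at *
  interval_cases r <;> assumption

/-- A run too heavy for all three generators would be too heavy for each of their nonnegative
combinations. -/
theorem ConeBound.good {y : ℕ → ℕ} (hp : stateAlphabet.IsPath y) (hR : stateAlphabet.Rich y)
    (h : ConeBound y) : (stateModel packedWt coneViol).Good y where
  path := hp
  rich := hR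
  power := by
    intro i e q l r hr hl hr'
    have hw : (stateModel packedWt coneViol).wt = packedWt :=
      funext fun x => by simp [stateModel, packedWt, stateWt]
    rw [hw, ← Bool.not_eq_true]
    intro hv
    obtain ⟨t₀, t₁, t₂, h⟩ := h
    have h := h.flags hr hl hr'
    have hq := hr.2.1
    have hpack : ∀ i e, wsum packedWt y i e = 1 * wsum (stateWt 19 24 16) y i e +
        16384 * wsum (stateWt 43 51 35) y i e + 268435456 * wsum (stateWt 94 113 78) y i e :=
      wsum_linear (fun x => stateWt_cases
        (P := fun r => [_, _, _].getD r 0 = 1 * [19, 24, 16].getD r 0 +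
          16384 * [43, 51, 35].getD r 0 + 268435456 * [94, 113, 78].getD r 0) x rfl rfl rfl) y
    have hcone := wsum_linear (w := stateWt (19 * t₀ + 43 * t₁ + 94 * t₂)
      (24 * t₀ + 51 * t₁ + 113 * t₂) (16 * t₀ + 35 * t₁ + 78 * t₂)) (k₀ := t₀) (k₁ := t₁) (k₂ := t₂)
      (w₀ := stateWt 19 24 16) (w₁ := stateWt 43 51 35) (w₂ := stateWt 94 113 78)
      (fun x => stateWt_cases
        (P := fun r => [_, _, _].getD r 0 = t₀ * [19, 24, 16].getD r 0 +
          t₁ * [43, 51, 35].getD r 0 + t₂ * [94, 113, 78].getD r 0) x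
        (by simp; ring) (by simp; ring) (by simp; ring)) y
    have h01 : ∀ i e, wsum (stateWt 19 24 16) y i e ≤ wsum (stateWt 43 51 35) y i e :=
      wsum_le (fun x => stateWt_cases
        (P := fun r => [19, 24, 16].getD r 0 ≤ [43, 51, 35].getD r 0) x (by decide) (by decide)
        (by decide)) y
    have h12 : ∀ i e, wsum (stateWt 43 51 35) y i e ≤ wsum (stateWt 94 113 78) y i e :=
      wsum_le (fun x => stateWt_cases
        (P := fun r => [43, 51, 35].getD r 0 ≤ [94, 113, 78].getD r 0) x (by decide) (by decide)
        (by decide)) y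
    have hle : ∀ w, wsum w y (e - q) e ≤ wsum w y i e := fun w => by
      rw [← wsum_add w y (show i ≤ e - q by omega) (Nat.sub_le e q)]; omega
    have p0 := hle (stateWt 19 24 16)
    have p1 := hle (stateWt 43 51 35)
    have p2 := hle (stateWt 94 113 78)
    have r01 := h01 i e
    have r12 := h12 i e
    rw [hpack, hpack] at hv
    rw [hcone, hcone] at h
    generalize wsum (stateWt 19 24 16) y i e = R₀ at *
    generalize wsum (stateWt 43 51 35) y i e = R₁ at *
    generalize wsum (stateWt 94 113 78) y i e = R₂ at *
    generalize wsum (stateWt 19 24 16) y (e - q) e = P₀ at *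
    generalize wsum (stateWt 43 51 35) y (e - q) e = P₁ at *
    generalize wsum (stateWt 94 113 78) y (e - q) e = P₂ at *
    obtain ⟨v, v0, v1, v2⟩ := coneViol_eq_true hv
    have unpack : ∀ a b c, a < 16384 → b < 16384 → c < 16384 →
        (1 * a + 16384 * b + 268435456 * c) % 16384 = a ∧
        (1 * a + 16384 * b + 268435456 * c) / 16384 % 16384 = b ∧
        (1 * a + 16384 * b + 268435456 * c) / 268435456 % 16384 = c := by
      intro a b c ha hb hc
      have h1 : (1 * a + 16384 * b + 268435456 * c) / 16384 = b + 16384 * c := by omega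
      have h2 : (1 * a + 16384 * b + 268435456 * c) / 268435456 = c := by omega
      rw [h1, h2]
      omega
    obtain ⟨a0, a1, a2⟩ := unpack R₀ R₁ R₂ (by omega) (by omega) (by omega)
    obtain ⟨b0, b1, b2⟩ := unpack P₀ P₁ P₂ (by omega) (by omega) (by omega)
    rw [a0, b0] at v0
    rw [a1, b1] at v1
    rw [a2, b2] at v2
    have := Nat.mul_le_mul_left t₀ v0
    have := Nat.mul_le_mul_left t₁ v1
    have := Nat.mul_le_mul_left t₂ v2
    linarith

/-- By the characteristic equation the fourth weight is the first plus twice the third, so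
coordinates change by a companion matrix. The overlap weighs as much as the letter `2`, which is
preserved: the new values of both are the old weights of `0` and `2` added. The new mismatch weight
is the old weight of `2`. -/
theorem ConeBound.step {y y' pos : ℕ → ℕ} (D : codingF.Decodes y y' pos) (h : ConeBound y) :
    ConeBound y' := by
  obtain ⟨t₀, t₁, t₂, h⟩ := h
  refine ⟨t₂, t₀, t₁ + 2 * t₂, ?_⟩
  have := powerBound_codingF D (lam' := 16 * t₂ + 35 * t₀ + 78 * (t₁ + 2 * t₂))
    (e' := 8 * t₂ + 16 * t₀ + 35 * (t₁ + 2 * t₂)) h (by omega) (by omega)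
  have ha : 19 * t₀ + 43 * t₁ + 94 * t₂ + (24 * t₀ + 51 * t₁ + 113 * t₂) =
    19 * t₂ + 43 * t₀ + 94 * (t₁ + 2 * t₂) := by ring
  have hb : 19 * t₀ + 43 * t₁ + 94 * t₂ + 2 * (16 * t₀ + 35 * t₁ + 78 * t₂) =
    24 * t₂ + 51 * t₀ + 113 * (t₁ + 2 * t₂) := by ring
  have hc : 19 * t₀ + 43 * t₁ + 94 * t₂ + (16 * t₀ + 35 * t₁ + 78 * t₂) =
    16 * t₂ + 35 * t₀ + 78 * (t₁ + 2 * t₂) := by ring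
  rwa [ha, hb, hc] at this

theorem ConeBound.shift {y : ℕ → ℕ} (h : ConeBound y) (k : ℕ) : ConeBound fun t => y (k + t) := by
  obtain ⟨t₀, t₁, t₂, h⟩ := h
  exact ⟨t₀, t₁, t₂, h.shift k⟩

end TernaryRich

/-! ### Computations that force the morphism f. -/

namespace TernaryRich

-- Used once, for the word decoded from return words; its weights (8, 11, 8) are lengths in the
-- ternary word.
set_option maxHeartbeats 4000000 in
theorem sieve_linear : (stateModel (stateWt 8 11 8) (linViol 10 2)).Sieve codingF where
  h01 := by decide +kernel
  h02' := by decide +kernel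
  h02 := by decide +kernel
  h12' := by decide +kernel
  h12'' := by decide +kernel
  h12 := by decide +kernel
  mark := by decide +kernel
  parse := by decide +kernel

/-- Used at every later level. -/
theorem sieve_cone : (stateModel packedWt coneViol).Sieve codingF where
  h01 := by decide +kernel
  h02' := by decide +kernel
  h02 := by decide +kernel
  h12' := by decide +kernel
  h12'' := by decide +kernel
  h12 := by decide +kernel
  mark := by decide +kernel
  parse := by decide +kernel

end TernaryRich

namespace TernaryRich

/-! ### Ternary words and their return words to the letter `0` -/

def plainAlphabet : Alphabet where
  size := 3
  src _ := 0
  dst _ := 0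
  rv a := a
  rv_lt := by decide
  rv_rv := by decide
  src_rv := by decide

noncomputable def plainModel : Model where
  S := plainAlphabet
  wt _ := 1
  mask := 0
  viol := linViol 0 0
  size := by decide
  states := by decide
  mis_zero := by decide

/-- The letters stand for the words `0`, `01`, `011`, `02`, `022`. -/
def returnAlphabet : Alphabet where
  size := 5
  src _ := 0
  dst _ := 0
  rv a := a
  rv_lt := by decide
  rv_rv := by decide
  src_rv := by decide

noncomputable def returnModel : Model where
  S := returnAlphabet
  wt a := [1, 2, 3, 2, 3].getD a 0
  -- The pairs 01, 011 and 02, 022: such return words still share one letter after the initial 0,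
  -- and also their last letter.
  mask := 2 ^ 6 + 2 ^ 24
  viol := linViol 1 1
  size := by decide
  states := by decide
  mis_zero := by decide

def returnSwap : returnAlphabet.Symm where
  σ a := [0, 3, 4, 1, 2].getD a 0
  lt := by decide
  inj := by decide
  rv := by decide
  src := by decide

/-- Without 12, 21 and cubes of letters, at most two letters, and equal ones, stand between
successive zeros. -/
def codingReturn : Coding plainAlphabet returnAlphabet where
  states := 1
  φ a := [[0], [0, 1], [0, 1, 1], [0, 2], [0, 2, 2]].getD a []
  W _ := [0]
  len := 1
  len_pos := by decide
  src_lt := by decide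
  length_W := by decide
  rev_W := by decide
  W_inj := by decide
  φ_ne := by decide
  W_prefix := by decide
  inner := by decide
  rev_φ := by decide
  φ_inj := by decide

/-- The letters `0` and `2` have the same code word and differ in the marker to come, as do `3` and
`5`. -/
def codingState : Coding returnAlphabet stateAlphabet where
  states := 2
  φ a := [[0, 1, 2, 1], [0, 1, 2, 1, 0, 3], [0, 1, 2, 1],
    [0, 3, 4, 3], [0, 3, 4, 3, 0, 1], [0, 3, 4, 3]].getD a []
  W s := [[0, 1, 2, 1, 0], [0, 3, 4, 3, 0]].getD s []
  len := 5
  len_pos := by decide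
  src_lt := by decide
  length_W := by decide
  rev_W := by decide
  W_inj := by decide
  φ_ne := by decide
  W_prefix := by decide
  inner := by decide +kernel
  rev_φ := by decide
  φ_inj := by decide

theorem powerBound_codingReturn {y y' pos : ℕ → ℕ} (D : codingReturn.Decodes y y' pos)
    (h : plainAlphabet.PowerBound plainModel.wt 0 (maskEps plainModel.mask 0) y) :
    returnAlphabet.PowerBound returnModel.wt 1 (maskEps returnModel.mask 1) y' :=
  D.powerBound h (by decide) (by decide) (by decide +kernel) (by decide +kernel)

theorem powerBound_codingState {y y' pos : ℕ → ℕ} (D : codingState.Decodes y y' pos)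
    (h : returnAlphabet.PowerBound returnModel.wt 1 (maskEps returnModel.mask 1) y) :
    stateAlphabet.PowerBound (stateWt 8 11 8) 10 (maskEps stateMask 2) y' :=
  D.powerBound h (by decide) (by decide) (by decide +kernel) (by decide +kernel)

theorem plain_mark : plainModel.chain [[1, 2], [0]] [(0, [])] = true := by decide +kernel

theorem plain_parse : ∀ s < codingReturn.states, ∀ s₁ < 2,
    plainModel.excludes (plainModel.withRev [[1, 2]])
      (((List.range returnAlphabet.size).filter fun a => returnAlphabet.src a = s).map
        fun a => codingReturn.φ a ++ codingReturn.W (returnAlphabet.dst a)) s₁ 0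
      (codingReturn.W s) = true := by decide +kernel

/-- In the ternary word, this is the case in which 002 dies out; the exchange of 1 and 2 reduces 001
to it. -/
theorem return_dead : returnModel.chain [[0, 3], [0, 4]]
    [(3, [0, 2]), (1, [1, 0, 1]), (1, [0]), (0, [1]), (0, [])] = true := by decide +kernel

theorem return_chain : returnModel.chain [[1, 3], [1, 4], [2, 3], [2, 4]]
    [(2, [0, 2]), (2, [0, 4]), (4, [0, 1, 0, 3, 0])] = true := by decide +kernel

theorem return_mark : returnModel.chain [[0, 1, 0, 3, 0], [0, 4], [0, 2], [1, 3], [1, 4], [2, 3],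
    [2, 4], [0, 1, 2, 1, 0], [0, 3, 4, 3, 0]] [(0, [])] = true := by decide +kernel

theorem return_parse : ∀ s < codingState.states, ∀ s₁ < 2, returnModel.excludes
    (returnModel.withRev [[0, 1, 0, 3, 0], [0, 4], [0, 2], [1, 3], [1, 4], [2, 3], [2, 4]])
      (((List.range stateAlphabet.size).filter fun a => stateAlphabet.src a = s).map
        fun a => codingState.φ a ++ codingState.W (stateAlphabet.dst a)) s₁ 0
      (codingState.W s) = true := by decide +kernel

end TernaryRich

namespace TernaryRich

/-! ### Rich ternary words -/

theorem segment_succ {A : Type*} (w : ℕ → A) (k n : ℕ) :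
    segment w k (n + 1) = segment w k n ++ [w (k + n)] := by
  rw [segment, List.ofFn_succ', List.concat_eq_append]; rfl

theorem length_segment {A : Type*} (w : ℕ → A) (k n : ℕ) : (segment w k n).length = n := by
  simp [segment]

theorem getElem_segment {A : Type*} (w : ℕ → A) (k n j : ℕ) (h : j < (segment w k n).length) :
    (segment w k n)[j] = w (k + j) := by
  simp [segment]

theorem segment_infix {A : Type*} (w : ℕ → A) {k n t m : ℕ} (h : k ≤ t) (h' : t + m ≤ k + n) :
    segment w t m <:+: segment w k n := by
  refine ⟨segment w k (t - k), segment w (t + m) (k + n - (t + m)), ?_⟩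
  refine List.ext_getElem (by simp [length_segment]; omega) fun j h1 h2 => ?_
  rw [getElem_segment]
  rw [List.getElem_append]
  split_ifs with h3
  · rw [List.getElem_append]
    split_ifs with h4
    · rw [getElem_segment]
    · rw [getElem_segment]; congr 1; simp only [length_segment] at *; omega
  · rw [getElem_segment]; congr 1; simp only [List.length_append, length_segment] at *; omega

/-- One more letter raises the number of palindromes by one. A palindrome that is new must be a
suffix, and it cannot occur earlier. -/
theorem rich_of_isRichInf {z : ℕ → Fin 3} (hz : IsRichInf z) :
    plainAlphabet.Rich fun i => (z i).val := by
  intro i e hie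
  obtain ⟨n, rfl⟩ := Nat.exists_eq_add_of_le hie
  cases n with
  | zero => exact ⟨i, le_rfl, le_rfl, fun a b ha hb hab => by omega, fun t ht ht' => by omega⟩
  | succ n =>
    have h1 := hz (segment z i (n + 1)) ⟨_, _, rfl⟩
    have h2 := hz (segment z i n) ⟨_, _, rfl⟩
    rw [IsRich, length_segment] at h1 h2
    obtain ⟨p, ⟨hp, hpal⟩, hp'⟩ : ∃ p, p ∈ {p | p <:+: segment z i (n + 1) ∧ p.reverse = p} ∧
        p ∉ {p | p <:+: segment z i n ∧ p.reverse = p} := by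
      by_contra hc
      push Not at hc
      -- The cardinality `n + 1` is positive, so the set is finite and `ncard` is not the default
      -- value 0.
      have := Set.ncard_le_ncard hc (Set.finite_of_ncard_pos (by omega))
      omega
    have hp' : ¬ p <:+: segment z i n := fun h => hp' ⟨h, hpal⟩
    rw [segment_succ, List.infix_concat_iff] at hp
    have hs := hp.resolve_right hp'
    rw [← segment_succ] at hs
    have hl := hs.length_le
    rw [length_segment] at hl
    have hget : ∀ j (hj : j < p.length), p[j] = z (i + (n + 1) - p.length + j) := by
      intro j hj
      obtain ⟨q, hq⟩ := hs
      have hlen := congrArg List.length hq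
      rw [List.length_append, length_segment] at hlen
      have : (q ++ p)[q.length + j]'(by simp; omega) = p[j] := by
        rw [List.getElem_append_right (by omega)]; simp
      rw [← this]
      simp only [hq, getElem_segment]
      congr 1; omega
    refine ⟨i + (n + 1) - p.length, by omega, by omega, fun a b ha hb hab => ?_,
      fun t ht ht' hsame => hp' ?_⟩
    · have h3 := hget (a - (i + (n + 1) - p.length)) (by omega)
      have h4 := hget (b - (i + (n + 1) - p.length)) (by omega)
      rw [Nat.add_sub_cancel' ha] at h3
      rw [Nat.add_sub_cancel' hb] at h4
      have h5 : p[b - (i + (n + 1) - p.length)]'(by omega) =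
          p.reverse[b - (i + (n + 1) - p.length)]'(by simp; omega) := by simp only [hpal]
      rw [List.getElem_reverse] at h5
      change (z b).val = (z a).val
      rw [← h3, ← h4, h5]
      congr 2; omega
    · have hpt : p = segment z t p.length := by
        refine List.ext_getElem (by rw [length_segment]) fun j hj hj' => ?_
        rw [hget j hj, getElem_segment]
        exact Fin.ext (hsame.2 j (by omega)).symm
      rw [hpt]
      exact segment_infix z ht (by omega)

theorem powerBound_of_powerFree {z : ℕ → Fin 3} (hz : PowerFree (16 / 7 : ℝ) z) :
    plainAlphabet.PowerBound plainModel.wt 0 (maskEps plainModel.mask 0) fun i => (z i).val := by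
  intro i e q l r hr hl hr'
  have hε : ∀ a b, maskEps plainModel.mask 0 a b = 0 := fun a b => by simp [maskEps]
  have hl : l = 0 := by
    rcases hl with h | ⟨_, _, h⟩
    · exact h
    · rw [h, hε]
  have hr' : r = 0 := by rcases hr' with h | h <;> simp [h, hε]
  subst hl hr'
  have hw : ∀ i e, wsum plainModel.wt (fun i => (z i).val) i e = e - i := fun i e => by
    simp [wsum, plainModel]
  rw [hw, hw]
  obtain ⟨h1, h2, -, h4⟩ := hr
  by_contra hc
  refine hz (segment z i (e - i)) ⟨_, _, rfl⟩ ⟨_, ⟨q, ⟨h1, ?_, fun j hj => ?_⟩, rfl⟩, ?_⟩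
  · rw [length_segment]; omega
  · rw [length_segment] at hj
    rw [List.getElem?_eq_getElem (by rw [length_segment]; exact hj),
      List.getElem?_eq_getElem (by rw [length_segment]; omega), getElem_segment, getElem_segment]
    have := h4 (i + j) (by omega) (by omega)
    rw [← add_assoc, Fin.ext this]
  · rw [length_segment, le_div_iff₀ (by exact_mod_cast h1)]
    have : 16 * q ≤ 7 * (e - i) := by omega
    have : (16 : ℝ) * q ≤ 7 * (e - i : ℕ) := by exact_mod_cast this
    linarith

/-- A permutation of the letters, as a symmetry. -/
def permSymm (π : Equiv.Perm (Fin 3)) : plainAlphabet.Symm where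
  σ a := π (Fin.ofNat 3 a)
  lt a _ := (π _).isLt
  inj a ha b hb h := by
    have := congrArg Fin.val (π.injective (Fin.ext h))
    change a < 3 at ha
    change b < 3 at hb
    simpa [Nat.mod_eq_of_lt ha, Nat.mod_eq_of_lt hb] using this
  rv _ _ := rfl
  src _ _ _ _ := Iff.rfl

theorem permSymm_apply (π : Equiv.Perm (Fin 3)) (x : Fin 3) : (permSymm π).σ x.val = (π x).val :=
  congrArg (fun x => (π x).val) (Fin.ext (Nat.mod_eq_of_lt x.isLt))

theorem Alphabet.Symm.powerBound {S : Alphabet} (T : S.Symm) {w : ℕ → ℕ} {lam : ℕ} {ε : ℕ → ℕ → ℕ}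
    {y : ℕ → ℕ} (hp : S.IsPath y) (hw : ∀ a < S.size, w (T.σ a) = w a)
    (hε : ∀ a < S.size, ∀ b < S.size, ε (T.σ a) (T.σ b) = ε a b) (h : S.PowerBound w lam ε y) :
    S.PowerBound w lam ε fun i => T.σ (y i) := by
  intro i e q l r hr hl hr'
  have hlt := fun i => (hp i).1
  simp only [hε _ (hlt _) _ (hlt _)] at hl hr'
  rw [T.wsum hp hw, T.wsum hp hw]
  exact h i e q l r (T.run hp hr) hl hr'

namespace Coding.Decodes
variable {S S' : Alphabet} {C : Coding S S'} {y y' pos : ℕ → ℕ}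

theorem occ_flatMap (D : C.Decodes y y' pos) {v : List ℕ} {i : ℕ} (h : Occ y' v i) :
    Occ y (v.flatMap C.φ) (pos i) := by
  induction v generalizing i with
  | nil => trivial
  | cons a v ih =>
    rw [List.flatMap_cons, occ_append, ← h.1, ← D.succ]
    exact ⟨D.block i, ih h.2⟩

/-- Code words are nonempty, so code word number `i` begins at position `i` or later and late
occurrences stay late. -/
theorem evAvoids (D : C.Decodes y y' pos) {u v : List ℕ} (o : ℕ) (h : EvAvoids y u)
    (ho : o ≤ (v.flatMap C.φ).length) (huv : u <+: (v.flatMap C.φ).drop o) : EvAvoids y' v := by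
  obtain ⟨N, hN⟩ := Filter.eventually_atTop.1 h
  refine Filter.eventually_atTop.2 ⟨N, fun i hi hv => ?_⟩
  have := D.mono.id_le i
  refine hN (pos i + o) ?_ (((D.occ_flatMap hv).drop ho).of_prefix huv)
  simp only [id] at this
  omega

end Coding.Decodes

theorem EvAvoids.shift {y : ℕ → ℕ} {u : List ℕ} (h : EvAvoids y u) (k : ℕ) :
    EvAvoids (fun t => y (k + t)) u := by
  obtain ⟨N, hN⟩ := Filter.eventually_atTop.1 h
  exact Filter.eventually_atTop.2 ⟨N, fun i hi => by rw [occ_shift]; exact hN _ (by omega)⟩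

/-- A rich word of low exponent over the return words to `0` in which certain letters do not meet is
the code of a word with states. -/
theorem exists_decodes_state {y : ℕ → ℕ} (hy : returnModel.Good y)
    (h : ∀ v ∈ [[1, 3], [1, 4], [2, 3], [2, 4]], EvAvoids y v) :
    ∃ k v pos, codingState.Decodes (fun t => y (k + t)) v pos := by
  have h1 := hy.chain h (by decide)
    (by decide) return_chain
  have h2 : ∀ v ∈ [[0, 1, 0, 3, 0], [0, 4], [0, 2], [1, 3], [1, 4], [2, 3], [2, 4]],
      EvAvoids y v := by
    simp only [List.mem_cons, List.not_mem_nil, or_false, forall_eq_or_imp, forall_eq] at h h1 ⊢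
    tauto
  refine hy.exists_decodes codingState h2 (by decide) ?_ return_parse
  by_contra hc
  push Not at hc
  have a0 : EvAvoids y [0, 1, 2, 1, 0] := hc 0 Nat.zero_lt_two
  have a1 : EvAvoids y [0, 3, 4, 3, 0] := hc 1 Nat.one_lt_two
  refine hy.false_of_chain ?_ (by decide) (by simp) return_mark
    ⟨0, by decide⟩
  simp only [List.mem_cons, List.not_mem_nil, or_false, forall_eq_or_imp, forall_eq] at h2 ⊢
  tauto

theorem return_false {y : ℕ → ℕ} (hy : returnModel.Good y) (h3 : EvAvoids y [0, 3])
    (h4 : EvAvoids y [0, 4]) : False :=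
  hy.false_of_chain (F := [[0, 3], [0, 4]]) (by simp [h3, h4])
    (by decide) (by decide)
    return_dead ⟨0, by decide⟩

theorem exists_decodes_of_avoids {y : ℕ → ℕ} (hp : plainAlphabet.IsPath y)
    (hR : plainAlphabet.Rich y)
    (hP : plainAlphabet.PowerBound plainModel.wt 0 (maskEps plainModel.mask 0) y)
    (h12 : EvAvoids y [1, 2]) :
    ∃ k y' pos k' v pos', codingReturn.Decodes (fun t => y (k + t)) y' pos ∧
      codingState.Decodes (fun t => y' (k' + t)) v pos' := by
  have hy : plainModel.Good y := Model.good_of_powerBound rfl hp hR hP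
  obtain ⟨k, y', pos, D⟩ := hy.exists_decodes codingReturn (F := [[1, 2]]) (by simpa using h12)
    (by decide) (by
      by_contra hc
      push Not at hc
      have a0 : EvAvoids y [0] := hc 0 Nat.one_pos
      exact hy.false_of_chain (F := [[1, 2], [0]]) (by simp [h12, a0])
        (by decide) (by simp) plain_mark ⟨0, by decide⟩) plain_parse
  have hR' := D.rich (hR.shift k)
  have hP' := powerBound_codingReturn D (hP.shift k)
  have hy' : returnModel.Good y' := Model.good_of_powerBound rfl D.path' hR' hP'
  have key : EvAvoids y' [1, 3] ∧ EvAvoids y' [1, 4] ∧ EvAvoids y' [2, 3] ∧ EvAvoids y' [2, 4] := by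
    -- Around the letter 0, one of 001, 102, 002 dies out. The middle case says that 01, 011 are not
    -- followed by 02, 022.
    rcases hR.triangle hp (p := [0]) (σ := 0) (a := 0) (b := 1) (c := 2) rfl
      (by decide) (by decide) (by decide) (by decide) (by decide) (by decide) (by decide)
      with h | h | h
    · refine (return_false (Alphabet.Symm.good (M := returnModel) returnSwap
        (by decide) (by decide +kernel) hy') ?_ ?_).elim
      · exact returnSwap.evAvoids (u := [0, 1]) hy'.path (by decide)
          (D.evAvoids 0 (h.shift k) (by decide) (by decide))
      · exact returnSwap.evAvoids (u := [0, 2]) hy'.path (by decide)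
          (D.evAvoids 0 (h.shift k) (by decide) (by decide))
    · exact ⟨D.evAvoids 1 (h.shift k) (by decide) (by decide),
        D.evAvoids 1 (h.shift k) (by decide) (by decide),
        D.evAvoids 2 (h.shift k) (by decide) (by decide),
        D.evAvoids 2 (h.shift k) (by decide) (by decide)⟩
    · exact (return_false hy' (D.evAvoids 0 (h.shift k) (by decide) (by decide))
        (D.evAvoids 0 (h.shift k) (by decide) (by decide))).elim
  obtain ⟨k', v, pos', D'⟩ := exists_decodes_state hy' (by simpa using key)
  exact ⟨k, y', pos, k', v, pos', D, D'⟩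

/-- A word with states that satisfies what the morphism `f` preserves. -/
structure StateWord (v : ℕ → ℕ) : Prop where
  path : stateAlphabet.IsPath v
  rich : stateAlphabet.Rich v
  bound : ConeBound v

/-- The decoded word meets the same conditions, which is what permits unlimited desubstitution. -/
theorem StateWord.step {v : ℕ → ℕ} (h : StateWord v) :
    ∃ k v' pos, codingF.Decodes (fun t => v (k + t)) v' pos ∧ StateWord v' := by
  obtain ⟨k, v', pos, D⟩ := sieve_cone.exists_decodes (h.bound.good h.path h.rich)
  exact ⟨k, v', pos, D, D.path', D.rich (h.rich.shift k), (h.bound.shift k).step D⟩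

/-- The decoding of a rich word of low exponent. -/
theorem exists_stateWord {z : ℕ → Fin 3} (hfree : PowerFree (16 / 7 : ℝ) z) (hrich : IsRichInf z) :
    ∃ (π : Equiv.Perm (Fin 3)) (k₁ : ℕ) (y₁ pos₁ : ℕ → ℕ) (k₂ : ℕ) (y₂ pos₂ : ℕ → ℕ) (k₃ : ℕ)
      (v pos₃ : ℕ → ℕ), codingReturn.Decodes (fun t => (π (z (k₁ + t))).val) y₁ pos₁ ∧
      codingState.Decodes (fun t => y₁ (k₂ + t)) y₂ pos₂ ∧
      codingF.Decodes (fun t => y₂ (k₃ + t)) v pos₃ ∧ StateWord v := by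
  have hp : plainAlphabet.IsPath fun i => (z i).val := fun i => ⟨(z i).isLt, rfl⟩
  have hR := rich_of_isRichInf hrich
  have hP := powerBound_of_powerFree hfree
  obtain ⟨π, hπ⟩ : ∃ π : Equiv.Perm (Fin 3), EvAvoids (fun i => (π (z i)).val) [1, 2] := by
    have h := fun (π : Equiv.Perm (Fin 3)) (u : List ℕ) (hu : ∀ a ∈ u, a < 3)
      (h : EvAvoids (fun i => (z i).val) u) => (permSymm π).evAvoids hp hu h
    simp only [permSymm_apply] at h
    rcases hR.triangle hp (p := []) (σ := 0) (a := 0) (b := 1) (c := 2) rfl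
      (by decide) (by decide) (by decide) (by decide) (by decide) (by decide) (by decide)
      with h1 | h1 | h1
    -- The rotation maps 0, 1 to 1, 2.
    · refine ⟨finRotate 3, ?_⟩
      have := h (finRotate 3) [0, 1] (by decide) h1
      rwa [show [0, 1].map (permSymm (finRotate 3)).σ = [1, 2] by decide +kernel] at this
    · exact ⟨1, h1⟩
    · refine ⟨Equiv.swap 0 1, ?_⟩
      have := h (Equiv.swap 0 1) [0, 2] (by decide) h1
      rwa [show [0, 2].map (permSymm (Equiv.swap 0 1)).σ = [1, 2] by decide +kernel] at this
  have hp' := (permSymm π).isPath hp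
  have hR' := (permSymm π).rich hp hR
  have hP' := (permSymm π).powerBound hp (fun _ _ => rfl) (fun a _ b _ => by simp [maskEps]) hP
  simp only [permSymm_apply] at hp' hR' hP'
  obtain ⟨k₁, y₁, pos₁, k₂, y₂, pos₂, D₁, D₂⟩ := exists_decodes_of_avoids hp' hR' hP' hπ
  have hR₁ := D₁.rich (hR'.shift k₁)
  have hP₁ := powerBound_codingReturn D₁ (hP'.shift k₁)
  have hR₂ := D₂.rich (hR₁.shift k₂)
  have hP₂ := powerBound_codingState D₂ (hP₁.shift k₂)
  obtain ⟨k₃, v, pos₃, D₃⟩ := sieve_linear.exists_decodes (y := y₂) (by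
    refine Model.good_of_powerBound (c := 2) rfl D₂.path' hR₂ ?_
    have : (stateModel (stateWt 8 11 8) (linViol 10 2)).wt = stateWt 8 11 8 :=
      funext fun x => by simp [stateModel, stateWt]
    rw [this]
    exact hP₂)
  -- Decoding by f once takes the weights (8, 11, 8) to the first generator (19, 24, 16), hence the
  -- coordinates 1, 0, 0. The overlap 10 + 8 exceeds the 16 required.
  refine ⟨π, k₁, y₁, pos₁, k₂, y₂, pos₂, k₃, v, pos₃, D₁, D₂, D₃, D₃.path', D₃.rich (hR₂.shift k₃),
    1, 0, 0, ?_⟩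
  have := powerBound_codingF D₃ (lam' := 16) (e' := 8) (hP₂.shift k₃) (by norm_num) (by norm_num)
  norm_num at this ⊢
  exact this

end TernaryRich

namespace TernaryRich

/-! ### Concatenations of blocks -/

/-- `y` is the concatenation of the blocks `B i`, which begin at the positions `P i`. -/
structure Reads {A : Type*} (y : ℕ → A) (B : ℕ → List A) (P : ℕ → ℕ) : Prop where
  zero : P 0 = 0
  succ : ∀ i, P (i + 1) = P i + (B i).length
  ne : ∀ i, B i ≠ []
  occ : ∀ i, Occ y (B i) (P i)

theorem Occ.map {A A' : Type*} {y : ℕ → A} {u : List A} {i : ℕ} (h : Occ y u i) (φ : A → A') :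
    Occ (fun t => φ (y t)) (u.map φ) i := by
  induction u generalizing i with
  | nil => trivial
  | cons a u ih => exact ⟨congrArg φ h.1, ih h.2⟩

namespace Reads
variable {A A' : Type*} {y y₂ : ℕ → A} {B : ℕ → List A} {P P₂ : ℕ → ℕ}

theorem mono (R : Reads y B P) : StrictMono P :=
  strictMono_nat_of_lt_succ fun i => by
    have := List.length_pos_of_ne_nil (R.ne i)
    rw [R.succ]; omega

theorem map (R : Reads y B P) (φ : A → A') :
    Reads (fun t => φ (y t)) (fun i => (B i).map φ) P where
  zero := R.zero
  succ i := by rw [R.succ, List.length_map]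
  ne i := by simpa using R.ne i
  occ i := (R.occ i).map φ

theorem shift (R : Reads y B P) (k : ℕ) :
    Reads (fun t => y (P k + t)) (fun i => B (k + i)) (fun i => P (k + i) - P k) where
  zero := by simp
  succ i := by
    have := R.mono.monotone (Nat.le_add_right k i)
    rw [← add_assoc, R.succ]; omega
  ne i := R.ne _
  occ i := by
    have := R.mono.monotone (Nat.le_add_right k i)
    rw [occ_shift, Nat.add_sub_cancel' this]
    exact R.occ _

theorem pos_eq (R : Reads y B P) (R₂ : Reads y₂ B P₂) (i : ℕ) : P i = P₂ i := by
  induction i with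
  | zero => rw [R.zero, R₂.zero]
  | succ i ih => rw [R.succ, R₂.succ, ih]

theorem unique (R : Reads y B P) (R₂ : Reads y₂ B P₂) : y = y₂ := by
  funext t
  obtain ⟨i, hi, hi'⟩ : ∃ i, P i ≤ t ∧ t < P (i + 1) := by
    have hex : ∃ i, t < P (i + 1) := ⟨t, (Nat.lt_succ_self t).trans_le (R.mono.id_le (t + 1))⟩
    refine ⟨Nat.find hex, ?_, Nat.find_spec hex⟩
    rcases hf : Nat.find hex with _ | k
    · rw [R.zero]; omega
    · have := Nat.find_min hex (m := k) (by omega)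
      omega
  rw [R.succ] at hi'
  obtain ⟨j, rfl⟩ := Nat.exists_eq_add_of_le hi
  have h1 := (occ_iff ..).1 (R.occ i) j (by omega)
  have h2 := (occ_iff ..).1 (R₂.occ i) j (by omega)
  rw [h1, R.pos_eq R₂, h2]

theorem occ_flatMap {x : ℕ → A'} {φ : A' → List A} (R : Reads y (fun i => φ (x i)) P)
    {u : List A'} {i : ℕ} (h : Occ x u i) :
    Occ y (u.flatMap φ) (P i) ∧ P (i + u.length) = P i + (u.flatMap φ).length := by
  induction u generalizing i with
  | nil => exact ⟨trivial, rfl⟩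
  | cons a u ih =>
    obtain ⟨h1, h2⟩ := ih h.2
    have hs := R.succ i
    have ho := R.occ i
    simp only [h.1] at hs ho
    rw [List.flatMap_cons, occ_append, ← hs, List.length_cons, List.length_append,
      show i + (u.length + 1) = i + 1 + u.length by ring, h2, hs]
    rw [hs] at h1
    exact ⟨⟨ho, h1⟩, by ring⟩

theorem comp {x : ℕ → A'} {φ : A' → List A} {B : ℕ → List A'} {Q : ℕ → ℕ}
    (R : Reads y (fun i => φ (x i)) P) (R' : Reads x B Q) :
    Reads y (fun i => (B i).flatMap φ) (fun i => P (Q i)) where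
  zero := by rw [R'.zero, R.zero]
  succ i := by rw [R'.succ, (R.occ_flatMap (R'.occ i)).2]
  ne i := by
    have h := (R.occ_flatMap (R'.occ i)).2
    rw [← R'.succ] at h
    have := R.mono (R'.mono (Nat.lt_add_one i))
    intro hc
    rw [hc, List.length_nil] at h
    omega
  occ i := (R.occ_flatMap (R'.occ i)).1

end Reads

theorem Coding.Decodes.reads {S S' : Alphabet} {C : Coding S S'} {y y' pos : ℕ → ℕ}
    (D : C.Decodes y y' pos) : Reads y (fun i => C.φ (y' i)) pos where
  zero := D.zero
  succ := D.succ
  ne i := C.φ_ne _ (D.path' i).1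
  occ := D.block

/-- The letter at `i` is taken from the first `i + 1` blocks, but any longer concatenation has the
same letter there. -/
theorem reads_infConcat {B : ℕ → List (Fin 3)} (hB : ∀ i, B i ≠ []) :
    Reads (infConcat B) B fun i => ((List.range i).flatMap B).length := by
  have hs : ∀ i, ((List.range (i + 1)).flatMap B).length =
      ((List.range i).flatMap B).length + (B i).length := fun i => by
    rw [List.range_succ, List.flatMap_append, List.length_append, List.flatMap_singleton]
  have hle : ∀ i, i ≤ ((List.range i).flatMap B).length := fun i => by
    induction i with
    | zero => exact Nat.zero_le _
    | succ i ih =>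
      have := List.length_pos_of_ne_nil (hB i)
      rw [hs]; omega
  have hpre : ∀ i k, i ≤ k → (List.range i).flatMap B <+: (List.range k).flatMap B := by
    intro i k hik
    induction k, hik using Nat.le_induction with
    | base => exact List.prefix_rfl
    | succ k _ ih =>
      refine ih.trans ?_
      rw [List.range_succ, List.flatMap_append]
      exact List.prefix_append _ _
  refine ⟨rfl, hs, hB, fun i => (occ_iff ..).2 fun j hj => ?_⟩
  have h1 := hle i
  have h2 := hpre (i + 1) (((List.range i).flatMap B).length + j + 1) (by omega)
  have h3 : ((List.range i).flatMap B).length + j < ((List.range (i + 1)).flatMap B).length := by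
    rw [hs]; omega
  rw [infConcat, List.getD_eq_getElem _ _ (h3.trans_le h2.length_le), ← h2.getElem h3]
  simp only [List.range_succ, List.flatMap_append, List.flatMap_singleton]
  rw [List.getElem_append_right (by omega)]
  simp

theorem infConcat_congr {B B' : ℕ → List (Fin 3)} {n : ℕ} (h : ∀ i < n, B i = B' i) {i : ℕ}
    (hi : i < n) : infConcat B i = infConcat B' i := by
  have : (List.range (i + 1)).flatMap B = (List.range (i + 1)).flatMap B' :=
    List.flatMap_congr fun k hk => h k (by rw [List.mem_range] at hk; omega)
  rw [infConcat, infConcat, this]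

end TernaryRich

namespace TernaryRich

/-! ### The morphisms and the transducer -/

theorem f_ne (a : Fin 3) : f a ≠ [] := by revert a; decide

theorem g_ne (a : Fin 3) : g a ≠ [] := by revert a; decide

theorem reads_applyInf {h : Fin 3 → List (Fin 3)} (hne : ∀ a, h a ≠ []) (x : ℕ → Fin 3) :
    ∃ P, Reads (applyInf h x) (fun i => h (x i)) P :=
  ⟨_, reads_infConcat fun _ => hne _⟩

theorem applyInf_suffix {h : Fin 3 → List (Fin 3)} (hne : ∀ a, h a ≠ []) (x : ℕ → Fin 3) (k : ℕ) :
    ∃ m, applyInf h (suffix x k) = suffix (applyInf h x) m := by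
  obtain ⟨P, R⟩ := reads_applyInf hne x
  obtain ⟨P', R'⟩ := reads_applyInf hne (suffix x k)
  exact ⟨P k, R'.unique (R.shift k)⟩

theorem suffix_suffix {A : Type*} (w : ℕ → A) (k m : ℕ) :
    suffix (suffix w k) m = suffix w (k + m) := by
  funext i; simp [suffix, add_assoc]

theorem iterate_applyInf_suffix {h : Fin 3 → List (Fin 3)} (hne : ∀ a, h a ≠ []) (n : ℕ)
    (x : ℕ → Fin 3) (k : ℕ) :
    ∃ m, (applyInf h)^[n] (suffix x k) = suffix ((applyInf h)^[n] x) m := by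
  induction n generalizing x k with
  | zero => exact ⟨k, rfl⟩
  | succ n ih =>
    obtain ⟨m, hm⟩ := applyInf_suffix hne x k
    rw [Function.iterate_succ_apply, hm, Function.iterate_succ_apply]
    exact ih _ m

/-- The exchange of the letters `1` and `2`. -/
def swap12 : Equiv.Perm (Fin 3) := Equiv.swap 1 2

/-- What the transducer puts out on a letter that it reads at position `i`. -/
def tauLetter (i : ℕ) (a : Fin 3) : List (Fin 3) := if Even i then t₁ a else t₂ a

theorem tauLetter_ne (i : ℕ) (a : Fin 3) : tauLetter i a ≠ [] := by
  unfold tauLetter; split_ifs <;> revert a <;> decide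

theorem reads_tau (w : ℕ → Fin 3) : ∃ P, Reads (tau w) (fun i => tauLetter i (w i)) P :=
  ⟨_, reads_infConcat fun _ => tauLetter_ne _ _⟩

theorem map_tauLetter (i : ℕ) (a : Fin 3) : (tauLetter i a).map swap12 = tauLetter (i + 1) a := by
  by_cases h : Even i
  · simp only [tauLetter, h, Nat.even_add_one, if_true, not_true, if_false]; revert a; decide
  · simp only [tauLetter, h, Nat.even_add_one, if_false, not_false_eq_true, if_true]
    revert a; decide

/-- After an odd number of input letters the transducer is in the other state, and exchanging 1 and
2 exchanges its two outputs. -/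
theorem tau_suffix (w : ℕ → Fin 3) (k : ℕ) :
    ∃ m, ∃ ρ : Equiv.Perm (Fin 3), suffix (tau w) m = ρ ∘ tau (suffix w k) := by
  obtain ⟨P, R⟩ := reads_tau w
  obtain ⟨P', R'⟩ := reads_tau (suffix w k)
  refine ⟨P k, ?_⟩
  have hR := R.shift k
  rcases Nat.even_or_odd k with hk | hk
  · refine ⟨1, ?_⟩
    have : (fun i => tauLetter (k + i) (w (k + i))) = fun i => tauLetter i (suffix w k i) := by
      funext i; simp [tauLetter, Nat.even_add, hk, suffix]
    rw [this] at hR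
    exact hR.unique R'
  · refine ⟨swap12, ?_⟩
    have : (fun i => tauLetter (k + i) (w (k + i))) =
        fun i => (tauLetter i (suffix w k i)).map swap12 := by
      funext i
      rw [map_tauLetter]
      rw [← Nat.not_even_iff_odd] at hk
      simp [tauLetter, Nat.even_add, hk, suffix]
    rw [this] at hR
    exact hR.unique (R'.map swap12)

/-- What the transducer puts out on a word that begins at position `i`. -/
def tauWord : ℕ → List (Fin 3) → List (Fin 3)
  | _, [] => []
  | i, a :: u => tauLetter i a ++ tauWord (i + 1) u

theorem map_tauWord (i : ℕ) (u : List (Fin 3)) : (tauWord i u).map swap12 = tauWord (i + 1) u := by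
  induction u generalizing i with
  | nil => rfl
  | cons a u ih => rw [tauWord, List.map_append, map_tauLetter, ih]; rfl

theorem tauWord_mod_two (i : ℕ) (u : List (Fin 3)) : tauWord (i % 2) u = tauWord i u := by
  have : ∀ k i u, tauWord (i + 2 * k) u = tauWord i u := by
    intro k i u
    induction u generalizing i with
    | nil => rfl
    | cons a u ih =>
      rw [tauWord, tauWord, add_right_comm, ih]
      simp [tauLetter, Nat.even_add]
  conv_rhs => rw [← Nat.mod_add_div i 2]
  rw [this]

theorem Reads.tauWord {w : ℕ → Fin 3} {P : ℕ → ℕ} (R : Reads (tau w) (fun i => tauLetter i (w i)) P)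
    {u : List (Fin 3)} {i : ℕ} (h : Occ w u i) : Occ (tau w) (tauWord i u) (P i) ∧
      P (i + u.length) = P i + (TernaryRich.tauWord i u).length := by
  induction u generalizing i with
  | nil => exact ⟨trivial, rfl⟩
  | cons a u ih =>
    obtain ⟨h1, h2⟩ := ih h.2
    have hs := R.succ i
    have ho := R.occ i
    simp only [h.1] at hs ho
    rw [TernaryRich.tauWord, occ_append, ← hs, List.length_cons, List.length_append,
      show i + (u.length + 1) = i + 1 + u.length by ring, h2, hs]
    rw [hs] at h1
    exact ⟨⟨ho, h1⟩, by ring⟩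

theorem reads_tau_applyInf {h : Fin 3 → List (Fin 3)} {x : ℕ → Fin 3} {P : ℕ → ℕ}
    (R : Reads (applyInf h x) (fun i => h (x i)) P) :
    ∃ Q, Reads (tau (applyInf h x)) (fun i => tauWord (P i) (h (x i))) Q := by
  obtain ⟨Q, R'⟩ := reads_tau (applyInf h x)
  have hk := fun i => R'.tauWord (R.occ i)
  refine ⟨fun i => Q (P i), ?_, fun i => ?_, fun i hc => ?_, fun i => (hk i).1⟩
  · rw [R.zero, R'.zero]
  · rw [R.succ, (hk i).2]
  · have h := (hk i).2
    rw [← R.succ, hc, List.length_nil] at h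
    have := R'.mono (R.mono (Nat.lt_add_one i))
    omega

/-! ### The structure theorem -/

/-- The letter with its state forgotten. -/
def forget (a : ℕ) : Fin 3 := Fin.ofNat 3 a

theorem forget_val (x : Fin 3) : forget x.val = x := Fin.ext (Nat.mod_eq_of_lt x.isLt)

theorem applyInf_f_of_decodes {y v pos : ℕ → ℕ} (D : codingF.Decodes y v pos) :
    (fun t => forget (y t)) = applyInf f fun t => forget (v t) := by
  obtain ⟨P, R⟩ := reads_applyInf f_ne fun t => forget (v t)
  refine Reads.unique (B := fun i => f (forget (v i))) (P := pos) ?_ R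
  convert D.reads.map forget using 2 with i
  have : ∀ a < 6, f (forget a) = (codingF.φ a).map forget := by decide
  exact this _ (D.path' i).1

/-- At each level another f is split off. The suffix lost in decoding becomes a suffix of the image
under f, g and τ, with a further permutation if the cut falls at an odd position of the input of τ.
-/
theorem exists_suffix {z : ℕ → Fin 3} (hfree : PowerFree (16 / 7 : ℝ) z) (hrich : IsRichInf z)
    (n : ℕ) : ∃ (π : Equiv.Perm (Fin 3)) (v : ℕ → ℕ) (k : ℕ), StateWord v ∧
      suffix z k = π ∘ tau (applyInf g ((applyInf f)^[n] fun t => forget (v t))) := by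
  induction n with
  | zero =>
    obtain ⟨π, k₁, y₁, pos₁, k₂, y₂, pos₂, k₃, v, pos₃, D₁, D₂, D₃, hv⟩ :=
      exists_stateWord hfree hrich
    have R₂ := Reads.comp (φ := fun a => (codingState.φ a).flatMap codingReturn.φ)
      (((D₁.reads.shift k₂).comp D₂.reads).shift k₃) D₃.reads
    have R := R₂.map forget
    simp only [forget_val] at R
    obtain ⟨P, Rg⟩ := reads_applyInf g_ne fun t => forget (v t)
    obtain ⟨Q, Rt⟩ := reads_tau_applyInf Rg
    -- Only `g(2)` has odd length, and only `2` and its copy change the state, so the state follows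
    -- the parity of the transducer.
    have hpar : ∀ i, P i % 2 = (stateAlphabet.src (v 0) + stateAlphabet.src (v i)) % 2 := by
      intro i
      induction i with
      | zero => rw [Rg.zero]; omega
      | succ i ih =>
        have hd : ∀ a < 6, (g (forget a)).length % 2 =
          (stateAlphabet.src a + stateAlphabet.dst a) % 2 := by decide
        have := hd _ (hv.path i).1
        rw [Rg.succ, ← (hv.path i).2]
        omega
    -- The block of a letter, spelt out through all three codings, is the output of τ on `g` of that
    -- letter. This is where τ and g come from.
    have hblock : ∀ a < 6, ((codingF.φ a).flatMap
        fun a => (codingState.φ a).flatMap codingReturn.φ).map forget = tauWord (stateAlphabet.src a) (g (forget a)) := by decide +kernel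
    have hsrc : ∀ a < 6, stateAlphabet.src a < 2 := by decide
    have h0 := hsrc _ (hv.path 0).1
    have hR : (fun i => ((codingF.φ (v i)).flatMap
        fun a => (codingState.φ a).flatMap codingReturn.φ).map forget) =
        fun i => tauWord (stateAlphabet.src (v i)) (g (forget (v i))) :=
      funext fun i => hblock _ (hv.path i).1
    rw [hR] at R
    have hs : stateAlphabet.src (v 0) = 0 ∨ stateAlphabet.src (v 0) = 1 := by omega
    obtain ⟨ρ, hρ⟩ : ∃ ρ : Equiv.Perm (Fin 3), (fun t => π (z (k₁ + (pos₁ k₂ +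
        (pos₁ (k₂ + pos₂ k₃) - pos₁ k₂ + t))))) =
        ρ ∘ tau (applyInf g fun t => forget (v t)) := by
      rcases hs with hs | hs
      · refine ⟨1, R.unique (P₂ := Q) ?_⟩
        have : (fun i => tauWord (P i) (g (forget (v i)))) =
            fun i => tauWord (stateAlphabet.src (v i)) (g (forget (v i))) := by
          funext i
          rw [← tauWord_mod_two, hpar, hs, zero_add, tauWord_mod_two]
        rw [← this]
        exact Rt
      · refine ⟨swap12, R.unique (P₂ := Q) ?_⟩
        have : (fun i => (tauWord (P i) (g (forget (v i)))).map swap12) =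
            fun i => tauWord (stateAlphabet.src (v i)) (g (forget (v i))) := by
          funext i
          rw [map_tauWord, ← tauWord_mod_two, Nat.add_mod, hpar, hs,
            ← tauWord_mod_two (stateAlphabet.src (v i))]
          congr 1
          omega
        rw [← this]
        exact Rt.map swap12
    refine ⟨ρ.trans π.symm, v, k₁ + (pos₁ k₂ + (pos₁ (k₂ + pos₂ k₃) - pos₁ k₂)), hv, ?_⟩
    funext t
    have := congrFun hρ t
    simp only [Function.comp_apply] at this
    simp only [suffix, Function.comp_apply, Function.iterate_zero, id, Equiv.trans_apply, ← this,
      Equiv.symm_apply_apply, add_assoc]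
  | succ n ih =>
    obtain ⟨π, v, k, hv, hk⟩ := ih
    obtain ⟨k', v', pos, D, hv'⟩ := hv.step
    have h1 : suffix (fun t => forget (v t)) k' = applyInf f fun t => forget (v' t) :=
      applyInf_f_of_decodes D
    obtain ⟨m₁, hm₁⟩ := iterate_applyInf_suffix f_ne n (fun t => forget (v t)) k'
    obtain ⟨m₂, hm₂⟩ := applyInf_suffix g_ne ((applyInf f)^[n] fun t => forget (v t)) m₁
    obtain ⟨m₃, ρ, hm₃⟩ := tau_suffix (applyInf g ((applyInf f)^[n] fun t => forget (v t))) m₂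
    refine ⟨ρ.trans π, v', k + m₃, hv', ?_⟩
    rw [Function.iterate_succ_apply, ← h1, hm₁, hm₂, ← suffix_suffix, hk]
    funext i
    have := congrFun hm₃ i
    simp only [suffix, Function.comp_apply] at this ⊢
    rw [this]; rfl

end TernaryRich

namespace TernaryRich

/-! ### The fixed point of `f` -/

theorem length_iterate_f (n : ℕ) : n < ((applyFin f)^[n] [0]).length := by
  have h2 : ∀ u : List (Fin 3), 2 * u.length ≤ (applyFin f u).length := fun u => by
    induction u with
    | nil => simp
    | cons a u ih =>
      have : 2 ≤ (f a).length := by revert a; decide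
      rw [applyFin] at ih ⊢
      rw [List.flatMap_cons, List.length_append, List.length_cons]
      omega
  induction n with
  | zero => simp
  | succ n ih =>
    rw [Function.iterate_succ_apply']
    have := h2 ((applyFin f)^[n] [0])
    omega

theorem occ_iterate {x : ℕ → Fin 3} {u : List (Fin 3)} (h : Occ x u 0) (n : ℕ) :
    Occ ((applyInf f)^[n] x) ((applyFin f)^[n] u) 0 := by
  induction n with
  | zero => exact h
  | succ n ih =>
    rw [Function.iterate_succ_apply', Function.iterate_succ_apply']
    obtain ⟨P, R⟩ := reads_applyInf f_ne ((applyInf f)^[n] x)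
    have := (R.occ_flatMap ih).1
    rwa [R.zero] at this

/-- Every image under f begins with 0, so one application produces the first letter 0 and the last
`i` applications turn it into the prefix `f^i(0)`, which is longer than `i`. -/
theorem iterate_applyInf_eq_fOmega {n i : ℕ} (h : i < n) (x : ℕ → Fin 3) :
    (applyInf f)^[n] x i = fOmega i := by
  obtain ⟨m, rfl⟩ := Nat.exists_eq_add_of_lt h
  rw [show i + m + 1 = i + (m + 1) by ring, Function.iterate_add_apply]
  have h0 : Occ ((applyInf f)^[m + 1] x) [0] 0 := by
    rw [Function.iterate_succ_apply']
    obtain ⟨P, R⟩ := reads_applyInf f_ne ((applyInf f)^[m] x)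
    have := R.occ 0
    rw [R.zero] at this
    have hf : ∀ a, f a = 0 :: (f a).tail := by decide
    rw [hf] at this
    exact ⟨this.1, trivial⟩
  have h1 := (occ_iff ..).1 (occ_iterate h0 i) i (length_iterate_f i)
  rw [zero_add] at h1
  rw [h1, fOmega, List.getD_eq_getElem _ _ (length_iterate_f i)]

theorem applyInf_congr {h : Fin 3 → List (Fin 3)} {x y : ℕ → Fin 3} {n : ℕ}
    (hxy : ∀ i < n, x i = y i) {i : ℕ} (hi : i < n) : applyInf h x i = applyInf h y i :=
  infConcat_congr (fun k hk => by rw [hxy k hk]) hi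

theorem tau_congr {x y : ℕ → Fin 3} {n : ℕ} (hxy : ∀ i < n, x i = y i) {i : ℕ} (hi : i < n) :
    tau x i = tau y i :=
  infConcat_congr (fun k hk => by rw [hxy k hk]) hi

end TernaryRich

/-! ### The theorem: suffixes at each level, and the factors common to all. -/

theorem theorem2 (z : ℕ → Fin 3)
    (hfree : TernaryRich.PowerFree (16 / 7 : ℝ) z)
    (hrich : TernaryRich.IsRichInf z) :
    (∀ n : ℕ, ∃ (π : Equiv.Perm (Fin 3)) (x : ℕ → Fin 3) (k : ℕ),
      TernaryRich.suffix z k =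
        π ∘ TernaryRich.tau
          (TernaryRich.applyInf TernaryRich.g ((TernaryRich.applyInf TernaryRich.f)^[n] x))) ∧
    (∃ π : Equiv.Perm (Fin 3), ∀ u : List (Fin 3),
      TernaryRich.IsFactor u
        (π ∘ TernaryRich.tau (TernaryRich.applyInf TernaryRich.g TernaryRich.fOmega)) →
      TernaryRich.IsFactor u z) := by
  have key : ∀ n : ℕ, ∃ (π : Equiv.Perm (Fin 3)) (x : ℕ → Fin 3) (k : ℕ),
      TernaryRich.suffix z k = π ∘ TernaryRich.tau
        (TernaryRich.applyInf TernaryRich.g ((TernaryRich.applyInf TernaryRich.f)^[n] x)) :=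
    fun n => by
      obtain ⟨π, v, k, -, h⟩ := TernaryRich.exists_suffix hfree hrich n
      exact ⟨π, _, k, h⟩
  refine ⟨key, ?_⟩
  choose π x k hk using key
  -- There are finitely many permutations, so one of them occurs at arbitrarily high levels.
  obtain ⟨ρ, hρ⟩ := Finite.exists_infinite_fiber π
  refine ⟨ρ, ?_⟩
  rintro u ⟨i, m, rfl⟩
  obtain ⟨n, hn, hlt⟩ := (Set.infinite_coe_iff.1 hρ).exists_gt (i + m)
  rw [Set.mem_preimage, Set.mem_singleton_iff] at hn
  refine ⟨k n + i, m, ?_⟩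
  refine List.ext_getElem (by simp [TernaryRich.segment]) fun j hj hj' => ?_
  rw [TernaryRich.length_segment] at hj
  rw [TernaryRich.getElem_segment, TernaryRich.getElem_segment]
  have h1 := congrFun (hk n) (i + j)
  simp only [TernaryRich.suffix, Function.comp_apply, hn] at h1
  rw [Function.comp_apply, add_assoc, h1]
  congr 1
  -- Letter images are nonempty, so the first `n` letters of an image depend on the first `n`
  -- letters of the word only.
  refine TernaryRich.tau_congr (n := n) (fun a ha => ?_) (by omega)
  refine TernaryRich.applyInf_congr (n := n) (fun b hb => ?_) ha
  exact (TernaryRich.iterate_applyInf_eq_fOmega hb _).symm
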